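/- Let $n\ge 2$. For $u\in W^{1,p}(\mathbb R^n)$, $1<p<n$ (real-valued), let $\nabla u$ be the weak gradient, $\|u\|_{W^{1,p}}=\|u\|_{L^p}+\|\nabla u\|_{L^p}$, and let $$\tilde u(x)=\limsup_{r\to 0^+}\frac1{|B(x,r)|}\int_{B(x,r)}u(z)\,dz\in[-\infty,\infty],\qquad x\in\mathbb R^n,$$ be its precise representative. For a Borel probability measure $\mu$ on $\mathbb R^n$ let $\mu_t(E)=\mu(E/t)$, $t>0$. For a function $v:\mathbb R^n\to[-\infty,\infty]$ defined at every point put $$\mathcal S_\mu v(x)=\sup_{t>0}\int_{\mathbb R^n}|v(z+x)|\,d\mu_t(z),$$ (integrals of non-measurable nonnegative functions, which occur only in (3), being read as lower integrals) and write $\mathcal S_\mu u:=\mathcal S_\mu\tilde u$ for $u\in W^{1,p}$. Further let $$\mathcal M u(x)=\sup_{r>0}\frac1{|B(x,r)|}\int_{B(x,r)}|u(z)|\,dz,\qquad \mathcal I|\nabla u|(x)=\int_{\mathbb R^n}\frac{|\nabla u(z)|}{|x-z|^{n-1}}\,dz,\qquad p^*=\frac{np}{n-p}.$$ Call $\mu$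 spherical-like with constants $R,M\in\mathbb R$ if $\operatorname{supp}\mu\subset\overline B(0,R)$ and $\mu(B(x,r))\le M r^{n-1}$ for all $x\in\mathbb R^n$, $r>0$. (1) There is a constant $C(n)>0$, depending only on $n$, such that for every Borel probability measure $\mu$ that is spherical-like with constants $R,M$, every $1<p<n$ and every $u\in W^{1,p}(\mathbb R^n)$, $$\mathcal S_\mu u(x)\le C(n)\,R^{n-1}M\,\bigl(\mathcal M u(x)+\mathcal I|\nabla u|(x)\bigr)\qquad\text{for every }x\in\mathbb R^n .$$ (2) For every spherical-like $\mu$ and every $1<p<n$ the operator $\mathcal S_\mu:W^{1,p}(\mathbb R^n)\to L^{p^*}(\mathbb R^n)$ is bounded: there is $K<\infty$ such that for all $u\in W^{1,p}(\mathbb R^n)$ the function $\mathcal S_\mu u$ is Lebesgue measurable and $\|\mathcal S_\mu u\|_{L^{p^*}}\le K\|u\|_{W^{1,p}}$. (3) This covers the spherical maximal operator and averages over boundaries of cubes: the normalized $(n-1)$-dimensional Hausdorff measures $\sigma$ on the unit sphere and $\tau$ on the boundary of $[-1,1]^n$ are spherical-like for suitable $R,M$, and for every $v:\mathbb R^n\to[-\infty,\infty]$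 and every $x\in\mathbb R^n$, $\mathcal S_\sigma v(x)$ is the supremum over $t>0$ of the $\mathcal H^{n-1}$-average of $|v|$ over the sphere of centre $x$ and radius $t$, while $\mathcal S_\tau v(x)$ is the supremum over $t>0$ of the $\mathcal H^{n-1}$-average of $|v|$ over the boundary of the cube $\{z:\max_i|z_i-x_i|\le t\}$. -/

import Mathlib

open MeasureTheory Filter Topology
open scoped ENNReal NNReal ContDiff

noncomputable section

namespace SphericalLike

/-- `ℝⁿ` with its Euclidean norm. -/
abbrev Rn (n : ℕ) : Type := EuclideanSpace ℝ (Fin n)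

/-- `g` is the weak gradient of `u` on `ℝⁿ`: the distributional derivative of `u` in every
direction `e` is `⟪g, e⟫`. -/
structure IsWeakGradient {n : ℕ} (u : Rn n → ℝ) (g : Rn n → Rn n) : Prop where
  locInt : LocallyIntegrable u volume
  locInt_grad : LocallyIntegrable g volume
  integral_eq : ∀ φ : Rn n → ℝ, ContDiff ℝ ∞ φ → HasCompactSupport φ → ∀ e : Rn n,
    ∫ x, u x * fderiv ℝ φ x e = -∫ x, inner ℝ (g x) e * φ x

/-- `u` belongs to `W^{1,p}(ℝⁿ)` and its weak gradient is (a.e.) `g`. -/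
structure IsSobolev {n : ℕ} (p : ℝ) (u : Rn n → ℝ) (g : Rn n → Rn n) : Prop where
  memLp : MemLp u (ENNReal.ofReal p) volume
  memLp_grad : MemLp g (ENNReal.ofReal p) volume
  weakGradient : IsWeakGradient u g

/-- The Sobolev norm `‖u‖_p + ‖∇u‖_p`, where `g` is the weak gradient of `u`. -/
def sobolevNorm {n : ℕ} (p : ℝ) (u : Rn n → ℝ) (g : Rn n → Rn n) : ℝ≥0∞ :=
  eLpNorm u (ENNReal.ofReal p) volume + eLpNorm g (ENNReal.ofReal p) volume

/-- The precise representative `x ↦ limsup_{r → 0⁺} ⨍_{B(x,r)} u`, defined at every point, with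
values in `[-∞, ∞]`. It depends only on the a.e. equivalence class of `u`. -/
def preciseRep {n : ℕ} (u : Rn n → ℝ) (x : Rn n) : EReal :=
  limsup (fun r : ℝ => ((⨍ z in Metric.ball x r, u z : ℝ) : EReal)) (𝓝[>] 0)

/-- `μ` is a probability measure with support in `closedBall 0 R` and `μ(B(x,r)) ≤ M r^{n-1}`. -/
structure IsSphericalLike {n : ℕ} (μ : Measure (Rn n)) (R M : ℝ) : Prop where
  isProbabilityMeasure : IsProbabilityMeasure μ
  support_subset : μ.support ⊆ Metric.closedBall 0 R
  measure_ball_le : ∀ (x : Rn n) (r : ℝ), 0 < r →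
    μ (Metric.ball x r) ≤ ENNReal.ofReal (M * r ^ (n - 1))

/-- The rescaled measure `μ_t`, `μ_t(E) = μ(E / t)`: the image of `μ` under `z ↦ t z`. -/
def rescale {n : ℕ} (μ : Measure (Rn n)) (t : ℝ) : Measure (Rn n) :=
  μ.map (fun z => t • z)

/-- The maximal operator `S_μ v (x) = sup_{t > 0} ∫ |v(z + x)| dμ_t(z)`, for a function `v` that is
defined at every point. -/
def maximalOp {n : ℕ} (μ : Measure (Rn n)) (v : Rn n → EReal) (x : Rn n) : ℝ≥0∞ :=
  ⨆ (t : ℝ) (_ : 0 < t), ∫⁻ z, (v (z + x)).abs ∂(rescale μ t)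

/-- The Hardy–Littlewood maximal function. -/
def hardyLittlewood {n : ℕ} (u : Rn n → ℝ) (x : Rn n) : ℝ≥0∞ :=
  ⨆ (r : ℝ) (_ : 0 < r), ⨍⁻ z in Metric.ball x r, ‖u z‖ₑ ∂volume

/-- The Riesz potential `I|g| (x) = ∫ |g(z)| / |x - z|^{n-1} dz`. -/
def rieszPotential {n : ℕ} (g : Rn n → Rn n) (x : Rn n) : ℝ≥0∞ :=
  ∫⁻ z, ‖g z‖ₑ / ‖x - z‖ₑ ^ (n - 1)

/-- The operator `S`, acting on precise representatives, is bounded from `W^{1,p}(ℝⁿ)` to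
`L^{p*}(ℝⁿ)`, where `p* = np / (n - p)`. -/
def BoundedSobolevLebesgue {n : ℕ} (p : ℝ) (S : (Rn n → EReal) → Rn n → ℝ≥0∞) : Prop :=
  ∃ K : ℝ≥0, ∀ (u : Rn n → ℝ) (g : Rn n → Rn n), IsSobolev p u g →
    MemLp (S (preciseRep u)) (ENNReal.ofReal (n * p / (n - p))) volume ∧
    eLpNorm (S (preciseRep u)) (ENNReal.ofReal (n * p / (n - p))) volume ≤ K * sobolevNorm p u g

/-- The closed cube with centre `x`, side length `2t` and sides parallel to the axes. -/
def cube {n : ℕ} (x : Rn n) (t : ℝ) : Set (Rn n) :=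
  {z | ∀ i, |z i - x i| ≤ t}

/-- `(n-1)`-dimensional Hausdorff measure on `A`, normalized to have total mass one. -/
def normalizedHausdorff {n : ℕ} (A : Set (Rn n)) : Measure (Rn n) :=
  ProbabilityTheory.cond (Measure.hausdorffMeasure ((n : ℝ) - 1)) A

/-- The spherical maximal operator. -/
def sphericalMaximal {n : ℕ} (v : Rn n → EReal) (x : Rn n) : ℝ≥0∞ :=
  ⨆ (t : ℝ) (_ : 0 < t), ⨍⁻ z in Metric.sphere x t, (v z).abs
    ∂(Measure.hausdorffMeasure ((n : ℝ) - 1))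

/-- The maximal operator of averages over boundaries of cubes. -/
def cubeBoundaryMaximal {n : ℕ} (v : Rn n → EReal) (x : Rn n) : ℝ≥0∞ :=
  ⨆ (t : ℝ) (_ : 0 < t), ⨍⁻ z in frontier (cube x t), (v z).abs
    ∂(Measure.hausdorffMeasure ((n : ℝ) - 1))

end SphericalLike

end

/-! Everything rests on a trace inequality of Meyers–Ziemer type: if `ν(B(y,r)) ≤ A r^{n-1}` for all
balls, then `∫ |f| dν ≤ C A ∫ |∇f|` for `f ∈ C¹_c`, with `C` depending only on `n`
(`exists_lintegral_enorm_le_lintegral_fderiv`). Its proof is a boxing argument. Every point of a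
superlevel set `{f > s}` is the centre of a ball in which that set has intermediate density, and a
relative isoperimetric inequality bounds `r^{n-1}` by the variation, in a concentric ball, of a
smoothed indicator of the set. A Vitali covering then bounds `ν{f > s}`, and integration in `s`
gives the claim; averages over thin slabs `{s ≤ f ≤ s + 1/k}` play the role of the coarea formula. A
cutoff localizes the inequality to measures carried by a ball of radius `L`, at the cost of a term
`L⁻¹ ∫_{B(x,2L)} |v|`.

The inequality passes to precise representatives without exceptional sets
(`exists_lintegral_preciseRep_le`). For `0 < r ≤ ρ` the average of `u` over `B(y,r)` differs from
the mollifications at `y` by a truncated potential of the mollified gradient, up to a limit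
inferior. The `ν`-integral of that potential is bounded independently of the mollification and tends
to `0` with `ρ`, because `p > 1`. Hence `∫ |ũ| dν` and `∫ |w| dν` differ by at most a trace-type
norm of `u - w` on a ball, for every `w ∈ C¹`.

Taking `w = 0` and for `ν` the image of `μ` under `z ↦ t z + x`, so that `A = M t^{1-n}` and `L = t
R`, all powers of `t` cancel and the pointwise estimate remains. Taking for `w` the mollifications
of `u` shows that `S_μ u` is lower semicontinuous, hence measurable.

For boundedness, `M u` is itself at most a constant times `I|∇u|`
(`hardyLittlewood_le_rieszPotential`), so only the Riesz potential has to be estimated in `L^{p*}`.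
This is the Hardy–Littlewood–Sobolev inequality, obtained from Hedberg's inequality and the `Lᵖ`
maximal theorem.

For the examples, the scaling factor of Hausdorff measure cancels in the normalization. The growth
bound holds on the boundary of the cube because it consists of `2n` flat faces, and it is carried to
the sphere by the bi-Lipschitz radial projection. -/

noncomputable section

namespace SphericalLike

variable {n : ℕ}

/-! ### Integration along rays and truncated potentials. -/

/-- `∫_r^ρ s⁻ⁿ ∫_{B(y,s)} h ds`. -/
def radialPotential (h : Rn n → ℝ≥0∞) (r ρ : ℝ) (y : Rn n) : ℝ≥0∞ :=
  ∫⁻ s in Set.Ioc r ρ, (ENNReal.ofReal s ^ n)⁻¹ * ∫⁻ w in Metric.ball y s, h w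

theorem volume_ball_eq (x : Rn n) {r : ℝ} (hr : 0 < r) :
    volume (Metric.ball x r) = ENNReal.ofReal r ^ n * volume (Metric.ball (0 : Rn n) 1) := by
  rw [Measure.addHaar_ball_of_pos volume x hr, finrank_euclideanSpace_fin,
    ENNReal.ofReal_pow hr.le]

theorem volume_unitBall_pos : 0 < volume (Metric.ball (0 : Rn n) 1) :=
  Metric.measure_ball_pos _ _ one_pos

theorem volume_unitBall_ne_zero : volume (Metric.ball (0 : Rn n) 1) ≠ 0 :=
  volume_unitBall_pos.ne'

theorem volume_unitBall_ne_top : volume (Metric.ball (0 : Rn n) 1) ≠ ⊤ :=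
  measure_ball_lt_top.ne

theorem enorm_sub_le_lintegral_fderiv {v : Rn n → ℝ} (hv : ContDiff ℝ 1 v) (y z : Rn n) {r ρ : ℝ}
    (h : r ≤ ρ) :
    ‖v (y + ρ • z) - v (y + r • z)‖ₑ ≤
      ∫⁻ s in Set.Ioc r ρ, ‖fderiv ℝ v (y + s • z)‖ₑ * ‖z‖ₑ := by
  have hder : ∀ s : ℝ, HasDerivAt (fun s : ℝ => v (y + s • z)) (fderiv ℝ v (y + s • z) z) s := by
    intro s
    have h1 : HasDerivAt (fun s : ℝ => y + s • z) z s := by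
      simpa using ((hasDerivAt_id s).smul_const z).const_add y
    exact ((hv.differentiable one_ne_zero _).hasFDerivAt).comp_hasDerivAt s h1
  have hc : Continuous fun s : ℝ => fderiv ℝ v (y + s • z) z := by
    have := hv.continuous_fderiv one_ne_zero
    fun_prop
  rw [← intervalIntegral.integral_eq_sub_of_hasDerivAt (fun s _ => hder s)
    (hc.intervalIntegrable _ _), intervalIntegral.integral_of_le h]
  refine (enorm_integral_le_lintegral_enorm _).trans (lintegral_mono fun s => ?_)
  exact ContinuousLinearMap.le_opENorm _ _

theorem lintegral_unitBall_comp {F : Rn n → ℝ≥0∞} (hF : Measurable F) (y : Rn n) {s : ℝ}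
    (hs : 0 < s) :
    ∫⁻ z in Metric.ball 0 1, F (y + s • z) =
      (ENNReal.ofReal s ^ n)⁻¹ * ∫⁻ w in Metric.ball y s, F w := by
  have h1 : ∫⁻ w in Metric.ball y s, F w = ∫⁻ w in Metric.ball 0 s, F (y + w) := by
    rw [← lintegral_indicator Metric.isOpen_ball.measurableSet,
      ← lintegral_indicator Metric.isOpen_ball.measurableSet,
      ← lintegral_add_left_eq_self _ y]
    refine lintegral_congr fun w => ?_
    simp [Set.indicator]
  have h2 : ∫⁻ z in Metric.ball 0 1, F (y + s • z) =
      ∫⁻ z, (Metric.ball (0 : Rn n) s).indicator (fun w => F (y + w)) (s • z) := by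
    rw [← lintegral_indicator Metric.isOpen_ball.measurableSet]
    refine lintegral_congr fun w => ?_
    have : w ∈ Metric.ball (0 : Rn n) 1 ↔ s • w ∈ Metric.ball (0 : Rn n) s := by
      simp [norm_smul, abs_of_pos hs, hs]
    by_cases hw : w ∈ Metric.ball (0 : Rn n) 1
    · rw [Set.indicator_of_mem hw, Set.indicator_of_mem (this.1 hw)]
    · rw [Set.indicator_of_notMem hw, Set.indicator_of_notMem (fun h => hw (this.2 h))]
  have hm : Measurable ((Metric.ball (0 : Rn n) s).indicator (fun w => F (y + w))) :=
    (hF.comp (measurable_const_add y)).indicator Metric.isOpen_ball.measurableSet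
  have h3 := lintegral_map (μ := (volume : Measure (Rn n))) hm (measurable_const_smul s)
  rw [Measure.map_addHaar_smul volume hs.ne', lintegral_smul_measure,
    lintegral_indicator Metric.isOpen_ball.measurableSet, finrank_euclideanSpace_fin] at h3
  rw [h2, ← h3, h1, abs_of_pos (by positivity), ENNReal.ofReal_inv_of_pos (by positivity),
    ENNReal.ofReal_pow hs.le, smul_eq_mul]

theorem measurable_lintegral_ball {h : Rn n → ℝ≥0∞} (hh : Measurable h) :
    Measurable fun q : Rn n × ℝ => ∫⁻ w in Metric.ball q.1 q.2, h w := by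
  have : (fun q : Rn n × ℝ => ∫⁻ w in Metric.ball q.1 q.2, h w) =
      fun q : Rn n × ℝ => ∫⁻ w, {a : (Rn n × ℝ) × Rn n | dist a.2 a.1.1 < a.1.2}.indicator
        (fun a => h a.2) (q, w) := by
    ext q
    rw [← lintegral_indicator Metric.isOpen_ball.measurableSet]
    rfl
  rw [this]
  refine Measurable.lintegral_prod_right' ((hh.comp measurable_snd).indicator ?_)
  exact (isOpen_lt (by fun_prop) (by fun_prop)).measurableSet

theorem measurable_radialPotential {h : Rn n → ℝ≥0∞} (hh : Measurable h) (r ρ : ℝ) :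
    Measurable (radialPotential h r ρ) := by
  have h1 : Measurable fun q : Rn n × ℝ =>
      (ENNReal.ofReal q.2 ^ n)⁻¹ * ∫⁻ w in Metric.ball q.1 q.2, h w :=
    (by fun_prop : Measurable fun q : Rn n × ℝ => (ENNReal.ofReal q.2 ^ n)⁻¹).mul
      (measurable_lintegral_ball hh)
  exact h1.lintegral_prod_right'

theorem measurable_enorm_fderiv {v : Rn n → ℝ} (hv : ContDiff ℝ 1 v) :
    Measurable fun w => ‖fderiv ℝ v w‖ₑ :=
  (hv.continuous_fderiv one_ne_zero).enorm.measurable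

/-- The fundamental theorem of calculus along each ray, integrated over the unit ball; at parameter
`s`, the change of variables `w = y + s z` produces the factor `s⁻ⁿ` and the ball `B(y,s)`. The case
`r = 0` compares a mean with the value at the centre, the case `r > 0` compares means over two
concentric balls. -/
theorem lintegral_unitBall_enorm_sub_le {v : Rn n → ℝ} (hv : ContDiff ℝ 1 v) (y : Rn n) {r ρ : ℝ}
    (hr : 0 ≤ r) (h : r ≤ ρ) :
    ∫⁻ z in Metric.ball 0 1, ‖v (y + ρ • z) - v (y + r • z)‖ₑ ≤
      radialPotential (fun w => ‖fderiv ℝ v w‖ₑ) r ρ y := by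
  have hc := hv.continuous_fderiv one_ne_zero
  calc ∫⁻ z in Metric.ball 0 1, ‖v (y + ρ • z) - v (y + r • z)‖ₑ
      ≤ ∫⁻ z in Metric.ball (0 : Rn n) 1, ∫⁻ s in Set.Ioc r ρ, ‖fderiv ℝ v (y + s • z)‖ₑ := by
        refine setLIntegral_mono' Metric.isOpen_ball.measurableSet fun z hz => ?_
        refine (enorm_sub_le_lintegral_fderiv hv y z h).trans (lintegral_mono fun s => ?_)
        refine mul_le_of_le_one_right (zero_le) ?_
        have : ‖z‖ ≤ 1 := by simpa using (mem_ball_zero_iff.1 hz).le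
        rw [← ofReal_norm]; exact ENNReal.ofReal_le_one.2 this
    _ = ∫⁻ s in Set.Ioc r ρ, ∫⁻ z in Metric.ball (0 : Rn n) 1, ‖fderiv ℝ v (y + s • z)‖ₑ := by
        refine lintegral_lintegral_swap (Measurable.aemeasurable ?_)
        have : Continuous fun q : Rn n × ℝ => ‖fderiv ℝ v (y + q.2 • q.1)‖ₑ :=
          (hc.comp (by fun_prop)).enorm
        exact this.measurable
    _ = _ := by
        refine setLIntegral_congr_fun measurableSet_Ioc fun s hs => ?_
        exact lintegral_unitBall_comp (measurable_enorm_fderiv hv) y (hr.trans_lt hs.1)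

/-! ### Relative isoperimetry and balls of intermediate density. -/

/-- A segment from a point of `A` to a point of `A'` carries variation at least `1`. Integrating
over all pairs of endpoints gives a relative isoperimetric inequality without Poincaré's inequality.
-/
theorem volume_mul_volume_le {v : Rn n → ℝ} (hv : ContDiff ℝ 1 v) (x : Rn n) {r : ℝ}
    {A A' : Set (Rn n)} (hA : MeasurableSet A) (hA' : MeasurableSet A')
    (hAx : A ⊆ Metric.ball x r) (hAx' : A' ⊆ Metric.ball x r) (h1 : ∀ z ∈ A, v z = 1)
    (h0 : ∀ z ∈ A', v z = 0) :
    volume A * volume A' ≤ volume (Metric.ball (0 : Rn n) (2 * r)) *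
      (ENNReal.ofReal (2 * r) * ∫⁻ w in Metric.ball x (3 * r), ‖fderiv ℝ v w‖ₑ) := by
  have hc := hv.continuous_fderiv one_ne_zero
  set I := ∫⁻ w in Metric.ball x (3 * r), ‖fderiv ℝ v w‖ₑ
  have step : ∀ z ∈ A, volume A' ≤ ∫⁻ e in Metric.ball (0 : Rn n) (2 * r),
      ∫⁻ s in Set.Ioc (0 : ℝ) 1, ‖fderiv ℝ v (z + s • e)‖ₑ * ENNReal.ofReal (2 * r) := by
    intro z hz
    calc volume A' = ∫⁻ e, A'.indicator 1 (z + e) := by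
          rw [lintegral_add_left_eq_self (fun w => A'.indicator 1 w) z,
            lintegral_indicator_one hA']
      _ ≤ ∫⁻ e, (Metric.ball (0 : Rn n) (2 * r)).indicator (fun e =>
            ∫⁻ s in Set.Ioc (0 : ℝ) 1, ‖fderiv ℝ v (z + s • e)‖ₑ * ENNReal.ofReal (2 * r)) e := by
          refine lintegral_mono fun e => ?_
          by_cases he : z + e ∈ A'
          · have hzr := Metric.mem_ball.1 (hAx hz)
            have her := Metric.mem_ball.1 (hAx' he)
            have hn : ‖e‖ < 2 * r := by
              have := dist_triangle_right (z + e) z x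
              rw [dist_eq_norm] at this
              simp only [add_sub_cancel_left] at this
              linarith
            rw [Set.indicator_of_mem he, Set.indicator_of_mem (by simpa using hn)]
            have := enorm_sub_le_lintegral_fderiv hv z e zero_le_one
            simp only [one_smul, zero_smul, add_zero, h0 _ he, h1 _ hz, zero_sub, enorm_neg,
              enorm_one] at this
            refine this.trans (lintegral_mono fun s => ?_)
            gcongr
            rw [← ofReal_norm]; exact ENNReal.ofReal_le_ofReal hn.le
          · rw [Set.indicator_of_notMem he]; exact zero_le
      _ = _ := lintegral_indicator Metric.isOpen_ball.measurableSet _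
  have hcont : Continuous fun q : Rn n × Rn n × ℝ =>
      ‖fderiv ℝ v (q.1 + q.2.2 • q.2.1)‖ₑ := (hc.comp (by fun_prop)).enorm
  calc volume A * volume A' = ∫⁻ _z in A, volume A' := by
        rw [setLIntegral_const, mul_comm]
    _ ≤ ∫⁻ z in A, ∫⁻ e in Metric.ball (0 : Rn n) (2 * r),
      ∫⁻ s in Set.Ioc (0 : ℝ) 1, ‖fderiv ℝ v (z + s • e)‖ₑ * ENNReal.ofReal (2 * r) :=
        setLIntegral_mono' hA step
    _ ≤ ∫⁻ z in Metric.ball x r, ∫⁻ e in Metric.ball (0 : Rn n) (2 * r),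
      ∫⁻ s in Set.Ioc (0 : ℝ) 1, ‖fderiv ℝ v (z + s • e)‖ₑ * ENNReal.ofReal (2 * r) :=
        lintegral_mono_set hAx
    -- The integral in `z` is moved innermost: for fixed `e` and `s` it runs over a translate of
    -- `B(x,r)` by a vector of length at most `2r`, hence inside `B(x,3r)`.
    _ = ∫⁻ e in Metric.ball (0 : Rn n) (2 * r), ∫⁻ z in Metric.ball x r,
      ∫⁻ s in Set.Ioc (0 : ℝ) 1, ‖fderiv ℝ v (z + s • e)‖ₑ * ENNReal.ofReal (2 * r) := by
        refine lintegral_lintegral_swap (Measurable.aemeasurable ?_)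
        have : Measurable fun q : (Rn n × Rn n) × ℝ =>
            ‖fderiv ℝ v (q.1.1 + q.2 • q.1.2)‖ₑ * ENNReal.ofReal (2 * r) :=
          ((hc.comp (by fun_prop)).enorm.measurable).mul_const _
        exact this.lintegral_prod_right'
    _ = ∫⁻ e in Metric.ball (0 : Rn n) (2 * r), ∫⁻ s in Set.Ioc (0 : ℝ) 1,
      ∫⁻ z in Metric.ball x r, ‖fderiv ℝ v (z + s • e)‖ₑ * ENNReal.ofReal (2 * r) := by
        refine lintegral_congr fun e => lintegral_lintegral_swap (Measurable.aemeasurable ?_)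
        exact (((hc.comp (by fun_prop :
          Continuous fun q : Rn n × ℝ => q.1 + q.2 • e)).enorm.measurable).mul_const _)
    _ ≤ ∫⁻ _e in Metric.ball (0 : Rn n) (2 * r), ∫⁻ _s in Set.Ioc (0 : ℝ) 1,
          ENNReal.ofReal (2 * r) * I := by
        refine setLIntegral_mono' Metric.isOpen_ball.measurableSet fun e he =>
          setLIntegral_mono' measurableSet_Ioc fun s hs => ?_
        rw [lintegral_mul_const _ (by exact (hc.comp (by fun_prop)).enorm.measurable), mul_comm]
        gcongr
        rw [← lintegral_indicator Metric.isOpen_ball.measurableSet,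
          ← lintegral_add_right_eq_self _ (-(s • e))]
        simp only [I]
        rw [← lintegral_indicator Metric.isOpen_ball.measurableSet]
        refine lintegral_mono fun w => ?_
        by_cases hw : w + -(s • e) ∈ Metric.ball x r
        · rw [Set.indicator_of_mem hw, Set.indicator_of_mem]
          · simp
          · rw [mem_ball_iff_norm] at hw ⊢
            have h2 : ‖s • e‖ ≤ 2 * r := by
              rw [norm_smul, Real.norm_eq_abs, abs_of_pos hs.1]
              have := mem_ball_zero_iff.1 he
              nlinarith [hs.2, norm_nonneg e]
            calc ‖w - x‖ = ‖(w + -(s • e) - x) + s • e‖ := by congr 1; abel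
              _ ≤ ‖w + -(s • e) - x‖ + ‖s • e‖ := norm_add_le _ _
              _ < 3 * r := by linarith
        · rw [Set.indicator_of_notMem hw]; exact zero_le
    _ = _ := by
        rw [setLIntegral_const, setLIntegral_const]
        simp [mul_comm]

/-- Start from a ball inside `E` and double the radius until the density first drops to at most
`1/2`, which happens because `E` has finite volume. At the preceding radius the density exceeded
`1/2`, so at the chosen one it exceeds `2^{-n} / 2`. The strict inequality is what later survives
approximation from inside. -/
theorem exists_radius_density {E : Set (Rn n)} (hn : 0 < n) (hE : IsOpen E) (hfin : volume E ≠ ⊤)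
    {y : Rn n} (hy : y ∈ E) :
    ∃ r : ℝ, 0 < r ∧
      volume (E ∩ Metric.ball y r) ≤ 2⁻¹ * volume (Metric.ball y r) ∧
      (2 ^ (n + 1))⁻¹ * volume (Metric.ball y r) < volume (E ∩ Metric.ball y r) := by
  obtain ⟨r₀, hr₀, hball⟩ := Metric.isOpen_iff.1 hE y hy
  have hpos : ∀ j : ℕ, 0 < r₀ * 2 ^ j := fun j => by positivity
  have hex : ∃ j : ℕ, volume (E ∩ Metric.ball y (r₀ * 2 ^ j)) ≤
      2⁻¹ * volume (Metric.ball y (r₀ * 2 ^ j)) := by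
    have ht : Tendsto (fun j : ℕ => 2⁻¹ * volume (Metric.ball y (r₀ * 2 ^ j))) atTop (𝓝 ⊤) := by
      have h1 : Tendsto (fun j : ℕ => r₀ * (2 : ℝ) ^ j) atTop atTop :=
        (tendsto_pow_atTop_atTop_of_one_lt one_lt_two).const_mul_atTop hr₀
      have h2 : Tendsto (fun j : ℕ => ENNReal.ofReal (r₀ * (2 : ℝ) ^ j) ^ n) atTop (𝓝 ⊤) := by
        have h3 := (ENNReal.continuous_pow n).tendsto ⊤
        rw [ENNReal.top_pow hn.ne'] at h3
        exact h3.comp (ENNReal.tendsto_ofReal_atTop.comp h1)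
      have h4 := ENNReal.Tendsto.const_mul (a := 2⁻¹ * volume (Metric.ball (0 : Rn n) 1)) h2
        (Or.inl ENNReal.top_ne_zero)
      rw [ENNReal.mul_top (mul_ne_zero (by simp) volume_unitBall_ne_zero)] at h4
      refine h4.congr fun j => ?_
      rw [volume_ball_eq _ (hpos j)]; ring
    obtain ⟨j, hj⟩ := (ht.eventually (lt_mem_nhds hfin.lt_top)).exists
    exact ⟨j, (measure_mono Set.inter_subset_left).trans hj.le⟩
  classical
  set j := Nat.find hex with hjdef
  have hj := Nat.find_spec hex
  rw [← hjdef] at hj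
  have hj0 : j ≠ 0 := by
    intro h0
    rw [h0, pow_zero, mul_one, Set.inter_eq_right.2 hball] at hj
    have hne : volume (Metric.ball y r₀) ≠ ⊤ := measure_ball_lt_top.ne
    have hp : 0 < volume (Metric.ball y r₀) := Metric.measure_ball_pos _ _ hr₀
    have : 2⁻¹ * volume (Metric.ball y r₀) < volume (Metric.ball y r₀) := by
      rw [mul_comm, ← div_eq_mul_inv]
      exact ENNReal.half_lt_self hp.ne' hne
    exact absurd hj (not_le.2 this)
  obtain ⟨i, hi⟩ := Nat.exists_eq_succ_of_ne_zero hj0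
  refine ⟨r₀ * 2 ^ j, hpos j, hj, ?_⟩
  have hlt := not_le.1 (Nat.find_min hex (m := i) (by omega))
  have heq : (2 ^ (n + 1))⁻¹ * volume (Metric.ball y (r₀ * 2 ^ j)) =
      2⁻¹ * volume (Metric.ball y (r₀ * 2 ^ i)) := by
    rw [volume_ball_eq _ (hpos j), volume_ball_eq _ (hpos i), hi, Nat.succ_eq_add_one,
      pow_succ (2 : ℝ) i, ← mul_assoc r₀, ENNReal.ofReal_mul (hpos i).le, mul_pow,
      pow_succ (2 : ℝ≥0∞) n,
      ENNReal.mul_inv (Or.inr (by simp)) (Or.inr (by simp))]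
    have : (2 ^ n : ℝ≥0∞)⁻¹ * ENNReal.ofReal 2 ^ n = 1 := by
      rw [ENNReal.ofReal_ofNat]
      exact ENNReal.inv_mul_cancel (by simp) (by simp)
    calc _ = ((2 ^ n : ℝ≥0∞)⁻¹ * ENNReal.ofReal 2 ^ n) *
        (2⁻¹ * (ENNReal.ofReal (r₀ * 2 ^ i) ^ n * volume (Metric.ball (0 : Rn n) 1))) := by ring
      _ = _ := by rw [this, one_mul]
  rw [heq]
  exact hlt.trans_le (measure_mono (by
    gcongr
    · exact one_le_two
    · omega))

/-- The constant in the isoperimetric estimate for balls of intermediate density. -/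
def isoConst (n : ℕ) : ℝ≥0∞ := 2 ^ (2 * n + 3) * (volume (Metric.ball (0 : Rn n) 1))⁻¹

theorem isoConst_ne_top : isoConst n ≠ ⊤ :=
  ENNReal.mul_ne_top (by simp) (ENNReal.inv_ne_top.2 volume_unitBall_ne_zero)

theorem radius_pow_le {v : Rn n → ℝ} (hn : 0 < n) (hv : ContDiff ℝ 1 v) (y : Rn n) {r : ℝ}
    (hr : 0 < r)
    {A A' : Set (Rn n)} (hA : MeasurableSet A) (hA' : MeasurableSet A')
    (hAx : A ⊆ Metric.ball y r) (hAx' : A' ⊆ Metric.ball y r) (h1 : ∀ z ∈ A, v z = 1)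
    (h0 : ∀ z ∈ A', v z = 0) (hvA : (2 ^ (n + 1))⁻¹ * volume (Metric.ball y r) ≤ volume A)
    (hvA' : 2⁻¹ * volume (Metric.ball y r) ≤ volume A') :
    ENNReal.ofReal r ^ (n - 1) ≤
      isoConst n * ∫⁻ w in Metric.ball y (3 * r), ‖fderiv ℝ v w‖ₑ := by
  have key := (mul_le_mul' hvA hvA').trans (volume_mul_volume_le hv y hA hA' hAx hAx' h1 h0)
  set I := ∫⁻ w in Metric.ball y (3 * r), ‖fderiv ℝ v w‖ₑ
  obtain ⟨m, rfl⟩ := Nat.exists_eq_succ_of_ne_zero hn.ne'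
  rw [volume_ball_eq _ hr, volume_ball_eq _ (by positivity : (0 : ℝ) < 2 * r),
    ENNReal.ofReal_mul zero_le_two, ENNReal.ofReal_ofNat] at key
  simp only [Nat.succ_eq_add_one, Nat.add_sub_cancel]
  rw [isoConst]
  have hV0 : volume (Metric.ball (0 : Rn (m + 1)) 1) ≠ 0 := volume_unitBall_ne_zero
  have hVt : volume (Metric.ball (0 : Rn (m + 1)) 1) ≠ ⊤ := volume_unitBall_ne_top
  simp only [Nat.succ_eq_add_one] at key
  set V := volume (Metric.ball (0 : Rn (m + 1)) 1)
  set R := ENNReal.ofReal r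
  have hR0 : R ≠ 0 := by simpa [R] using hr
  have hRt : R ≠ ⊤ := ENNReal.ofReal_ne_top
  have c1 : (2 : ℝ≥0∞) ^ (m + 1 + 1) * (2 ^ (m + 1 + 1))⁻¹ = 1 :=
    ENNReal.mul_inv_cancel (by simp) (by simp)
  have c2 : (2 : ℝ≥0∞) * 2⁻¹ = 1 := ENNReal.mul_inv_cancel (by simp) (by simp)
  have c3 : V * V⁻¹ = 1 := ENNReal.mul_inv_cancel hV0 hVt
  have c4 : R ^ (m + 2) * (R ^ (m + 2))⁻¹ = 1 :=
    ENNReal.mul_inv_cancel (pow_ne_zero _ hR0) (ENNReal.pow_ne_top hRt)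
  -- The units `a a⁻¹ = 1` are inserted by hand, so that what is left is a semiring identity over
  -- `[0, ∞]`.
  calc R ^ m = (2 ^ (m + 1 + 1) * (2 ^ (m + 1 + 1))⁻¹) * (2 * 2⁻¹) * (V * V⁻¹) * (V * V⁻¹) *
        (R ^ (m + 2) * (R ^ (m + 2))⁻¹) * R ^ m := by rw [c1, c2, c3, c4]; simp
    _ = (2 ^ (m + 1 + 1) * 2 * V⁻¹ * V⁻¹ * (R ^ (m + 2))⁻¹) *
        ((2 ^ (m + 1 + 1))⁻¹ * (R ^ (m + 1) * V) * (2⁻¹ * (R ^ (m + 1) * V))) := by ring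
    _ ≤ (2 ^ (m + 1 + 1) * 2 * V⁻¹ * V⁻¹ * (R ^ (m + 2))⁻¹) *
        ((2 * R) ^ (m + 1) * V * (2 * R * I)) := by gcongr
    _ = (R ^ (m + 2) * (R ^ (m + 2))⁻¹) * (V * V⁻¹) * (2 ^ (2 * (m + 1) + 3) * V⁻¹ * I) := by ring
    _ = _ := by rw [c3, c4]; simp

/-! ### Smoothed superlevel sets and slabs in place of the coarea formula. -/

theorem exists_bound_deriv_smoothTransition :
    ∃ K : ℝ≥0, ∀ x : ℝ, ‖deriv Real.smoothTransition x‖ₑ ≤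
      (Set.Icc (0 : ℝ) 1).indicator (fun _ => (K : ℝ≥0∞)) x := by
  have hc : Continuous (deriv Real.smoothTransition) :=
    (Real.smoothTransition.contDiff (n := 1)).continuous_deriv le_rfl
  obtain ⟨K, hK⟩ := isCompact_Icc.exists_bound_of_continuousOn (s := Set.Icc (0 : ℝ) 1)
    hc.continuousOn
  refine ⟨K.toNNReal, fun x => ?_⟩
  by_cases hx : x ∈ Set.Icc (0 : ℝ) 1
  · rw [Set.indicator_of_mem hx, ← ofReal_norm]
    exact ENNReal.ofReal_le_ofReal (hK x hx)
  · have : deriv Real.smoothTransition x = 0 := by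
      rw [Set.mem_Icc, not_and_or, not_le, not_le] at hx
      rcases hx with hx | hx
      · have : Real.smoothTransition =ᶠ[𝓝 x] fun _ => 0 := by
          filter_upwards [gt_mem_nhds hx] with z hz
          exact Real.smoothTransition.zero_of_nonpos (le_of_lt hz)
        rw [this.deriv_eq]; simp
      · have : Real.smoothTransition =ᶠ[𝓝 x] fun _ => 1 := by
          filter_upwards [lt_mem_nhds hx] with z hz
          exact Real.smoothTransition.one_of_one_le (le_of_lt hz)
        rw [this.deriv_eq]; simp
    simp [this]

/-- `k |∇f|` restricted to the slab `{s ≤ f ≤ s + 1 / k}`. -/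
def slab (f : Rn n → ℝ) (k : ℕ) (s : ℝ) (z : Rn n) : ℝ≥0∞ :=
  (Set.Icc (0 : ℝ) 1).indicator (fun _ => (k : ℝ≥0∞)) (k * (f z - s)) * ‖fderiv ℝ f z‖ₑ

theorem measurable_slab {f : Rn n → ℝ} (hf : ContDiff ℝ 1 f) (k : ℕ) :
    Measurable fun q : ℝ × Rn n => slab f k q.1 q.2 := by
  have hc := hf.continuous
  have h1 : Measurable fun q : ℝ × Rn n => (k : ℝ) * (f q.2 - q.1) :=
    (by fun_prop : Continuous fun q : ℝ × Rn n => (k : ℝ) * (f q.2 - q.1)).measurable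
  exact ((measurable_const.indicator measurableSet_Icc).comp h1).mul
    ((measurable_enorm_fderiv hf).comp measurable_snd)

/-- For fixed `z` the levels `s` whose slab contains `z` form an interval of length `1/k`, which
cancels the weight `k`. This is the only half of the coarea formula that is needed. -/
theorem lintegral_slab_le {f : Rn n → ℝ} (hf : ContDiff ℝ 1 f) (k : ℕ) :
    ∫⁻ s, ∫⁻ z, slab f k s z ≤ ∫⁻ z, ‖fderiv ℝ f z‖ₑ := by
  rw [lintegral_lintegral_swap (measurable_slab hf k).aemeasurable]
  refine lintegral_mono fun z => ?_
  simp only [slab]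
  have hm : Measurable fun s : ℝ =>
      (Set.Icc (0 : ℝ) 1).indicator (fun _ => (k : ℝ≥0∞)) (k * (f z - s)) :=
    (measurable_const.indicator measurableSet_Icc).comp (by fun_prop)
  rw [lintegral_mul_const _ hm]
  refine mul_le_of_le_one_left zero_le ?_
  rcases Nat.eq_zero_or_pos k with rfl | hk
  · simp
  have hk' : (0 : ℝ) < k := by exact_mod_cast hk
  have : (fun s : ℝ => (Set.Icc (0 : ℝ) 1).indicator (fun _ => (k : ℝ≥0∞)) (k * (f z - s))) =
      (Set.Icc (f z - 1 / k) (f z)).indicator (fun _ => (k : ℝ≥0∞)) := by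
    ext s
    have : (k : ℝ) * (f z - s) ∈ Set.Icc (0 : ℝ) 1 ↔ s ∈ Set.Icc (f z - 1 / k) (f z) := by
      rw [Set.mem_Icc, Set.mem_Icc, mul_nonneg_iff_of_pos_left hk', ← le_div_iff₀' hk']
      constructor <;> rintro ⟨h1, h2⟩ <;> constructor <;> linarith
    by_cases hs : s ∈ Set.Icc (f z - 1 / k) (f z)
    · rw [Set.indicator_of_mem hs, Set.indicator_of_mem (this.2 hs)]
    · rw [Set.indicator_of_notMem hs, Set.indicator_of_notMem (fun h => hs (this.1 h))]
  rw [this, lintegral_indicator measurableSet_Icc, setLIntegral_const, Real.volume_Icc]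
  rw [sub_sub_cancel, one_div, ENNReal.ofReal_inv_of_pos hk', ENNReal.ofReal_natCast,
    ENNReal.mul_inv_cancel (by exact_mod_cast hk.ne') (by simp)]

theorem enorm_fderiv_smoothTransition_le {f : Rn n → ℝ} (hf : ContDiff ℝ 1 f) {K : ℝ≥0}
    (hK : ∀ x : ℝ, ‖deriv Real.smoothTransition x‖ₑ ≤
      (Set.Icc (0 : ℝ) 1).indicator (fun _ => (K : ℝ≥0∞)) x) (k : ℕ) (s : ℝ) (z : Rn n) :
    ‖fderiv ℝ (fun z => Real.smoothTransition (k * (f z - s))) z‖ₑ ≤ K * slab f k s z := by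
  have h1 : HasFDerivAt (fun z => (k : ℝ) * (f z - s)) ((k : ℝ) • fderiv ℝ f z) z :=
    ((hf.differentiable one_ne_zero z).hasFDerivAt.sub_const s).const_mul _
  have h2 : HasDerivAt Real.smoothTransition (deriv Real.smoothTransition (k * (f z - s)))
      (k * (f z - s)) :=
    ((Real.smoothTransition.contDiff (n := 1)).differentiable one_ne_zero _).hasDerivAt
  have h3 : fderiv ℝ (fun z => Real.smoothTransition (k * (f z - s))) z =
      deriv Real.smoothTransition (k * (f z - s)) • ((k : ℝ) • fderiv ℝ f z) :=
    HasFDerivAt.fderiv (h2.comp_hasFDerivAt_of_eq z h1 rfl)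
  rw [h3, enorm_smul, enorm_smul]
  refine (mul_le_mul_left (hK _) _).trans ?_
  rw [slab]
  by_cases hz : (k : ℝ) * (f z - s) ∈ Set.Icc (0 : ℝ) 1
  · rw [Set.indicator_of_mem hz, Set.indicator_of_mem hz]
    simp
  · rw [Set.indicator_of_notMem hz]; simp

theorem contDiff_smoothTransition_comp {f : Rn n → ℝ} (hf : ContDiff ℝ 1 f) (k : ℕ) (s : ℝ) :
    ContDiff ℝ 1 fun z => Real.smoothTransition (k * (f z - s)) :=
  Real.smoothTransition.contDiff.comp (contDiff_const.mul (hf.sub contDiff_const))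

/-- The smoothed indicator equals `1` on `{f ≥ s + 1/k}`, which increases to `{f > s}`, and `0` on
`{f ≤ s}`. The strict lower density bound therefore passes to the former set for large `k`, while
the complement fills at least half of the ball for every `k`. -/
theorem eventually_radius_pow_le {f : Rn n → ℝ} (hn : 0 < n) (hf : ContDiff ℝ 1 f) (s : ℝ)
    (y : Rn n) {r : ℝ} (hr : 0 < r)
    (h1 : volume ({z | s < f z} ∩ Metric.ball y r) ≤ 2⁻¹ * volume (Metric.ball y r))
    (h2 : (2 ^ (n + 1))⁻¹ * volume (Metric.ball y r) < volume ({z | s < f z} ∩ Metric.ball y r)) :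
    ∀ᶠ k : ℕ in atTop, ENNReal.ofReal r ^ (n - 1) ≤ isoConst n *
      ∫⁻ w in Metric.ball y (3 * r),
        ‖fderiv ℝ (fun z => Real.smoothTransition (k * (f z - s))) w‖ₑ := by
  have hc := hf.continuous
  set D : ℕ → Set (Rn n) := fun k => {z | 1 ≤ (k : ℝ) * (f z - s)} ∩ Metric.ball y r with hD
  have hmono : Monotone D := by
    intro k k' hkk
    refine Set.inter_subset_inter_left _ fun z hz => ?_
    have hz' : 1 ≤ (k : ℝ) * (f z - s) := hz
    have hkk' : (k : ℝ) ≤ k' := by exact_mod_cast hkk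
    have hk0 : (0 : ℝ) ≤ k := Nat.cast_nonneg k
    have hpos : 0 ≤ f z - s := by
      by_contra hneg
      nlinarith [not_le.1 hneg]
    show 1 ≤ (k' : ℝ) * (f z - s)
    nlinarith
  have hU : ⋃ k, D k = {z | s < f z} ∩ Metric.ball y r := by
    rw [← Set.iUnion_inter]
    congr 1
    ext z
    simp only [Set.mem_iUnion, Set.mem_ofPred_eq]
    constructor
    · rintro ⟨k, hk⟩
      by_contra hneg
      have hk0 : (0 : ℝ) ≤ k := Nat.cast_nonneg k
      nlinarith [not_lt.1 hneg]
    · intro hz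
      obtain ⟨k, hk⟩ := exists_nat_gt (1 / (f z - s))
      exact ⟨k, by rw [div_lt_iff₀ (by linarith)] at hk; exact hk.le⟩
  have ht := tendsto_measure_iUnion_atTop (μ := volume) hmono
  rw [hU] at ht
  filter_upwards [ht.eventually (lt_mem_nhds h2)] with k hk
  have hDm : MeasurableSet (D k) := by
    refine MeasurableSet.inter (IsClosed.measurableSet ?_) Metric.isOpen_ball.measurableSet
    exact isClosed_le (by fun_prop) (by fun_prop)
  have hEm : MeasurableSet ({z | s < f z} ∩ Metric.ball y r) :=
    (isOpen_lt (by fun_prop) hc).measurableSet.inter Metric.isOpen_ball.measurableSet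
  have hfin : volume (Metric.ball y r) ≠ ⊤ := measure_ball_lt_top.ne
  refine radius_pow_le hn (contDiff_smoothTransition_comp hf k s) y hr hDm
    (Metric.isOpen_ball.measurableSet.diff hEm) Set.inter_subset_right Set.sdiff_subset
    (fun z hz => Real.smoothTransition.one_of_one_le hz.1) ?_ hk.le ?_
  · rintro z ⟨hz1, hz2⟩
    refine Real.smoothTransition.zero_of_nonpos (mul_nonpos_of_nonneg_of_nonpos
      (Nat.cast_nonneg k) ?_)
    by_contra hneg
    exact hz2 ⟨by simpa using hneg, hz1⟩
  · rw [measure_sdiff Set.inter_subset_right hEm.nullMeasurableSet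
      (measure_ne_top_of_subset Set.inter_subset_right hfin)]
    refine ENNReal.le_sub_of_add_le_right
      (measure_ne_top_of_subset Set.inter_subset_right hfin) ((add_le_add le_rfl h1).trans ?_)
    rw [← add_mul, ENNReal.inv_two_add_inv_two, one_mul]

/-- The boxing inequality: balls of intermediate density cover the set, and a disjoint subfamily of
their triples has `∑ r^{n-1}` controlled by the slab integral. The growth of `ν` turns that sum into
a bound for `ν`. -/
theorem measure_superlevel_le {K : ℝ≥0} (hn : 0 < n)
    (hK : ∀ x : ℝ, ‖deriv Real.smoothTransition x‖ₑ ≤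
      (Set.Icc (0 : ℝ) 1).indicator (fun _ => (K : ℝ≥0∞)) x)
    {ν : Measure (Rn n)} {A : ℝ≥0∞}
    (hν : ∀ (y : Rn n) (r : ℝ), 0 < r → ν (Metric.ball y r) ≤ A * ENNReal.ofReal r ^ (n - 1))
    {f : Rn n → ℝ} (hf : ContDiff ℝ 1 f) (s : ℝ) (hfin : volume {z | s < f z} ≠ ⊤) :
    ν {z | s < f z} ≤ 16 ^ (n - 1) * isoConst n * K * A *
      liminf (fun k => ∫⁻ z, slab f k s z) atTop := by
  have hE : IsOpen {z | s < f z} := isOpen_lt continuous_const hf.continuous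
  set E := {z | s < f z} with hEdef
  have hex : ∀ y : Rn n, ∃ r : ℝ, y ∈ E → (0 < r ∧
      volume (E ∩ Metric.ball y r) ≤ 2⁻¹ * volume (Metric.ball y r) ∧
      (2 ^ (n + 1))⁻¹ * volume (Metric.ball y r) < volume (E ∩ Metric.ball y r)) := by
    intro y
    by_cases hy : y ∈ E
    · obtain ⟨r, hr⟩ := exists_radius_density hn hE hfin hy
      exact ⟨r, fun _ => hr⟩
    · exact ⟨0, fun h => absurd h hy⟩
  choose r hr using hex
  -- Vitali's lemma requires bounded radii. A ball in which `E` has density at least `2^{-(n+1)}`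
  -- has volume at most `2^{n+1} |E|`.
  obtain ⟨R, hR⟩ : ∃ R : ℝ, ∀ y ∈ E, 3 * r y ≤ R := by
    set W := volume (Metric.ball (0 : Rn n) 1) with hW
    set Q : ℝ≥0∞ := 2 ^ (n + 1) * W⁻¹ * volume E with hQ
    have hQt : Q ≠ ⊤ := ENNReal.mul_ne_top (ENNReal.mul_ne_top (by simp)
      (ENNReal.inv_ne_top.2 volume_unitBall_ne_zero)) hfin
    refine ⟨3 * max 1 Q.toReal, fun y hy => ?_⟩
    obtain ⟨h0, -, h2⟩ := hr y hy
    have h3 : (2 ^ (n + 1))⁻¹ * (ENNReal.ofReal (r y) ^ n * W) ≤ volume E := by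
      rw [← volume_ball_eq y h0]
      exact h2.le.trans (measure_mono Set.inter_subset_left)
    have h4 : ENNReal.ofReal (r y) ^ n ≤ Q := by
      calc ENNReal.ofReal (r y) ^ n = (2 ^ (n + 1) * (2 ^ (n + 1))⁻¹) * (W * W⁻¹) *
            ENNReal.ofReal (r y) ^ n := by
            rw [ENNReal.mul_inv_cancel (by simp) (by simp),
              ENNReal.mul_inv_cancel volume_unitBall_ne_zero volume_unitBall_ne_top]; simp
        _ = 2 ^ (n + 1) * W⁻¹ * ((2 ^ (n + 1))⁻¹ * (ENNReal.ofReal (r y) ^ n * W)) := by ring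
        _ ≤ Q := mul_le_mul' le_rfl h3
    refine mul_le_mul_of_nonneg_left ?_ (by norm_num)
    rcases le_total (r y) 1 with h5 | h5
    · exact h5.trans (le_max_left _ _)
    · refine le_trans ?_ (le_max_right _ _)
      rw [← ENNReal.ofReal_pow h0.le] at h4
      exact (le_self_pow₀ h5 hn.ne').trans ((ENNReal.ofReal_le_iff_le_toReal hQt).1 h4)
  -- Disjointness is needed for the balls of radius `3r`, where the gradient integrals live. Vitali
  -- enlarges these to `5 · 3r = 15r`, and `16r` gives open balls.
  obtain ⟨u, huE, hdisj, hcov⟩ :=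
    Vitali.exists_disjoint_subfamily_covering_enlargement_closedBall E id (fun y => 3 * r y) R hR 5
      (by norm_num)
  have hcount : u.Countable := by
    refine hdisj.countable_of_nonempty_interior fun a ha => ?_
    refine ⟨a, Metric.ball_subset_interior_closedBall (Metric.mem_ball_self ?_)⟩
    have := (hr a (huE ha)).1
    positivity
  have hsub : E ⊆ ⋃ b ∈ u, Metric.ball b (16 * r b) := by
    intro y hy
    obtain ⟨b, hb, hyb⟩ := hcov y hy
    have h1 : y ∈ Metric.closedBall b (5 * (3 * r b)) :=
      hyb (Metric.mem_closedBall_self (by have := (hr y hy).1; positivity))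
    refine Set.mem_biUnion hb (Metric.closedBall_subset_ball ?_ h1)
    have := (hr b (huE hb)).1
    linarith
  have hsum : ∑' b : u, ENNReal.ofReal (r b) ^ (n - 1) ≤
      isoConst n * K * liminf (fun k => ∫⁻ z, slab f k s z) atTop := by
    -- The threshold in `k` depends on the ball, so it can be made common only for finitely many
    -- balls; the infinite sum is the supremum of such finite sums.
    rw [ENNReal.tsum_eq_iSup_sum]
    refine iSup_le fun F => ?_
    rw [← ENNReal.liminf_const_mul_of_ne_top (ENNReal.mul_ne_top isoConst_ne_top (by simp))]
    refine le_liminf_of_le (by isBoundedDefault) ?_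
    have hall : ∀ᶠ k : ℕ in atTop, ∀ b ∈ F, ENNReal.ofReal (r b) ^ (n - 1) ≤ isoConst n *
        ∫⁻ w in Metric.ball (b : Rn n) (3 * r b),
          ‖fderiv ℝ (fun z => Real.smoothTransition (k * (f z - s))) w‖ₑ := by
      rw [Filter.eventually_all_finset]
      intro b _
      obtain ⟨h0, h1, h2⟩ := hr b (huE b.2)
      exact eventually_radius_pow_le hn hf s b h0 h1 h2
    filter_upwards [hall] with k hk
    calc ∑ b ∈ F, ENNReal.ofReal (r b) ^ (n - 1) ≤ ∑ b ∈ F, isoConst n *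
        ∫⁻ w in Metric.ball (b : Rn n) (3 * r b),
          ‖fderiv ℝ (fun z => Real.smoothTransition (k * (f z - s))) w‖ₑ := Finset.sum_le_sum hk
      _ = isoConst n * ∫⁻ w in ⋃ b ∈ F, Metric.ball (b : Rn n) (3 * r b),
          ‖fderiv ℝ (fun z => Real.smoothTransition (k * (f z - s))) w‖ₑ := by
          rw [← Finset.mul_sum, lintegral_biUnion_finset]
          · intro a _ b _ hab
            exact (hdisj a.2 b.2 (fun h => hab (Subtype.ext h))).mono
              Metric.ball_subset_closedBall Metric.ball_subset_closedBall
          · exact fun b _ => Metric.isOpen_ball.measurableSet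
      _ ≤ isoConst n * ∫⁻ w, K * slab f k s w := by
          exact mul_le_mul' le_rfl <| (setLIntegral_le_lintegral _ _).trans
            (lintegral_mono fun w => enorm_fderiv_smoothTransition_le hf hK k s w)
      _ = _ := by
          rw [lintegral_const_mul (f := slab f k s) _
            ((measurable_slab hf k).comp measurable_prodMk_left), mul_assoc]
  calc ν E ≤ ∑' b : u, ν (Metric.ball (b : Rn n) (16 * r b)) :=
        (measure_mono hsub).trans (measure_biUnion_le ν hcount _)
    _ ≤ ∑' b : u, 16 ^ (n - 1) * A * ENNReal.ofReal (r b) ^ (n - 1) := by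
        refine ENNReal.tsum_le_tsum fun b => ?_
        have h0 := (hr b (huE b.2)).1
        refine (hν b _ (by positivity)).trans (le_of_eq ?_)
        rw [ENNReal.ofReal_mul (by norm_num), mul_pow, ENNReal.ofReal_ofNat]; ring
    _ = 16 ^ (n - 1) * A * ∑' b : u, ENNReal.ofReal (r b) ^ (n - 1) := ENNReal.tsum_mul_left
    _ ≤ 16 ^ (n - 1) * A * (isoConst n * K * liminf (fun k => ∫⁻ z, slab f k s z) atTop) := by
        gcongr
    _ = _ := by ring

/-! ### The trace inequality, global and on balls. -/

/-- The Meyers–Ziemer trace inequality for compactly supported `C¹` functions. -/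
theorem exists_lintegral_enorm_le_lintegral_fderiv (hn : 0 < n) :
    ∃ C : ℝ≥0, ∀ (ν : Measure (Rn n)) (A : ℝ≥0),
      (∀ (y : Rn n) (r : ℝ), 0 < r → ν (Metric.ball y r) ≤ A * ENNReal.ofReal r ^ (n - 1)) →
      ∀ f : Rn n → ℝ, ContDiff ℝ 1 f → HasCompactSupport f →
        ∫⁻ z, ‖f z‖ₑ ∂ν ≤ C * A * ∫⁻ z, ‖fderiv ℝ f z‖ₑ := by
  obtain ⟨K, hK⟩ := exists_bound_deriv_smoothTransition
  set C₀ : ℝ≥0∞ := 16 ^ (n - 1) * isoConst n * K with hC₀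
  have hC₀t : C₀ ≠ ⊤ := ENNReal.mul_ne_top (ENNReal.mul_ne_top (by simp) isoConst_ne_top) (by simp)
  -- The factor `2` accounts for the positive and the negative part of `f`.
  refine ⟨(2 * C₀).toNNReal, fun ν A hν f hf hfc => ?_⟩
  rw [ENNReal.coe_toNNReal (ENNReal.mul_ne_top (by simp) hC₀t)]
  -- Layer-cake formula for the positive part, then Fatou's lemma in `k` to exchange the limit
  -- inferior with the integral over levels.
  have key : ∀ f : Rn n → ℝ, ContDiff ℝ 1 f → HasCompactSupport f →
      ∫⁻ z, ENNReal.ofReal (max (f z) 0) ∂ν ≤ C₀ * A * ∫⁻ z, ‖fderiv ℝ f z‖ₑ := by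
    intro f hf hfc
    have hc := hf.continuous
    rw [lintegral_eq_lintegral_meas_lt (f := fun z => max (f z) 0) ν (Eventually.of_forall fun z => le_max_right _ _)
      (by exact (hc.max continuous_const).measurable.aemeasurable)]
    calc ∫⁻ t in Set.Ioi (0 : ℝ), ν {a | t < max (f a) 0}
        ≤ ∫⁻ t in Set.Ioi (0 : ℝ), C₀ * A * liminf (fun k => ∫⁻ z, slab f k t z) atTop := by
          refine setLIntegral_mono' measurableSet_Ioi fun t ht => ?_
          have ht' : (0 : ℝ) < t := ht
          have : {a | t < max (f a) 0} = {a | t < f a} := by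
            ext a; simp [not_lt.2 ht'.le]
          rw [this]
          refine measure_superlevel_le hn hK hν hf t ?_
          -- For positive levels the superlevel set lies in the compact support.
          refine measure_ne_top_of_subset (fun z hz => ?_) hfc.isCompact.measure_lt_top.ne
          refine subset_tsupport f ?_
          rw [Function.mem_support]
          exact (ht'.trans hz).ne'
      _ ≤ ∫⁻ t, C₀ * A * liminf (fun k => ∫⁻ z, slab f k t z) atTop :=
          setLIntegral_le_lintegral _ _
      _ = C₀ * A * ∫⁻ t, liminf (fun k => ∫⁻ z, slab f k t z) atTop := by
          refine lintegral_const_mul' _ _ (ENNReal.mul_ne_top hC₀t (by simp))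
      _ ≤ C₀ * A * liminf (fun k => ∫⁻ t, ∫⁻ z, slab f k t z) atTop := by
          gcongr
          exact lintegral_liminf_le fun k => (measurable_slab hf k).lintegral_prod_right'
      _ ≤ C₀ * A * ∫⁻ z, ‖fderiv ℝ f z‖ₑ := by
          gcongr
          refine liminf_le_of_frequently_le' (Frequently.of_forall fun k => lintegral_slab_le hf k)
  have h1 := key f hf hfc
  have h2 := key (fun z => -f z) hf.neg hfc.neg
  have h3 : ∫⁻ z, ‖fderiv ℝ (fun z => -f z) z‖ₑ = ∫⁻ z, ‖fderiv ℝ f z‖ₑ := by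
    refine lintegral_congr fun z => ?_
    rw [fderiv_fun_neg, enorm_neg]
  rw [h3] at h2
  have hc := hf.continuous
  calc ∫⁻ z, ‖f z‖ₑ ∂ν ≤ ∫⁻ z, (ENNReal.ofReal (max (f z) 0) + ENNReal.ofReal (max (-f z) 0)) ∂ν := by
        refine lintegral_mono fun z => ?_
        rw [← ENNReal.ofReal_add (le_max_right _ _) (le_max_right _ _), Real.enorm_eq_ofReal_abs]
        refine ENNReal.ofReal_le_ofReal (abs_le'.2 ⟨?_, ?_⟩) <;>
        linarith [le_max_left (f z) 0, le_max_right (f z) 0, le_max_left (-f z) 0,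
          le_max_right (-f z) 0]
    _ = _ := lintegral_add_left (by exact ((hc.max continuous_const).measurable).ennreal_ofReal) _
    _ ≤ _ := add_le_add h1 h2
    _ = _ := by ring

theorem enorm_add_le_dual (a b : Rn n →L[ℝ] ℝ) : ‖a + b‖ₑ ≤ ‖a‖ₑ + ‖b‖ₑ := by
  simp only [← ofReal_norm]
  rw [← ENNReal.ofReal_add (norm_nonneg _) (norm_nonneg _)]
  exact ENNReal.ofReal_le_ofReal (norm_add_le _ _)

/-- The trace inequality on a ball, for functions without boundary conditions. -/
theorem exists_lintegral_enorm_le_of_closedBall (hn : 0 < n) :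
    ∃ C : ℝ≥0, ∀ (ν : Measure (Rn n)) (A : ℝ≥0) (x : Rn n) (L : ℝ), 0 < L →
      (∀ (y : Rn n) (r : ℝ), 0 < r → ν (Metric.ball y r) ≤ A * ENNReal.ofReal r ^ (n - 1)) →
      ν (Metric.closedBall x L)ᶜ = 0 →
      ∀ v : Rn n → ℝ, ContDiff ℝ 1 v →
        ∫⁻ z, ‖v z‖ₑ ∂ν ≤ C * A * ((∫⁻ z in Metric.ball x (2 * L), ‖fderiv ℝ v z‖ₑ) +
          (ENNReal.ofReal L)⁻¹ * ∫⁻ z in Metric.ball x (2 * L), ‖v z‖ₑ) := by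
  obtain ⟨C₀, hC₀⟩ := exists_lintegral_enorm_le_lintegral_fderiv hn
  let b : ContDiffBump (0 : Rn n) := ⟨1, 2, one_pos, one_lt_two⟩
  have hb : ContDiff ℝ 1 b := b.contDiff
  obtain ⟨K, hK⟩ := (hb.continuous_fderiv one_ne_zero).bounded_above_of_compact_support
    (b.hasCompactSupport.fderiv ℝ)
  have hK0 : 0 ≤ K := (norm_nonneg _).trans (hK 0)
  refine ⟨C₀ * (1 + K.toNNReal), fun ν A x L hL hν hsupp v hv => ?_⟩
  -- A cutoff at scale `L`: it is `1` where `ν` lives, vanishes off `B(x,2L)`, and its gradient, of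
  -- size `K/L`, produces the term with `L⁻¹`.
  set φ : Rn n → ℝ := fun z => b (L⁻¹ • (z - x)) with hφ
  have hφd : ContDiff ℝ 1 φ := hb.comp (by fun_prop)
  have hnorm : ∀ z, ‖L⁻¹ • (z - x)‖ = ‖z - x‖ / L := fun z => by
    rw [norm_smul, Real.norm_eq_abs, abs_of_pos (inv_pos.2 hL)]; field_simp
  have hφ1 : ∀ z ∈ Metric.closedBall x L, φ z = 1 := fun z hz => by
    refine b.one_of_mem_closedBall ?_
    rw [mem_closedBall_zero_iff, hnorm]
    exact (div_le_one hL).2 (mem_closedBall_iff_norm.1 hz)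
  have hφ0 : ∀ z, z ∉ Metric.ball x (2 * L) → φ z = 0 := fun z hz => by
    refine b.zero_of_le_dist ?_
    rw [dist_zero_right, hnorm, le_div_iff₀ hL]
    simpa [dist_eq_norm] using hz
  have hφd0 : ∀ z, z ∉ Metric.ball x (2 * L) → fderiv ℝ φ z = 0 := fun z hz => by
    -- A zero of a nonnegative function is a minimum; this also covers the boundary of the ball.
    refine IsLocalMin.fderiv_eq_zero (Eventually.of_forall fun w => ?_)
    rw [hφ0 z hz]; exact b.nonneg
  have hφK : ∀ z, ‖fderiv ℝ φ z‖ₑ ≤ K.toNNReal * (ENNReal.ofReal L)⁻¹ := fun z => by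
    have h1 : HasFDerivAt (fun z : Rn n => L⁻¹ • (z - x)) (L⁻¹ • ContinuousLinearMap.id ℝ (Rn n)) z :=
      ((hasFDerivAt_id z).sub_const x).const_smul L⁻¹
    have h2 : fderiv ℝ φ z = (fderiv ℝ b (L⁻¹ • (z - x))).comp
        (L⁻¹ • ContinuousLinearMap.id ℝ (Rn n)) :=
      HasFDerivAt.fderiv ((hb.differentiable one_ne_zero _).hasFDerivAt.comp z h1)
    rw [h2, ContinuousLinearMap.comp_smul, enorm_smul, ContinuousLinearMap.comp_id, mul_comm]
    gcongr
    · rw [← ofReal_norm]; exact ENNReal.ofReal_le_ofReal (hK _)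
    · rw [Real.enorm_eq_ofReal (inv_nonneg.2 hL.le), ENNReal.ofReal_inv_of_pos hL]
  have hsuppc : HasCompactSupport fun z => v z * φ z := by
    refine HasCompactSupport.of_support_subset_isCompact (isCompact_closedBall x (2 * L)) ?_
    intro z hz
    by_contra hz'
    exact hz (by simp [hφ0 z (fun h => hz' (Metric.ball_subset_closedBall h))])
  have hprod : ∀ z, ‖fderiv ℝ (fun z => v z * φ z) z‖ₑ ≤
      (Metric.ball x (2 * L)).indicator (fun z => ‖fderiv ℝ v z‖ₑ +
        K.toNNReal * (ENNReal.ofReal L)⁻¹ * ‖v z‖ₑ) z := fun z => by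
    rw [fderiv_fun_mul (hv.differentiable one_ne_zero z) (hφd.differentiable one_ne_zero z)]
    by_cases hz : z ∈ Metric.ball x (2 * L)
    · rw [Set.indicator_of_mem hz, add_comm]
      refine le_trans (enorm_add_le_dual _ _) (add_le_add ?_ ?_)
      · rw [enorm_smul]
        refine mul_le_of_le_one_left zero_le ?_
        rw [Real.enorm_eq_ofReal b.nonneg]
        exact ENNReal.ofReal_le_one.2 b.le_one
      · rw [enorm_smul, mul_comm]
        gcongr
        exact hφK z
    · rw [hφ0 z hz, hφd0 z hz, smul_zero, zero_smul, add_zero, ← ofReal_norm, norm_zero,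
        ENNReal.ofReal_zero]
      exact zero_le
  calc ∫⁻ z, ‖v z‖ₑ ∂ν = ∫⁻ z, ‖v z * φ z‖ₑ ∂ν := by
        refine lintegral_congr_ae ?_
        have : ∀ᵐ z ∂ν, z ∈ Metric.closedBall x L := hsupp
        filter_upwards [this] with z hz
        rw [hφ1 z hz, mul_one]
    _ ≤ C₀ * A * ∫⁻ z, ‖fderiv ℝ (fun z => v z * φ z) z‖ₑ :=
        hC₀ ν A hν _ (hv.mul hφd) hsuppc
    _ ≤ C₀ * A * ∫⁻ z in Metric.ball x (2 * L), (‖fderiv ℝ v z‖ₑ +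
        K.toNNReal * (ENNReal.ofReal L)⁻¹ * ‖v z‖ₑ) := by
        rw [← lintegral_indicator Metric.isOpen_ball.measurableSet]
        gcongr
        exact hprod _
    _ = C₀ * A * ((∫⁻ z in Metric.ball x (2 * L), ‖fderiv ℝ v z‖ₑ) +
          K.toNNReal * ((ENNReal.ofReal L)⁻¹ * ∫⁻ z in Metric.ball x (2 * L), ‖v z‖ₑ)) := by
        rw [lintegral_add_left (measurable_enorm_fderiv hv), lintegral_const_mul' _ _
          (ENNReal.mul_ne_top (by simp) (by simpa using hL)), mul_assoc (K.toNNReal : ℝ≥0∞)]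
    _ ≤ _ := by
        rw [ENNReal.coe_mul, ENNReal.coe_add, ENNReal.coe_one]
        set a := ∫⁻ z in Metric.ball x (2 * L), ‖fderiv ℝ v z‖ₑ
        set c := (ENNReal.ofReal L)⁻¹ * ∫⁻ z in Metric.ball x (2 * L), ‖v z‖ₑ
        calc C₀ * A * (a + K.toNNReal * c) ≤
              C₀ * A * ((1 + K.toNNReal) * a + (1 + K.toNNReal) * c) := by
              gcongr
              · exact le_mul_of_one_le_left zero_le le_self_add
              · exact le_add_self
          _ = _ := by ring

/-! ### Mollification of functions and of weak gradients. -/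

section Mollification

variable {F : Type*} [NormedAddCommGroup F] [NormedSpace ℝ F]

/-- Smooth bump functions at the origin with outer radius `1 / (k + 1)`. -/
def bump (n k : ℕ) : ContDiffBump (0 : Rn n) where
  rIn := 1 / (k + 1) / 2
  rOut := 1 / (k + 1)
  rIn_pos := by positivity
  rIn_lt_rOut := half_lt_self (by positivity)

/-- The mollifying kernel at scale `1 / (k + 1)`. -/
def kernel (n k : ℕ) : Rn n → ℝ := (bump n k).normed volume

/-- The mollification of `f` at scale `1 / (k + 1)`. -/
def mollify (k : ℕ) (f : Rn n → F) : Rn n → F :=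
  convolution (kernel n k) f (ContinuousLinearMap.lsmul ℝ ℝ) volume

/-- The mollification of a function with values in `[0, ∞]`. -/
def smear (k : ℕ) (H : Rn n → ℝ≥0∞) (w : Rn n) : ℝ≥0∞ :=
  ∫⁻ a, ENNReal.ofReal (kernel n k a) * H (w - a)

theorem kernel_nonneg (k : ℕ) (a : Rn n) : 0 ≤ kernel n k a := (bump n k).nonneg_normed a

theorem contDiff_kernel (k : ℕ) : ContDiff ℝ ∞ (kernel n k) := (bump n k).contDiff_normed

theorem continuous_kernel (k : ℕ) : Continuous (kernel n k) := (contDiff_kernel k).continuous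

theorem hasCompactSupport_kernel (k : ℕ) : HasCompactSupport (kernel n k) :=
  (bump n k).hasCompactSupport_normed

theorem norm_lt_of_kernel_ne_zero {k : ℕ} {a : Rn n} (h : kernel n k a ≠ 0) :
    ‖a‖ < 1 / (k + 1) := by
  have : a ∈ Function.support ((bump n k).normed volume) := h
  rw [(bump n k).support_normed_eq] at this
  simpa [bump] using this

theorem measurable_ofReal_kernel (k : ℕ) :
    Measurable fun a => ENNReal.ofReal (kernel n k a) :=
  (continuous_kernel k).measurable.ennreal_ofReal

theorem lintegral_kernel (k : ℕ) : ∫⁻ a, ENNReal.ofReal (kernel n k a) = 1 := by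
  rw [← ofReal_integral_eq_lintegral_ofReal (f := kernel n k) (bump n k).integrable_normed
    (Eventually.of_forall (kernel_nonneg k))]
  rw [kernel, (bump n k).integral_normed, ENNReal.ofReal_one]

theorem contDiff_mollify (k : ℕ) {f : Rn n → F} [CompleteSpace F]
    (hf : LocallyIntegrable f volume) :
    ContDiff ℝ 1 (mollify k f) :=
  (hasCompactSupport_kernel k).contDiff_convolution_left (n := 1) _
    ((contDiff_kernel k).of_le (by simp)) hf

theorem enorm_mollify_le (k : ℕ) (f : Rn n → F) (w : Rn n) :
    ‖mollify k f w‖ₑ ≤ smear k (fun z => ‖f z‖ₑ) w := by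
  refine (enorm_integral_le_lintegral_enorm _).trans (le_of_eq (lintegral_congr fun a => ?_))
  rw [ContinuousLinearMap.lsmul_apply, enorm_smul, Real.enorm_eq_ofReal (kernel_nonneg k a)]

theorem aemeasurable_smear_integrand (k : ℕ) {H : Rn n → ℝ≥0∞} (hH : AEMeasurable H volume) :
    AEMeasurable (fun q : Rn n × Rn n => ENNReal.ofReal (kernel n k q.2) * H (q.1 - q.2))
      (volume.prod volume) :=
  ((measurable_ofReal_kernel k).comp measurable_snd).aemeasurable.mul
    (hH.comp_quasiMeasurePreserving
      (quasiMeasurePreserving_sub_of_right_invariant volume volume))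

/-- A smear is a weighted mean, with total weight one, of translates by vectors shorter than
`1/(k+1)`. By Fubini, any bound uniform over those translates passes to the mean. -/
theorem lintegral_mul_smear_le (k : ℕ) {H Φ : Rn n → ℝ≥0∞} (hH : AEMeasurable H volume)
    (hΦ : Measurable Φ) {B : ℝ≥0∞}
    (h : ∀ a : Rn n, ‖a‖ < 1 / (k + 1) → ∫⁻ w, Φ w * H (w - a) ≤ B) :
    ∫⁻ w, Φ w * smear k H w ≤ B := by
  have hae : ∀ w : Rn n, AEMeasurable (fun a => H (w - a)) volume := fun w =>
    hH.comp_quasiMeasurePreserving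
      (quasiMeasurePreserving_sub_left_of_right_invariant volume w)
  have hae' : ∀ a : Rn n, AEMeasurable (fun w => H (w - a)) volume := fun a =>
    hH.comp_quasiMeasurePreserving
      (measurePreserving_sub_right volume a).quasiMeasurePreserving
  calc ∫⁻ w, Φ w * smear k H w
      = ∫⁻ w, ∫⁻ a, Φ w * (ENNReal.ofReal (kernel n k a) * H (w - a)) := by
        refine lintegral_congr fun w => ?_
        rw [smear, lintegral_const_mul'']
        exact (measurable_ofReal_kernel k).aemeasurable.mul (hae w)
    _ = ∫⁻ a, ∫⁻ w, Φ w * (ENNReal.ofReal (kernel n k a) * H (w - a)) :=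
        lintegral_lintegral_swap ((hΦ.comp measurable_fst).aemeasurable.mul
          (aemeasurable_smear_integrand k hH))
    _ = ∫⁻ a, ENNReal.ofReal (kernel n k a) * ∫⁻ w, Φ w * H (w - a) := by
        refine lintegral_congr fun a => ?_
        rw [← lintegral_const_mul'' (f := fun w => Φ w * H (w - a)) _
          (hΦ.aemeasurable.mul (hae' a))]
        refine lintegral_congr fun w => by ring
    _ ≤ ∫⁻ a, ENNReal.ofReal (kernel n k a) * B := by
        refine lintegral_mono fun a => ?_
        by_cases ha : kernel n k a = 0
        · simp [ha]
        · exact mul_le_mul' le_rfl (h a (norm_lt_of_kernel_ne_zero ha))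
    _ = B := by
        rw [lintegral_mul_const _ (measurable_ofReal_kernel k), lintegral_kernel, one_mul]

theorem lintegral_smear_le (k : ℕ) {H : Rn n → ℝ≥0∞} (hH : AEMeasurable H volume) :
    ∫⁻ w, smear k H w ≤ ∫⁻ w, H w := by
  have := lintegral_mul_smear_le k (Φ := fun _ => 1) hH measurable_const (B := ∫⁻ w, H w)
    fun a _ => by
      simp only [one_mul]
      rw [lintegral_sub_right_eq_self H a]
  simpa using this

theorem setLIntegral_ball_smear_le (k : ℕ) {H : Rn n → ℝ≥0∞} (hH : AEMeasurable H volume)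
    (x : Rn n) (L : ℝ) :
    ∫⁻ w in Metric.ball x L, smear k H w ≤ ∫⁻ w in Metric.ball x (L + 1 / (k + 1)), H w := by
  have := lintegral_mul_smear_le k (Φ := (Metric.ball x L).indicator 1) hH
    (measurable_one.indicator Metric.isOpen_ball.measurableSet)
    (B := ∫⁻ w in Metric.ball x (L + 1 / (k + 1)), H w) fun a ha => by
      rw [← lintegral_indicator Metric.isOpen_ball.measurableSet,
        ← lintegral_sub_right_eq_self ((Metric.ball x (L + 1 / (k + 1))).indicator H) a]
      refine lintegral_mono fun w => ?_
      by_cases hw : w ∈ Metric.ball x L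
      · have : w - a ∈ Metric.ball x (L + 1 / (k + 1)) := by
          rw [mem_ball_iff_norm] at hw ⊢
          calc ‖w - a - x‖ = ‖(w - x) - a‖ := by congr 1; abel
            _ ≤ ‖w - x‖ + ‖a‖ := norm_sub_le _ _
            _ < _ := by linarith
        rw [Set.indicator_of_mem hw, Set.indicator_of_mem this, Pi.one_apply, one_mul]
      · simp [hw]
  refine le_trans (le_of_eq ?_) this
  rw [← lintegral_indicator Metric.isOpen_ball.measurableSet]
  refine lintegral_congr fun w => ?_
  by_cases hw : w ∈ Metric.ball x L <;> simp [hw]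

theorem setLIntegral_ball_mollify_le (k : ℕ) {f : Rn n → F}
    (hf : AEStronglyMeasurable f volume) (x : Rn n) (L : ℝ) :
    ∫⁻ w in Metric.ball x L, ‖mollify k f w‖ₑ ≤
      ∫⁻ w in Metric.ball x (L + 1 / (k + 1)), ‖f w‖ₑ :=
  (lintegral_mono fun w => enorm_mollify_le k f w).trans
    (setLIntegral_ball_smear_le k hf.enorm x L)

theorem convolutionExistsAt_kernel (k : ℕ) {f : Rn n → F} (hf : LocallyIntegrable f volume)
    (x : Rn n) :
    ConvolutionExistsAt (kernel n k) f x (ContinuousLinearMap.lsmul ℝ ℝ) volume :=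
  (hasCompactSupport_kernel k).convolutionExists_left _ (continuous_kernel k) hf x

theorem mollify_sub (k : ℕ) {f g : Rn n → F} (hf : LocallyIntegrable f volume)
    (hg : LocallyIntegrable g volume) (x : Rn n) :
    mollify k (fun z => f z - g z) x = mollify k f x - mollify k g x := by
  have h1 := convolutionExistsAt_kernel k hf x
  have h2 := convolutionExistsAt_kernel k hg x
  simp only [mollify, convolution, map_sub]
  exact integral_sub h1 h2

/-- Approximate `f` in `L¹` of a ball by a continuous function `c` of compact support: mollification
moves `c` uniformly little, and does not increase the `L¹` error apart from a slight enlargement of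
the ball. -/
theorem tendsto_setLIntegral_mollify_sub [CompleteSpace F] {f : Rn n → F} (hf : LocallyIntegrable f volume)
    (x : Rn n) (L : ℝ) :
    Tendsto (fun k => ∫⁻ w in Metric.ball x L, ‖mollify k f w - f w‖ₑ) atTop (𝓝 0) := by
  -- The radius `L + 1` leaves room for the mollification scale `1/(k+1) ≤ 1`.
  have hint : Integrable ((Metric.ball x (L + 1)).indicator f) volume := by
    rw [integrable_indicator_iff Metric.isOpen_ball.measurableSet]
    exact (hf.integrableOn_isCompact (isCompact_closedBall x (L + 1))).mono_set
      Metric.ball_subset_closedBall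
  rw [ENNReal.tendsto_nhds_zero]
  intro ε hε
  rcases eq_or_ne ε ⊤ with rfl | hεt
  · exact Eventually.of_forall fun _ => le_top
  have hε3 : ε / 3 ≠ 0 := by simpa using hε.ne'
  obtain ⟨c, hcs, hcε, hcc, -⟩ := hint.exists_hasCompactSupport_lintegral_sub_le hε3
  have hε3t : ε / 3 ≠ ⊤ := ENNReal.div_ne_top hεt (by simp)
  have hcε' : ∫⁻ w in Metric.ball x (L + 1), ‖f w - c w‖ₑ ≤ ε / 3 := by
    refine le_trans ?_ hcε
    rw [← lintegral_indicator Metric.isOpen_ball.measurableSet]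
    refine lintegral_mono fun w => ?_
    by_cases hw : w ∈ Metric.ball x (L + 1) <;> simp [hw]
  set V := volume (Metric.ball x L) with hV
  have hVt : V ≠ ⊤ := measure_ball_lt_top.ne
  obtain ⟨δ, hδ0, hδ⟩ : ∃ δ : ℝ, 0 < δ ∧ ENNReal.ofReal δ * V ≤ ε / 3 := by
    have h1 : ε / 3 / (V + 1) ≠ ⊤ := ENNReal.div_ne_top hε3t (by simp)
    have h2 : ε / 3 / (V + 1) ≠ 0 := ENNReal.div_ne_zero.2 ⟨hε3, by simp [hVt]⟩
    refine ⟨(ε / 3 / (V + 1)).toReal, ENNReal.toReal_pos h2 h1, ?_⟩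
    rw [ENNReal.ofReal_toReal h1]
    calc ε / 3 / (V + 1) * V ≤ ε / 3 / (V + 1) * (V + 1) := by gcongr; exact le_self_add
      _ ≤ ε / 3 := (ENNReal.div_mul_cancel (by simp) (by simp [hVt])).le
  have huc := hcs.uniformContinuous_of_continuous hcc
  obtain ⟨η, hη0, hη⟩ := Metric.uniformContinuous_iff.1 huc δ hδ0
  have hk : ∀ᶠ k : ℕ in atTop, (1 : ℝ) / (k + 1) < η :=
    (tendsto_one_div_add_atTop_nhds_zero_nat).eventually (gt_mem_nhds hη0)
  filter_upwards [hk] with k hk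
  have hcl : LocallyIntegrable c volume := hcc.locallyIntegrable
  have h1k : (1 : ℝ) / (k + 1) ≤ 1 := by
    rw [div_le_one (by positivity)]
    linarith [(Nat.cast_nonneg k : (0 : ℝ) ≤ k)]
  have hmeas : AEStronglyMeasurable (fun z => f z - c z) volume :=
    hf.aestronglyMeasurable.sub hcc.aestronglyMeasurable
  have e1 : ∫⁻ w in Metric.ball x L, ‖mollify k (fun z => f z - c z) w‖ₑ ≤ ε / 3 := by
    refine (setLIntegral_ball_mollify_le k hmeas x L).trans (le_trans ?_ hcε')
    exact lintegral_mono_set (Metric.ball_subset_ball (by linarith))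
  have e2 : ∫⁻ w in Metric.ball x L, ‖f w - c w‖ₑ ≤ ε / 3 := by
    refine le_trans ?_ hcε'
    exact lintegral_mono_set (Metric.ball_subset_ball (by linarith))
  have e3 : ∀ w, ‖mollify k c w - c w‖ₑ ≤ ENNReal.ofReal δ := by
    intro w
    rw [← ofReal_norm, ← dist_eq_norm]
    refine ENNReal.ofReal_le_ofReal ?_
    refine (bump n k).dist_normed_convolution_le hcc.aestronglyMeasurable fun z hz => ?_
    exact (hη (lt_trans (by simpa [bump] using hz) hk)).le
  calc ∫⁻ w in Metric.ball x L, ‖mollify k f w - f w‖ₑ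
      ≤ ∫⁻ w in Metric.ball x L, (ENNReal.ofReal δ + (‖mollify k (fun z => f z - c z) w‖ₑ +
          ‖f w - c w‖ₑ)) := by
        refine lintegral_mono fun w => ?_
        have : mollify k f w - f w = (mollify k c w - c w) +
            (mollify k (fun z => f z - c z) w - (f w - c w)) := by
          rw [mollify_sub k hf hcl]; abel
        rw [this]
        exact (enorm_add_le _ _).trans (add_le_add (e3 w) enorm_sub_le)
    _ = ENNReal.ofReal δ * V + ((∫⁻ w in Metric.ball x L, ‖mollify k (fun z => f z - c z) w‖ₑ) +
          ∫⁻ w in Metric.ball x L, ‖f w - c w‖ₑ) := by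
        rw [lintegral_add_left measurable_const, setLIntegral_const,
          lintegral_add_right' _ hmeas.restrict.enorm]
    _ ≤ ε / 3 + (ε / 3 + ε / 3) := add_le_add hδ (add_le_add e1 e2)
    _ = ε := by rw [← add_assoc]; exact ENNReal.add_thirds ε

/-- The definition of weak gradient, tested with `z ↦ kernel n k (x - z)`. -/
theorem fderiv_mollify {u : Rn n → ℝ} {g : Rn n → Rn n} (h : IsWeakGradient u g) (k : ℕ)
    (x : Rn n) : fderiv ℝ (mollify k u) x = innerSL ℝ (mollify k g x) := by
  have h1 : ContDiff ℝ 1 (kernel n k) := (contDiff_kernel k).of_le (by simp)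
  have hd : HasFDerivAt (mollify k u) _ x :=
    (hasCompactSupport_kernel k).hasFDerivAt_convolution_left (ContinuousLinearMap.lsmul ℝ ℝ) h1
      h.locInt x
  rw [hd.fderiv]
  ext e
  have hex := ((hasCompactSupport_kernel k).fderiv ℝ).convolutionExists_left
    ((ContinuousLinearMap.lsmul ℝ ℝ).precompL (Rn n) : (Rn n →L[ℝ] ℝ) →L[ℝ] ℝ →L[ℝ] _)
    (h1.continuous_fderiv one_ne_zero) h.locInt x
  have hφ : ContDiff ℝ ∞ fun z => kernel n k (x - z) := (contDiff_kernel k).comp (by fun_prop)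
  have hφc : HasCompactSupport fun z => kernel n k (x - z) :=
    (hasCompactSupport_kernel k).comp_homeomorph (Homeomorph.subLeft x)
  have hw := h.integral_eq _ hφ hφc e
  have hder : ∀ z, fderiv ℝ (fun z => kernel n k (x - z)) z e = -fderiv ℝ (kernel n k) (x - z) e := by
    intro z
    have : HasFDerivAt (fun z => x - z) (-ContinuousLinearMap.id ℝ (Rn n)) z :=
      (hasFDerivAt_id z).const_sub x
    have h3 : fderiv ℝ (fun z => kernel n k (x - z)) z =
        (fderiv ℝ (kernel n k) (x - z)).comp (-ContinuousLinearMap.id ℝ (Rn n)) :=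
      HasFDerivAt.fderiv ((h1.differentiable one_ne_zero _).hasFDerivAt.comp z this)
    rw [h3]; simp
  simp only [hder, mul_neg, integral_neg, neg_inj] at hw
  have hg := convolutionExistsAt_kernel k h.locInt_grad x
  rw [convolution, ContinuousLinearMap.integral_apply hex, innerSL_apply_apply]
  rw [real_inner_comm, mollify, convolution, ← integral_inner hg]
  rw [← integral_sub_left_eq_self _ volume x]
  simp only [sub_sub_cancel, ContinuousLinearMap.precompL_apply, ContinuousLinearMap.lsmul_apply,
    smul_eq_mul]
  rw [← integral_sub_left_eq_self (fun t => inner ℝ e (kernel n k t • g (x - t))) volume x]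
  simp only [sub_sub_cancel, real_inner_smul_right]
  simp only [mul_comm (u _), mul_comm (inner ℝ (g _) e)] at hw
  rw [hw]
  simp only [real_inner_comm]

theorem enorm_fderiv_mollify {u : Rn n → ℝ} {g : Rn n → Rn n} (h : IsWeakGradient u g) (k : ℕ)
    (x : Rn n) : ‖fderiv ℝ (mollify k u) x‖ₑ = ‖mollify k g x‖ₑ := by
  rw [fderiv_mollify h, ← ofReal_norm, innerSL_apply_norm, ofReal_norm]

/-- Above the level `l`, `t = t^{1-p} t^p ≤ l^{1-p} t^p`. With `l` chosen afterwards according to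
scale, this split replaces Hölder's inequality throughout. -/
theorem le_add_mul_rpow {p : ℝ} (hp : 1 < p) (t : ℝ≥0∞) {l : ℝ} (hl : 0 < l) :
    t ≤ ENNReal.ofReal l + ENNReal.ofReal (l ^ (1 - p)) * t ^ p := by
  rcases le_or_gt t (ENNReal.ofReal l) with h | h
  · exact h.trans le_self_add
  refine le_trans ?_ le_add_self
  rcases eq_or_ne t ⊤ with rfl | ht
  · rw [ENNReal.top_rpow_of_pos (by linarith), ENNReal.mul_top]
    simpa using Real.rpow_pos_of_pos hl _
  lift t to ℝ≥0 using ht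
  have h' : l < t := by
    rw [ENNReal.ofReal_lt_iff_lt_toReal hl.le (by simp)] at h
    simpa using h
  have ht0 : (0 : ℝ) < t := hl.trans h'
  rw [← ENNReal.ofReal_coe_nnreal, ENNReal.ofReal_rpow_of_pos ht0,
    ← ENNReal.ofReal_mul (by positivity)]
  refine ENNReal.ofReal_le_ofReal ?_
  calc (t : ℝ) = (t : ℝ) ^ (1 - p) * (t : ℝ) ^ p := by
        rw [← Real.rpow_add ht0, sub_add_cancel, Real.rpow_one]
    _ ≤ l ^ (1 - p) * (t : ℝ) ^ p := by
        exact mul_le_mul_of_nonneg_right (Real.rpow_le_rpow_of_nonpos hl h'.le (by linarith))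
          (by positivity)

theorem enorm_mollify_le_rpow {p : ℝ} (hp : 1 < p) (k : ℕ) {f : Rn n → F}
    (w : Rn n) {l : ℝ} (hl : 0 < l) :
    ‖mollify k f w‖ₑ ≤ ENNReal.ofReal l +
      ENNReal.ofReal (l ^ (1 - p)) * smear k (fun z => ‖f z‖ₑ ^ p) w := by
  calc ‖mollify k f w‖ₑ ≤ smear k (fun z => ‖f z‖ₑ) w := enorm_mollify_le k f w
    _ ≤ ∫⁻ a, (ENNReal.ofReal (kernel n k a) * ENNReal.ofReal l + ENNReal.ofReal (l ^ (1 - p)) *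
          (ENNReal.ofReal (kernel n k a) * ‖f (w - a)‖ₑ ^ p)) := by
        refine lintegral_mono fun a => ?_
        refine (mul_le_mul' le_rfl (le_add_mul_rpow hp ‖f (w - a)‖ₑ hl)).trans (le_of_eq ?_)
        ring
    _ = _ := by
        rw [lintegral_add_left ((measurable_ofReal_kernel k).mul_const _),
          lintegral_mul_const _ (measurable_ofReal_kernel k), lintegral_kernel, one_mul,
          lintegral_const_mul' _ _ ENNReal.ofReal_ne_top]
        rfl

end Mollification

/-! ### Comparison of the precise representative with smooth functions. -/

theorem laverage_ball_eq {H : Rn n → ℝ≥0∞} (hH : Measurable H) (y : Rn n) {r : ℝ} (hr : 0 < r) :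
    ⨍⁻ w in Metric.ball y r, H w ∂volume =
      (volume (Metric.ball (0 : Rn n) 1))⁻¹ * ∫⁻ z in Metric.ball 0 1, H (y + r • z) := by
  rw [setLAverage_eq, lintegral_unitBall_comp hH y hr, volume_ball_eq y hr, div_eq_mul_inv,
    ENNReal.mul_inv (Or.inr volume_unitBall_ne_top) (Or.inr volume_unitBall_ne_zero)]
  ring

theorem radialPotential_mono {h h' : Rn n → ℝ≥0∞} (hh : ∀ w, h w ≤ h' w) {r r' ρ ρ' : ℝ}
    (hr : r' ≤ r) (hρ : ρ ≤ ρ') (y : Rn n) :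
    radialPotential h r ρ y ≤ radialPotential h' r' ρ' y := by
  refine (lintegral_mono_set (Set.Ioc_subset_Ioc hr hρ)).trans (lintegral_mono fun s => ?_)
  exact mul_le_mul' le_rfl (lintegral_mono hh)

theorem enorm_average_sub_le {v : Rn n → ℝ} (hv : ContDiff ℝ 1 v) (y : Rn n) {r : ℝ} (hr : 0 < r) :
    ‖(⨍ w in Metric.ball y r, v w) - v y‖ₑ ≤ (volume (Metric.ball (0 : Rn n) 1))⁻¹ *
      radialPotential (fun w => ‖fderiv ℝ v w‖ₑ) 0 r y := by
  have hc := hv.continuous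
  have hne : volume (Metric.ball y r) ≠ 0 := (Metric.measure_ball_pos _ _ hr).ne'
  have hnt : volume (Metric.ball y r) ≠ ⊤ := measure_ball_lt_top.ne
  have hint : IntegrableOn v (Metric.ball y r) volume :=
    (hc.locallyIntegrable.integrableOn_isCompact (isCompact_closedBall y r)).mono_set
      Metric.ball_subset_closedBall
  have h1 : (⨍ w in Metric.ball y r, v w) - v y = ⨍ w in Metric.ball y r, (v w - v y) := by
    rw [setAverage_eq, setAverage_eq, integral_sub hint (integrableOn_const hnt), setIntegral_const,
      smul_sub, smul_smul, measureReal_def, inv_mul_cancel₀ (ENNReal.toReal_pos hne hnt).ne',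
      one_smul]
  rw [h1]
  have h2 : ‖⨍ w in Metric.ball y r, (v w - v y)‖ₑ ≤
      ⨍⁻ w in Metric.ball y r, ‖v w - v y‖ₑ ∂volume := enorm_integral_le_lintegral_enorm _
  refine h2.trans ?_
  rw [laverage_ball_eq (by exact (hc.sub continuous_const).enorm.measurable) y hr]
  refine mul_le_mul' le_rfl ?_
  have := lintegral_unitBall_enorm_sub_le hv y le_rfl hr.le
  simpa using this

theorem tendsto_average_mollify {u : Rn n → ℝ} (hu : LocallyIntegrable u volume) (y : Rn n)
    (r : ℝ) :
    Tendsto (fun k => ⨍ w in Metric.ball y r, mollify k u w) atTop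
      (𝓝 (⨍ w in Metric.ball y r, u w)) := by
  have hb : ∀ f : Rn n → ℝ, LocallyIntegrable f volume → IntegrableOn f (Metric.ball y r) volume :=
    fun f hf => (hf.integrableOn_isCompact (isCompact_closedBall y r)).mono_set
      Metric.ball_subset_closedBall
  simp only [setAverage_eq]
  refine Tendsto.const_smul ?_ _
  exact tendsto_integral_of_L1 _ (hb u hu).aestronglyMeasurable
    (Eventually.of_forall fun k => hb _ (contDiff_mollify k hu).continuous.locallyIntegrable)
    (tendsto_setLIntegral_mollify_sub hu y r)

/-- The means over `B(y,r)` of the mollifications converge to that of `u`, whereas their values at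
`y` need not converge; hence the limit inferior. The bound does not depend on `r ≤ ρ`, so it applies
to the upper limit defining the precise representative at every point `y`. -/
theorem enorm_average_sub_le_liminf {u : Rn n → ℝ} {g : Rn n → Rn n} (h : IsWeakGradient u g)
    (y : Rn n) (c : ℝ) {r ρ : ℝ} (hr : 0 < r) (hρ : r ≤ ρ) :
    ‖(⨍ w in Metric.ball y r, u w) - c‖ₑ ≤ liminf (fun k => ‖mollify k u y - c‖ₑ +
      (volume (Metric.ball (0 : Rn n) 1))⁻¹ *
        radialPotential (fun w => ‖mollify k g w‖ₑ) 0 ρ y) atTop := by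
  have ht : Tendsto (fun k => ‖(⨍ w in Metric.ball y r, mollify k u w) - c‖ₑ) atTop
      (𝓝 ‖(⨍ w in Metric.ball y r, u w) - c‖ₑ) :=
    ((tendsto_average_mollify h.locInt y r).sub_const c).enorm
  rw [← ht.liminf_eq]
  refine liminf_le_liminf (Eventually.of_forall fun k => ?_)
  have h1 : (⨍ w in Metric.ball y r, mollify k u w) - c =
      (mollify k u y - c) + ((⨍ w in Metric.ball y r, mollify k u w) - mollify k u y) := by ring
  rw [h1]
  refine (enorm_add_le _ _).trans (add_le_add le_rfl ?_)
  refine (enorm_average_sub_le (contDiff_mollify k h.locInt) y hr).trans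
    (mul_le_mul' le_rfl ?_)
  exact radialPotential_mono (fun w => (enorm_fderiv_mollify h k w).le) le_rfl hρ y

theorem abs_preciseRep_le {u : Rn n → ℝ} {y : Rn n} {c : ℝ} {G : ℝ≥0∞} {ρ : ℝ} (hρ : 0 < ρ)
    (h : ∀ r, 0 < r → r ≤ ρ → ‖(⨍ w in Metric.ball y r, u w) - c‖ₑ ≤ G) :
    (preciseRep u y).abs ≤ ‖c‖ₑ + G ∧ ‖c‖ₑ ≤ (preciseRep u y).abs + G := by
  rcases eq_or_ne G ⊤ with rfl | hG
  · simp
  have hev : ∀ᶠ r in 𝓝[>] (0 : ℝ), |(⨍ w in Metric.ball y r, u w) - c| ≤ G.toReal := by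
    filter_upwards [Ioc_mem_nhdsGT hρ] with r hr
    have := h r hr.1 hr.2
    rwa [Real.enorm_eq_ofReal_abs, ENNReal.ofReal_le_iff_le_toReal hG] at this
  have hup : preciseRep u y ≤ ((c + G.toReal : ℝ) : EReal) := by
    refine limsup_le_of_le (by isBoundedDefault) ?_
    filter_upwards [hev] with r hr
    exact EReal.coe_le_coe_iff.2 (by linarith [(abs_le.1 hr).2])
  have hlo : ((c - G.toReal : ℝ) : EReal) ≤ preciseRep u y := by
    refine le_limsup_of_frequently_le (Eventually.frequently ?_) (by isBoundedDefault)
    filter_upwards [hev] with r hr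
    exact EReal.coe_le_coe_iff.2 (by linarith [(abs_le.1 hr).1])
  obtain ⟨t, ht⟩ : ∃ t : ℝ, preciseRep u y = t := by
    induction hq : preciseRep u y with
    | bot => rw [hq] at hlo; exact absurd (le_bot_iff.1 hlo) (EReal.coe_ne_bot _)
    | top => rw [hq] at hup; exact absurd (top_le_iff.1 hup) (EReal.coe_ne_top _)
    | coe a => exact ⟨a, rfl⟩
  rw [ht] at hup hlo ⊢
  rw [EReal.coe_le_coe_iff] at hup hlo
  rw [EReal.abs_def, Real.enorm_eq_ofReal_abs, ← ENNReal.ofReal_toReal hG,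
    ← ENNReal.ofReal_add (abs_nonneg _) ENNReal.toReal_nonneg,
    ← ENNReal.ofReal_add (abs_nonneg _) ENNReal.toReal_nonneg]
  constructor <;> refine ENNReal.ofReal_le_ofReal (abs_le.2 ⟨?_, ?_⟩) <;>
  linarith [le_abs_self c, neg_abs_le c, le_abs_self t, neg_abs_le t]

theorem lintegral_lintegral_ball {ν : Measure (Rn n)} [SFinite ν] {H : Rn n → ℝ≥0∞}
    (hH : Measurable H) (s : ℝ) :
    ∫⁻ y, (∫⁻ w in Metric.ball y s, H w) ∂ν = ∫⁻ w, H w * ν (Metric.ball w s) := by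
  have h1 : ∀ y : Rn n, ∫⁻ w in Metric.ball y s, H w =
      ∫⁻ w, {q : Rn n × Rn n | dist q.2 q.1 < s}.indicator (fun q => H q.2) (y, w) := fun y => by
    rw [← lintegral_indicator Metric.isOpen_ball.measurableSet]
    rfl
  simp only [h1]
  have hs : MeasurableSet {q : Rn n × Rn n | dist q.2 q.1 < s} :=
    (isOpen_lt (by fun_prop) (by fun_prop)).measurableSet
  rw [lintegral_lintegral_swap (f := fun y w =>
    {q : Rn n × Rn n | dist q.2 q.1 < s}.indicator (fun q => H q.2) (y, w))
    (((hH.comp measurable_snd).indicator hs).aemeasurable :)]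
  refine lintegral_congr fun w => ?_
  have h2 : (fun y : Rn n => {q : Rn n × Rn n | dist q.2 q.1 < s}.indicator
      (fun q => H q.2) (y, w)) = (Metric.ball w s).indicator fun _ => H w := by
    ext y
    have : y ∈ Metric.ball w s ↔ (y, w) ∈ {q : Rn n × Rn n | dist q.2 q.1 < s} := by
      rw [Metric.mem_ball, dist_comm]; rfl
    by_cases hy : y ∈ Metric.ball w s
    · rw [Set.indicator_of_mem hy, Set.indicator_of_mem (this.1 hy)]
    · rw [Set.indicator_of_notMem hy, Set.indicator_of_notMem fun h => hy (this.2 h)]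
  rw [h2, lintegral_indicator Metric.isOpen_ball.measurableSet, setLIntegral_const]

theorem measurable_lintegral_ball_left {h : Rn n → ℝ≥0∞} (hh : Measurable h) (s : ℝ) :
    Measurable fun y : Rn n => ∫⁻ w in Metric.ball y s, h w :=
  Measurable.of_uncurry_right (f := fun (y : Rn n) (s : ℝ) => ∫⁻ w in Metric.ball y s, h w)
    (measurable_lintegral_ball hh)

/-- At radius `s` the level part of `h` is integrated trivially, and for the part with `H` Fubini
trades the integral over balls for `ν(B(w,s)) ≤ A s^{n-1}`. Only `H`, which plays the role of `h^p`,
has to be integrable. The remaining power of `s` is integrable at `0` because `p > 1`. -/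
theorem lintegral_radialPotential_le (hn : 0 < n) {ν : Measure (Rn n)} [IsFiniteMeasure ν]
    {A : ℝ≥0}
    (hν : ∀ (y : Rn n) (r : ℝ), 0 < r → ν (Metric.ball y r) ≤ A * ENNReal.ofReal r ^ (n - 1))
    {p : ℝ} (hp : 1 < p) {h H : Rn n → ℝ≥0∞} (hh : Measurable h) (hH : Measurable H)
    (hhH : ∀ (l : ℝ), 0 < l → ∀ w,
      h w ≤ ENNReal.ofReal l + ENNReal.ofReal (l ^ (1 - p)) * H w) (ρ : ℝ) :
    ∫⁻ y, radialPotential h 0 ρ y ∂ν ≤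
      (volume (Metric.ball (0 : Rn n) 1) * ν Set.univ + A * ∫⁻ w, H w) *
        ∫⁻ s in Set.Ioc 0 ρ, ENNReal.ofReal (s ^ (-(1 / p))) := by
  set V := volume (Metric.ball (0 : Rn n) 1)
  set N := ∫⁻ w, H w
  have hmeas : Measurable fun q : Rn n × ℝ =>
      (ENNReal.ofReal q.2 ^ n)⁻¹ * ∫⁻ w in Metric.ball q.1 q.2, h w :=
    (by fun_prop : Measurable fun q : Rn n × ℝ => (ENNReal.ofReal q.2 ^ n)⁻¹).mul
      (measurable_lintegral_ball hh)
  simp only [radialPotential]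
  rw [lintegral_lintegral_swap hmeas.aemeasurable, ← lintegral_const_mul _ (by fun_prop)]
  refine setLIntegral_mono' measurableSet_Ioc fun s hs => ?_
  have hs0 := hs.1
  have hS0 : ENNReal.ofReal s ≠ 0 := by simpa using hs0
  have hSt : ENNReal.ofReal s ≠ ⊤ := ENNReal.ofReal_ne_top
  have hl : 0 < s ^ (-(1 / p)) := Real.rpow_pos_of_pos hs0 _
  rw [lintegral_const_mul _ (measurable_lintegral_ball_left hh s)]
  -- With this level `l^{1-p} = s l`, so both contributions, after division by `sⁿ`, are multiples
  -- of `l = s^{-1/p}`.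
  set l := s ^ (-(1 / p)) with hldef
  have hl1 : l ^ (1 - p) = s * l := by
    have hp0 : p ≠ 0 := by positivity
    rw [hldef, ← Real.rpow_mul hs0.le, ← Real.rpow_one_add' hs0.le]
    · congr 1; field_simp; ring
    · rw [ne_eq, ← sub_eq_add_neg, sub_eq_zero, eq_div_iff hp0]; linarith
  have hb : ∫⁻ y, (∫⁻ w in Metric.ball y s, h w) ∂ν ≤
      ENNReal.ofReal l * (ENNReal.ofReal s ^ n * V) * ν Set.univ +
        ENNReal.ofReal s * ENNReal.ofReal l * (A * ENNReal.ofReal s ^ (n - 1) * N) := by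
    calc ∫⁻ y, (∫⁻ w in Metric.ball y s, h w) ∂ν
        ≤ ∫⁻ y, (ENNReal.ofReal l * (ENNReal.ofReal s ^ n * V) +
            ENNReal.ofReal s * ENNReal.ofReal l * ∫⁻ w in Metric.ball y s, H w) ∂ν := by
          refine lintegral_mono fun y => ?_
          refine (lintegral_mono (hhH l hl)).trans (le_of_eq ?_)
          rw [lintegral_add_left measurable_const, setLIntegral_const, volume_ball_eq y hs0,
            lintegral_const_mul _ hH, hl1, ENNReal.ofReal_mul hs0.le]
      _ = ENNReal.ofReal l * (ENNReal.ofReal s ^ n * V) * ν Set.univ +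
            ENNReal.ofReal s * ENNReal.ofReal l * ∫⁻ w, H w * ν (Metric.ball w s) := by
          rw [lintegral_add_left measurable_const, lintegral_const,
            lintegral_const_mul' _ _ (ENNReal.mul_ne_top hSt (by simp)),
            lintegral_lintegral_ball hH]
      _ ≤ _ := by
          refine add_le_add le_rfl (mul_le_mul' le_rfl ?_)
          rw [← lintegral_const_mul _ hH]
          refine lintegral_mono fun w => ?_
          rw [mul_comm]
          exact mul_le_mul' (hν w s hs0) le_rfl
  refine (mul_le_mul' le_rfl hb).trans (le_of_eq ?_)
  obtain ⟨m, rfl⟩ := Nat.exists_eq_succ_of_ne_zero hn.ne'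
  have hc : (ENNReal.ofReal s ^ (m + 1))⁻¹ * ENNReal.ofReal s ^ (m + 1) = 1 :=
    ENNReal.inv_mul_cancel (pow_ne_zero _ hS0) (ENNReal.pow_ne_top hSt)
  simp only [Nat.succ_eq_add_one, Nat.add_sub_cancel]
  calc _ = ((ENNReal.ofReal s ^ (m + 1))⁻¹ * ENNReal.ofReal s ^ (m + 1)) *
        ((V * ν Set.univ + A * N) * ENNReal.ofReal l) := by ring
    _ = _ := by rw [hc, one_mul]

theorem lintegral_Ioc_rpow {e : ℝ} (he : -1 < e) {a : ℝ} (ha : 0 ≤ a) :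
    ∫⁻ s in Set.Ioc 0 a, ENNReal.ofReal (s ^ e) = ENNReal.ofReal (a ^ (e + 1) / (e + 1)) := by
  have hi : IntervalIntegrable (fun s : ℝ => s ^ e) volume 0 a :=
    intervalIntegral.intervalIntegrable_rpow' he
  rw [← ofReal_integral_eq_lintegral_ofReal
    ((intervalIntegrable_iff_integrableOn_Ioc_of_le ha).1 hi)]
  · rw [← intervalIntegral.integral_of_le ha, integral_rpow (Or.inl he),
      Real.zero_rpow (by linarith), sub_zero]
  · filter_upwards [ae_restrict_mem measurableSet_Ioc] with s hs
    exact Real.rpow_nonneg hs.1.le _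

theorem tendsto_setLIntegral_rpow {p : ℝ} (hp : 1 < p) :
    Tendsto (fun ρ : ℝ => ∫⁻ s in Set.Ioc 0 ρ, ENNReal.ofReal (s ^ (-(1 / p)))) (𝓝[>] 0)
      (𝓝 0) := by
  have hp' : 1 / p < 1 := by rw [div_lt_one (by positivity)]; exact hp
  have hlim : Tendsto (fun ρ : ℝ => ENNReal.ofReal (ρ ^ (-(1 / p) + 1) / (-(1 / p) + 1))) (𝓝[>] 0)
      (𝓝 0) := by
    have h1 : Tendsto (fun ρ : ℝ => ρ ^ (-(1 / p) + 1) / (-(1 / p) + 1)) (𝓝[>] 0) (𝓝 0) := by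
      have h2 : ContinuousAt (fun ρ : ℝ => ρ ^ (-(1 / p) + 1) / (-(1 / p) + 1)) 0 :=
        (Real.continuousAt_rpow_const _ _ (Or.inr (by linarith))).div_const _
      have h3 := h2.tendsto
      rw [Real.zero_rpow (by linarith), zero_div] at h3
      exact h3.mono_left nhdsWithin_le_nhds
    simpa using ENNReal.tendsto_ofReal h1
  refine hlim.congr' ?_
  filter_upwards [self_mem_nhdsWithin] with ρ hρ
  exact (lintegral_Ioc_rpow (by linarith) (le_of_lt hρ)).symm

theorem measurable_smear (k : ℕ) {H : Rn n → ℝ≥0∞} (hH : Measurable H) :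
    Measurable (smear k H) := by
  have : Measurable fun q : Rn n × Rn n => ENNReal.ofReal (kernel n k q.2) * H (q.1 - q.2) :=
    ((measurable_ofReal_kernel k).comp measurable_snd).mul
      (hH.comp (measurable_fst.sub measurable_snd))
  exact this.lintegral_prod_right'

theorem smear_congr (k : ℕ) {H H' : Rn n → ℝ≥0∞} (h : H =ᵐ[volume] H') (w : Rn n) :
    smear k H w = smear k H' w := by
  refine lintegral_congr_ae ?_
  have := (quasiMeasurePreserving_sub_left_of_right_invariant volume w).ae h
  filter_upwards [this] with a ha
  rw [ha]

theorem enorm_sub_le_add_dual (a b c : Rn n →L[ℝ] ℝ) : ‖a - c‖ₑ ≤ ‖a - b‖ₑ + ‖b - c‖ₑ := by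
  rw [← sub_add_sub_cancel a b c]
  exact enorm_add_le_dual _ _

/-- Comparison of the precise representative of a Sobolev function with a `C¹` function in
`L¹(ν)`, for a measure `ν` with `ν(B(y,r)) ≤ A r^{n-1}` carried by a ball. -/
theorem exists_lintegral_preciseRep_le (hn : 0 < n) :
    ∃ C : ℝ≥0, ∀ (ν : Measure (Rn n)) [IsFiniteMeasure ν] (A : ℝ≥0) (x : Rn n) (L : ℝ), 0 < L →
      (∀ (y : Rn n) (r : ℝ), 0 < r → ν (Metric.ball y r) ≤ A * ENNReal.ofReal r ^ (n - 1)) →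
      ν (Metric.closedBall x L)ᶜ = 0 →
      ∀ p : ℝ, 1 < p → ∀ (u : Rn n → ℝ) (g : Rn n → Rn n), IsSobolev p u g →
      ∀ w : Rn n → ℝ, ContDiff ℝ 1 w →
        (∫⁻ y, (preciseRep u y).abs ∂ν ≤ ∫⁻ y, ‖w y‖ₑ ∂ν +
          C * A * ((∫⁻ z in Metric.ball x (2 * L), ‖innerSL ℝ (g z) - fderiv ℝ w z‖ₑ) +
            (ENNReal.ofReal L)⁻¹ * ∫⁻ z in Metric.ball x (2 * L), ‖u z - w z‖ₑ)) ∧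
        (∫⁻ y, ‖w y‖ₑ ∂ν ≤ ∫⁻ y, (preciseRep u y).abs ∂ν +
          C * A * ((∫⁻ z in Metric.ball x (2 * L), ‖innerSL ℝ (g z) - fderiv ℝ w z‖ₑ) +
            (ENNReal.ofReal L)⁻¹ * ∫⁻ z in Metric.ball x (2 * L), ‖u z - w z‖ₑ)) := by
  obtain ⟨C, hC⟩ := exists_lintegral_enorm_le_of_closedBall hn
  refine ⟨C, fun ν _ A x L hL hν hsupp p hp u g hug w hw => ?_⟩
  have hWG := hug.weakGradient
  have hp0 : 0 < p := by linarith
  set V := volume (Metric.ball (0 : Rn n) 1) with hV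
  set B := Metric.ball x (2 * L)
  set E := C * A * ((∫⁻ z in B, ‖innerSL ℝ (g z) - fderiv ℝ w z‖ₑ) +
    (ENNReal.ofReal L)⁻¹ * ∫⁻ z in B, ‖u z - w z‖ₑ) with hE
  have hgm : AEMeasurable (fun z => ‖g z‖ₑ ^ p) volume :=
    hWG.locInt_grad.aestronglyMeasurable.enorm.pow_const p
  set N := ∫⁻ z, ‖g z‖ₑ ^ p with hN
  have hNt : N ≠ ⊤ := by
    have := lintegral_rpow_enorm_lt_top_of_eLpNorm_lt_top (by simpa using hp0) (by simp)
      hug.memLp_grad.eLpNorm_lt_top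
    rw [ENNReal.toReal_ofReal hp0.le] at this
    exact this.ne
  set κ := V⁻¹ * (V * ν Set.univ + A * N) with hκ
  have hκt : κ ≠ ⊤ := ENNReal.mul_ne_top (ENNReal.inv_ne_top.2 volume_unitBall_ne_zero)
    (ENNReal.add_ne_top.2 ⟨ENNReal.mul_ne_top volume_unitBall_ne_top (measure_ne_top _ _),
      ENNReal.mul_ne_top (by simp) hNt⟩)
  set ι : ℝ → ℝ≥0∞ := fun ρ => ∫⁻ s in Set.Ioc 0 ρ, ENNReal.ofReal (s ^ (-(1 / p))) with hι
  have hmg : ∀ k, Continuous (mollify k g) := fun k => (contDiff_mollify k hWG.locInt_grad).continuous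
  have hmu : ∀ k, ContDiff ℝ 1 (mollify k u) := fun k => contDiff_mollify k hWG.locInt
  -- The error made in replacing means of `u` over balls of radius at most `ρ` by `w`: the distance
  -- of the `k`-th mollification to `w`, plus the truncated potential of the mollified gradient.
  set Gk : ℝ → ℕ → Rn n → ℝ≥0∞ := fun ρ k y => ‖mollify k u y - w y‖ₑ +
    V⁻¹ * radialPotential (fun w => ‖mollify k g w‖ₑ) 0 ρ y with hGk
  have hm1 : ∀ k, Measurable fun y => ‖mollify k u y - w y‖ₑ := fun k =>
    ((hmu k).continuous.sub hw.continuous).enorm.measurable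
  have hGkm : ∀ ρ k, Measurable (Gk ρ k) := fun ρ k =>
    (hm1 k).add ((measurable_radialPotential (hmg k).enorm.measurable 0 ρ).const_mul _)
  set G : ℝ → Rn n → ℝ≥0∞ := fun ρ y => liminf (fun k => Gk ρ k y) atTop with hG
  have hGm : ∀ ρ, Measurable (G ρ) := fun ρ => Measurable.liminf fun k => hGkm ρ k
  have hpt : ∀ ρ, 0 < ρ → ∀ y, (preciseRep u y).abs ≤ ‖w y‖ₑ + G ρ y ∧
      ‖w y‖ₑ ≤ (preciseRep u y).abs + G ρ y := fun ρ hρ y =>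
    abs_preciseRep_le hρ fun r hr hrρ => enorm_average_sub_le_liminf hWG y (w y) hr hrρ
  -- The trace inequality for the `C¹` function `mollify k u - w`, with `u` and `g` inserted as
  -- intermediate terms; the mollification errors vanish as `k → ∞`.
  have htrace : ∀ k, ∫⁻ y, ‖mollify k u y - w y‖ₑ ∂ν ≤
      C * A * (((∫⁻ z in B, ‖mollify k g z - g z‖ₑ) +
          ∫⁻ z in B, ‖innerSL ℝ (g z) - fderiv ℝ w z‖ₑ) +
        (ENNReal.ofReal L)⁻¹ * ((∫⁻ z in B, ‖mollify k u z - u z‖ₑ) +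
          ∫⁻ z in B, ‖u z - w z‖ₑ)) := by
    intro k
    refine (hC ν A x L hL hν hsupp _ ((hmu k).sub hw)).trans ?_
    refine mul_le_mul' le_rfl (add_le_add ?_ (mul_le_mul' le_rfl ?_))
    · rw [← lintegral_add_left' (f := fun z => ‖mollify k g z - g z‖ₑ)
        ((hmg k).aestronglyMeasurable.sub hWG.locInt_grad.aestronglyMeasurable).restrict.enorm]
      refine lintegral_mono fun z => ?_
      have h1 : fderiv ℝ (fun z => mollify k u z - w z) z =
          innerSL ℝ (mollify k g z) - fderiv ℝ w z := by
        rw [fderiv_fun_sub ((hmu k).differentiable one_ne_zero z)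
          (hw.differentiable one_ne_zero z), fderiv_mollify hWG]
      refine (le_of_eq (congrArg _ h1)).trans ?_
      refine (enorm_sub_le_add_dual _ (innerSL ℝ (g z)) _).trans (add_le_add (le_of_eq ?_) le_rfl)
      rw [← map_sub, ← ofReal_norm, innerSL_apply_norm, ofReal_norm]
    · rw [← lintegral_add_left' (f := fun z => ‖mollify k u z - u z‖ₑ)
        ((hmu k).continuous.aestronglyMeasurable.sub hWG.locInt.aestronglyMeasurable).restrict.enorm]
      refine lintegral_mono fun z => ?_
      rw [← sub_add_sub_cancel (mollify k u z) (u z) (w z)]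
      exact enorm_add_le _ _
  -- A bound uniform in `k`: mollification does not increase `∫ |g|^p`. As `|g|^p` is only a.e.
  -- measurable, a measurable version is smeared, with the same result.
  have hpot : ∀ ρ k, V⁻¹ * ∫⁻ y, radialPotential (fun w => ‖mollify k g w‖ₑ) 0 ρ y ∂ν ≤
      κ * ι ρ := by
    intro ρ k
    have h1 := lintegral_radialPotential_le hn hν hp (hmg k).enorm.measurable
      (measurable_smear k hgm.measurable_mk) (fun l hl z => by
        rw [← smear_congr k hgm.ae_eq_mk]
        exact enorm_mollify_le_rpow hp k z hl) ρ
    refine (mul_le_mul' le_rfl h1).trans ?_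
    rw [← mul_assoc]
    refine mul_le_mul' (mul_le_mul' le_rfl (add_le_add le_rfl (mul_le_mul' le_rfl ?_))) le_rfl
    refine (lintegral_smear_le k hgm.measurable_mk.aemeasurable).trans (le_of_eq ?_)
    exact (lintegral_congr_ae hgm.ae_eq_mk).symm
  have hGint : ∀ ρ, ∫⁻ y, G ρ y ∂ν ≤ E + κ * ι ρ := by
    intro ρ
    refine (lintegral_liminf_le fun k => hGkm ρ k).trans ?_
    have hstep : ∀ k, ∫⁻ y, Gk ρ k y ∂ν ≤
        C * A * (((∫⁻ z in B, ‖mollify k g z - g z‖ₑ) +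
          ∫⁻ z in B, ‖innerSL ℝ (g z) - fderiv ℝ w z‖ₑ) +
        (ENNReal.ofReal L)⁻¹ * ((∫⁻ z in B, ‖mollify k u z - u z‖ₑ) +
          ∫⁻ z in B, ‖u z - w z‖ₑ)) + κ * ι ρ := by
      intro k
      simp only [hGk]
      rw [lintegral_add_left (hm1 k), lintegral_const_mul _
        (measurable_radialPotential (hmg k).enorm.measurable 0 ρ)]
      exact add_le_add (htrace k) (hpot ρ k)
    refine (liminf_le_liminf (Eventually.of_forall hstep)).trans (le_of_eq ?_)
    refine Tendsto.liminf_eq ?_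
    have hLt : (ENNReal.ofReal L)⁻¹ ≠ ⊤ := by simpa using hL
    have t1 := tendsto_setLIntegral_mollify_sub hWG.locInt_grad x (2 * L)
    have t2 := tendsto_setLIntegral_mollify_sub hWG.locInt x (2 * L)
    have t3 := ENNReal.Tendsto.const_mul (a := (C * A : ℝ≥0∞)) ((t1.add_const
      (∫⁻ z in B, ‖innerSL ℝ (g z) - fderiv ℝ w z‖ₑ)).add (ENNReal.Tendsto.const_mul
        (a := (ENNReal.ofReal L)⁻¹) (t2.add_const (∫⁻ z in B, ‖u z - w z‖ₑ)) (Or.inr hLt)))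
        (Or.inr (ENNReal.mul_ne_top (by simp) (by simp)))
    rw [zero_add, zero_add] at t3
    exact t3.add_const (κ * ι ρ)
  -- Neither side of the claim involves `ρ`, so the potential term is removed by `ρ → 0`.
  have hlim : ∀ a : ℝ≥0∞, Tendsto (fun ρ => a + (E + κ * ι ρ)) (𝓝[>] 0) (𝓝 (a + E)) := by
    intro a
    have h1 := ENNReal.Tendsto.const_mul (a := κ) (tendsto_setLIntegral_rpow hp) (Or.inr hκt)
    rw [mul_zero] at h1
    have h2 := (h1.const_add E).const_add a
    rw [add_zero] at h2
    exact h2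
  constructor
  · refine ge_of_tendsto (hlim _) ?_
    filter_upwards [self_mem_nhdsWithin] with ρ hρ
    calc ∫⁻ y, (preciseRep u y).abs ∂ν ≤ ∫⁻ y, (‖w y‖ₑ + G ρ y) ∂ν :=
          lintegral_mono fun y => (hpt ρ hρ y).1
      -- Only one summand has to be measurable for additivity, so the measurability of the precise
      -- representative plays no role.
      _ = ∫⁻ y, ‖w y‖ₑ ∂ν + ∫⁻ y, G ρ y ∂ν := lintegral_add_right _ (hGm ρ)
      _ ≤ _ := add_le_add le_rfl (hGint ρ)
  · refine ge_of_tendsto (hlim _) ?_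
    filter_upwards [self_mem_nhdsWithin] with ρ hρ
    calc ∫⁻ y, ‖w y‖ₑ ∂ν ≤ ∫⁻ y, ((preciseRep u y).abs + G ρ y) ∂ν :=
          lintegral_mono fun y => (hpt ρ hρ y).2
      _ = ∫⁻ y, (preciseRep u y).abs ∂ν + ∫⁻ y, G ρ y ∂ν := lintegral_add_right _ (hGm ρ)
      _ ≤ _ := add_le_add le_rfl (hGint ρ)

/-! ### Dilated and translated measures; the pointwise estimate. -/

/-- The image of `μ` under `z ↦ t z + x`. -/
def place (μ : Measure (Rn n)) (t : ℝ) (x : Rn n) : Measure (Rn n) :=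
  μ.map fun z => t • z + x

theorem measurable_smul_add (t : ℝ) (x : Rn n) : Measurable fun z : Rn n => t • z + x :=
  (by fun_prop : Continuous fun z : Rn n => t • z + x).measurable

theorem place_eq_map_rescale (μ : Measure (Rn n)) (t : ℝ) (x : Rn n) :
    place μ t x = (rescale μ t).map (fun z => z + x) := by
  rw [rescale, Measure.map_map (measurable_add_const x) (measurable_const_smul t)]
  rfl

/-- Translation is a measurable equivalence, so no measurability of `f` is required. This keeps the
identities for the examples valid for arbitrary functions. -/
theorem lintegral_rescale (μ : Measure (Rn n)) (t : ℝ) (x : Rn n) (f : Rn n → ℝ≥0∞) :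
    ∫⁻ z, f (z + x) ∂(rescale μ t) = ∫⁻ y, f y ∂(place μ t x) := by
  rw [place_eq_map_rescale]
  exact (lintegral_map_equiv f (MeasurableEquiv.addRight x)).symm

theorem maximalOp_eq (μ : Measure (Rn n)) (v : Rn n → EReal) (x : Rn n) :
    maximalOp μ v x = ⨆ (t : ℝ) (_ : 0 < t), ∫⁻ y, (v y).abs ∂(place μ t x) := by
  simp only [maximalOp]
  refine iSup_congr fun t => iSup_congr fun _ => ?_
  exact lintegral_rescale μ t x fun y => (v y).abs

theorem IsSphericalLike.measure_compl_closedBall {μ : Measure (Rn n)} {R M : ℝ}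
    (h : IsSphericalLike μ R M) : μ (Metric.closedBall 0 R)ᶜ = 0 :=
  measure_mono_null (Set.compl_subset_compl.2 h.support_subset) Measure.measure_compl_support

/-- If `R ≤ 0`, every ball around the origin would have mass one, although `M r^{n-1} → 0` because
`n ≥ 2`. -/
theorem IsSphericalLike.radius_pos (hn : 2 ≤ n) {μ : Measure (Rn n)} {R M : ℝ}
    (h : IsSphericalLike μ R M) : 0 < R := by
  have := h.isProbabilityMeasure
  by_contra hR
  have h0 : μ (Metric.closedBall 0 R)ᶜ = 0 := h.measure_compl_closedBall
  have hball : ∀ r : ℝ, 0 < r → 1 ≤ ENNReal.ofReal (M * r ^ (n - 1)) := by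
    intro r hr
    refine le_trans ?_ (h.measure_ball_le 0 r hr)
    have h1 : μ (Metric.closedBall 0 R) = 1 := (prob_compl_eq_zero_iff₀
      Metric.isClosed_closedBall.measurableSet.nullMeasurableSet).1 h0
    rw [← h1]
    exact measure_mono (Metric.closedBall_subset_ball (by linarith))
  have hlim : Tendsto (fun r : ℝ => ENNReal.ofReal (M * r ^ (n - 1))) (𝓝[>] 0) (𝓝 0) := by
    have hc : Continuous fun r : ℝ => ENNReal.ofReal (M * r ^ (n - 1)) :=
      ENNReal.continuous_ofReal.comp (by fun_prop)
    have h2 := hc.tendsto 0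
    rw [zero_pow (by omega), mul_zero, ENNReal.ofReal_zero] at h2
    exact h2.mono_left nhdsWithin_le_nhds
  have h3 : (1 : ℝ≥0∞) ≤ 0 := by
    refine ge_of_tendsto hlim ?_
    filter_upwards [self_mem_nhdsWithin] with r hr using hball r hr
  simp at h3

/-- The growth constant of the image of a spherical-like measure under `z ↦ t z + x`. -/
def growthConst (n : ℕ) (M t : ℝ) : ℝ≥0 := M.toNNReal * (t⁻¹).toNNReal ^ (n - 1)

theorem coe_growthConst (M : ℝ) {t : ℝ} (ht : 0 < t) :
    (growthConst n M t : ℝ≥0∞) = ENNReal.ofReal M * ((ENNReal.ofReal t)⁻¹) ^ (n - 1) := by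
  rw [growthConst, ENNReal.coe_mul, ENNReal.coe_pow, ← ENNReal.ofReal_inv_of_pos ht]
  rfl

theorem IsSphericalLike.place_ball_le {μ : Measure (Rn n)} {R M : ℝ}
    (h : IsSphericalLike μ R M) {t : ℝ} (ht : 0 < t) (x y : Rn n) (r : ℝ) (hr : 0 < r) :
    place μ t x (Metric.ball y r) ≤ growthConst n M t * ENNReal.ofReal r ^ (n - 1) := by
  rw [place, Measure.map_apply (measurable_smul_add t x) Metric.isOpen_ball.measurableSet]
  have hsub : (fun z : Rn n => t • z + x) ⁻¹' Metric.ball y r ⊆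
      Metric.ball (t⁻¹ • (y - x)) (t⁻¹ * r) := by
    intro z hz
    have hz' : ‖t • z + x - y‖ < r := mem_ball_iff_norm.1 hz
    rw [mem_ball_iff_norm]
    have : z - t⁻¹ • (y - x) = t⁻¹ • (t • z + x - y) := by
      rw [smul_sub, smul_sub, smul_add, inv_smul_smul₀ ht.ne']; abel
    rw [this, norm_smul, Real.norm_eq_abs, abs_of_pos (inv_pos.2 ht)]
    exact mul_lt_mul_of_pos_left hz' (inv_pos.2 ht)
  refine (measure_mono hsub).trans ((h.measure_ball_le _ _ (by positivity)).trans (le_of_eq ?_))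
  rw [coe_growthConst M ht, mul_pow, ← mul_assoc, ENNReal.ofReal_mul' (by positivity),
    ENNReal.ofReal_mul' (by positivity), ENNReal.ofReal_pow hr.le,
    ENNReal.ofReal_pow (by positivity), ENNReal.ofReal_inv_of_pos ht]

theorem IsSphericalLike.place_compl_closedBall {μ : Measure (Rn n)} {R M : ℝ}
    (h : IsSphericalLike μ R M) {t : ℝ} (ht : 0 < t) (x : Rn n) :
    place μ t x (Metric.closedBall x (t * R))ᶜ = 0 := by
  rw [place, Measure.map_apply (measurable_smul_add t x)
    Metric.isClosed_closedBall.measurableSet.compl]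
  refine measure_mono_null (fun z hz => ?_) h.measure_compl_closedBall
  intro hz'
  apply hz
  rw [mem_closedBall_iff_norm, add_sub_cancel_right, norm_smul, Real.norm_eq_abs, abs_of_pos ht]
  exact mul_le_mul_of_nonneg_left (mem_closedBall_zero_iff.1 hz') ht.le

theorem isProbabilityMeasure_place {μ : Measure (Rn n)} [IsProbabilityMeasure μ] (t : ℝ)
    (x : Rn n) : IsProbabilityMeasure (place μ t x) :=
  Measure.isProbabilityMeasure_map (measurable_smul_add t x).aemeasurable

theorem setLIntegral_ball_le_rieszPotential (g : Rn n → Rn n) (x : Rn n) {r : ℝ} (hr : 0 < r) :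
    ∫⁻ z in Metric.ball x r, ‖g z‖ₑ ≤ ENNReal.ofReal r ^ (n - 1) * rieszPotential g x := by
  have hr0 : ENNReal.ofReal r ^ (n - 1) ≠ 0 := pow_ne_zero _ (by simpa using hr)
  have hrt : ENNReal.ofReal r ^ (n - 1) ≠ ⊤ := ENNReal.pow_ne_top ENNReal.ofReal_ne_top
  rw [rieszPotential, ← lintegral_const_mul' _ _ hrt]
  refine (setLIntegral_mono' Metric.isOpen_ball.measurableSet fun z hz => ?_).trans
    (setLIntegral_le_lintegral _ _)
  calc ‖g z‖ₑ = ENNReal.ofReal r ^ (n - 1) * (‖g z‖ₑ / ENNReal.ofReal r ^ (n - 1)) :=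
        (ENNReal.mul_div_cancel hr0 hrt).symm
    _ ≤ _ := by
        gcongr
        rw [← ofReal_norm]
        refine ENNReal.ofReal_le_ofReal ?_
        rw [← dist_eq_norm, dist_comm]
        exact (Metric.mem_ball.1 hz).le

theorem setLIntegral_ball_le_hardyLittlewood (u : Rn n → ℝ) (x : Rn n) {r : ℝ} (hr : 0 < r) :
    ∫⁻ z in Metric.ball x r, ‖u z‖ₑ ≤
      ENNReal.ofReal r ^ n * volume (Metric.ball (0 : Rn n) 1) * hardyLittlewood u x := by
  rw [← volume_ball_eq x hr]
  have h1 : ⨍⁻ z in Metric.ball x r, ‖u z‖ₑ ∂volume ≤ hardyLittlewood u x :=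
    le_iSup₂ (f := fun (r : ℝ) (_ : 0 < r) => ⨍⁻ z in Metric.ball x r, ‖u z‖ₑ ∂volume) r hr
  refine le_trans (le_of_eq ?_) (mul_le_mul' le_rfl h1)
  rw [setLAverage_eq, ENNReal.mul_div_cancel (Metric.measure_ball_pos _ _ hr).ne'
    measure_ball_lt_top.ne]

theorem enorm_innerSL (v : Rn n) : ‖innerSL ℝ v‖ₑ = ‖v‖ₑ := by
  rw [← ofReal_norm, innerSL_apply_norm, ofReal_norm]

/-- The pointwise estimate of the maximal operator. -/
theorem exists_maximalOp_preciseRep_le (hn : 2 ≤ n) :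
    ∃ C : ℝ, 0 < C ∧
      ∀ (μ : Measure (Rn n)) (R M : ℝ), IsSphericalLike μ R M →
      ∀ p : ℝ, 1 < p → ∀ (u : Rn n → ℝ) (g : Rn n → Rn n), IsSobolev p u g →
      ∀ x : Rn n, maximalOp μ (preciseRep u) x ≤
          ENNReal.ofReal (C * R ^ (n - 1) * M) * (hardyLittlewood u x + rieszPotential g x) := by
  obtain ⟨C, hC⟩ := exists_lintegral_preciseRep_le (n := n) (by omega)
  set V := volume (Metric.ball (0 : Rn n) 1) with hV
  have hVt : V ≠ ⊤ := volume_unitBall_ne_top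
  -- `C + 1` makes the constant positive; `2ⁿ` comes from the balls of radius `2tR`, and `V` from
  -- the volume in the maximal function.
  refine ⟨(C + 1) * 2 ^ n * (1 + V.toReal), by positivity, ?_⟩
  intro μ R M hμ p hp u g hug x
  have hR := hμ.radius_pos hn
  have := hμ.isProbabilityMeasure
  rw [maximalOp_eq]
  refine iSup₂_le fun t ht => ?_
  have := isProbabilityMeasure_place (μ := μ) t x
  have hL : 0 < t * R := mul_pos ht hR
  -- Comparison with the zero function leaves `∫ |g|` and `L⁻¹ ∫ |u|` over a ball of radius `2tR`.
  have h1 := (hC (place μ t x) (growthConst n M t) x (t * R) hL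
    (fun y r hr => hμ.place_ball_le ht x y r hr) (hμ.place_compl_closedBall ht x) p hp u g hug
    (fun _ => 0) contDiff_const).1
  have h2 : ∀ z, ‖innerSL ℝ (g z) - fderiv ℝ (fun _ : Rn n => (0 : ℝ)) z‖ₑ = ‖g z‖ₑ := fun z => by
    rw [fderiv_fun_const, Pi.zero_apply, sub_zero, enorm_innerSL]
  simp only [h2, enorm_zero, lintegral_zero, zero_add, sub_zero] at h1
  refine h1.trans ?_
  have h2L : 0 < 2 * (t * R) := by positivity
  have hI := setLIntegral_ball_le_rieszPotential g x h2L
  have hM := setLIntegral_ball_le_hardyLittlewood u x h2L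
  set I := rieszPotential g x
  set H := hardyLittlewood u x
  obtain ⟨m, rfl⟩ : ∃ m, n = m + 1 := ⟨n - 1, by omega⟩
  simp only [Nat.add_sub_cancel] at hI ⊢
  rw [coe_growthConst M ht]
  rw [ENNReal.ofReal_mul zero_le_two, ENNReal.ofReal_mul ht.le, ENNReal.ofReal_ofNat] at hI hM
  rw [ENNReal.ofReal_mul ht.le]
  have hconst : ENNReal.ofReal ((C + 1) * 2 ^ (m + 1) * (1 + V.toReal) * R ^ m * M) =
      (C + 1) * 2 ^ (m + 1) * (1 + V) * ENNReal.ofReal R ^ m * ENNReal.ofReal M := by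
    rw [ENNReal.ofReal_mul (by positivity), ENNReal.ofReal_mul (by positivity),
      ENNReal.ofReal_mul (by positivity), ENNReal.ofReal_mul (by positivity),
      ENNReal.ofReal_add (by positivity) zero_le_one,
      ENNReal.ofReal_add zero_le_one (by positivity), ENNReal.ofReal_toReal hVt,
      ENNReal.ofReal_pow zero_le_two, ENNReal.ofReal_pow hR.le, ENNReal.ofReal_one,
      ENNReal.ofReal_ofNat, ENNReal.ofReal_coe_nnreal]
  rw [hconst]
  have hT0 : ENNReal.ofReal t ≠ 0 := by simpa using ht
  have hTt : ENNReal.ofReal t ≠ ⊤ := ENNReal.ofReal_ne_top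
  have hR0 : ENNReal.ofReal R ≠ 0 := by simpa using hR
  have hRt : ENNReal.ofReal R ≠ ⊤ := ENNReal.ofReal_ne_top
  set T := ENNReal.ofReal t
  set S := ENNReal.ofReal R
  set M' := ENNReal.ofReal M
  have hTS : (T * S)⁻¹ * (T * S) = 1 :=
    ENNReal.inv_mul_cancel (mul_ne_zero hT0 hR0) (ENNReal.mul_ne_top hTt hRt)
  have hTm : (T⁻¹) ^ m * T ^ m = 1 := by
    rw [← mul_pow, ENNReal.inv_mul_cancel hT0 hTt, one_pow]
  calc (C : ℝ≥0∞) * (M' * (T⁻¹) ^ m) * ((∫⁻ z in Metric.ball x (2 * (t * R)), ‖g z‖ₑ) +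
        (T * S)⁻¹ * ∫⁻ z in Metric.ball x (2 * (t * R)), ‖u z‖ₑ)
      ≤ C * (M' * (T⁻¹) ^ m) * ((2 * (T * S)) ^ m * I +
          (T * S)⁻¹ * ((2 * (T * S)) ^ (m + 1) * V * H)) := by gcongr
    -- The growth constant contributes `t^{1-n}`, and both ball integrals contribute `(tR)^{n-1}`:
    -- what remains is `R^{n-1} M`.
    _ = ((T⁻¹) ^ m * T ^ m) * (C * M' * S ^ m * (2 ^ m * I +
          ((T * S)⁻¹ * (T * S)) * (2 ^ (m + 1) * V * H))) := by ring
    _ = C * M' * S ^ m * (2 ^ m * I + 2 ^ (m + 1) * V * H) := by rw [hTS, hTm, one_mul, one_mul]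
    _ ≤ (C + 1) * M' * S ^ m * (2 ^ (m + 1) * (1 + V) * I + 2 ^ (m + 1) * (1 + V) * H) := by
        gcongr
        · exact le_self_add
        · calc (2 : ℝ≥0∞) ^ m ≤ 2 ^ (m + 1) * 1 := by
                rw [mul_one]; exact pow_le_pow_right₀ one_le_two (by omega)
            _ ≤ 2 ^ (m + 1) * (1 + V) := by gcongr; exact le_self_add
        · exact le_add_self
    _ = _ := by ring

/-! ### Measurability through lower semicontinuity. -/

theorem lintegral_place_le_liminf {μ : Measure (Rn n)} {f : Rn n → ℝ≥0∞} (hf : Continuous f)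
    (t : ℝ) {X : ℕ → Rn n} {x : Rn n} (hX : Tendsto X atTop (𝓝 x)) :
    ∫⁻ y, f y ∂(place μ t x) ≤ liminf (fun j => ∫⁻ y, f y ∂(place μ t (X j))) atTop := by
  simp only [place, lintegral_map hf.measurable (measurable_smul_add _ _)]
  refine le_trans (le_of_eq (lintegral_congr fun z => ?_))
    (lintegral_liminf_le fun j => hf.measurable.comp (measurable_smul_add t (X j)))
  exact (((hf.tendsto _).comp (tendsto_const_nhds.add hX)).liminf_eq).symm

/-- A supremum of lower semicontinuous functions is lower semicontinuous, so one scale `t` suffices.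
There the average is a locally uniform limit, in the centre, of the corresponding averages of
mollifications, to which Fatou's lemma applies. -/
theorem lowerSemicontinuous_maximalOp (hn : 2 ≤ n) {μ : Measure (Rn n)} {R M : ℝ}
    (hμ : IsSphericalLike μ R M) {p : ℝ} (hp : 1 < p) {u : Rn n → ℝ} {g : Rn n → Rn n}
    (hug : IsSobolev p u g) : LowerSemicontinuous (maximalOp μ (preciseRep u)) := by
  obtain ⟨C, hC⟩ := exists_lintegral_preciseRep_le (n := n) (by omega)
  have hR := hμ.radius_pos hn
  have := hμ.isProbabilityMeasure
  have hWG := hug.weakGradient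
  have heq : maximalOp μ (preciseRep u) =
      fun x => ⨆ (t : ℝ) (_ : 0 < t), ∫⁻ y, (preciseRep u y).abs ∂(place μ t x) :=
    funext fun x => maximalOp_eq μ _ x
  rw [heq]
  refine lowerSemicontinuous_iSup fun t => lowerSemicontinuous_iSup fun ht => ?_
  have hL : 0 < t * R := mul_pos ht hR
  intro x a ha
  by_contra hcon
  obtain ⟨X, hX, hXa⟩ := exists_seq_forall_of_frequently (not_eventually.1 hcon)
  simp only [not_lt] at hXa
  -- The comparison error on a ball enlarged by `1`, which bounds the error for all centres in
  -- `B(x,1)` at once. It is paid twice, at `x` and at the approximating points.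
  set e : ℕ → ℝ≥0∞ := fun k => C * growthConst n M t *
    ((∫⁻ z in Metric.ball x (2 * (t * R) + 1), ‖mollify k g z - g z‖ₑ) +
      (ENNReal.ofReal (t * R))⁻¹ *
        ∫⁻ z in Metric.ball x (2 * (t * R) + 1), ‖mollify k u z - u z‖ₑ) with he
  have hcomp : ∀ k, ∀ x' ∈ Metric.ball x 1,
      (∫⁻ y, (preciseRep u y).abs ∂(place μ t x') ≤
        ∫⁻ y, ‖mollify k u y‖ₑ ∂(place μ t x') + e k) ∧
      (∫⁻ y, ‖mollify k u y‖ₑ ∂(place μ t x') ≤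
        ∫⁻ y, (preciseRep u y).abs ∂(place μ t x') + e k) := by
    intro k x' hx'
    have := isProbabilityMeasure_place (μ := μ) t x'
    have h1 := hC (place μ t x') (growthConst n M t) x' (t * R) hL
      (fun y r hr => hμ.place_ball_le ht x' y r hr) (hμ.place_compl_closedBall ht x') p hp u g hug
      (mollify k u) (contDiff_mollify k hWG.locInt)
    have hsub : Metric.ball x' (2 * (t * R)) ⊆ Metric.ball x (2 * (t * R) + 1) :=
      Metric.ball_subset_ball' (by linarith [Metric.mem_ball.1 hx'])
    have hle : C * growthConst n M t * ((∫⁻ z in Metric.ball x' (2 * (t * R)),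
        ‖innerSL ℝ (g z) - fderiv ℝ (mollify k u) z‖ₑ) + (ENNReal.ofReal (t * R))⁻¹ *
          ∫⁻ z in Metric.ball x' (2 * (t * R)), ‖u z - mollify k u z‖ₑ) ≤ e k := by
      refine mul_le_mul' le_rfl (add_le_add ?_ (mul_le_mul' le_rfl ?_))
      · refine le_trans (lintegral_mono fun z => le_of_eq ?_) (lintegral_mono_set hsub)
        rw [fderiv_mollify hWG, ← map_sub, enorm_innerSL, enorm_sub_rev]
      · refine le_trans (lintegral_mono fun z => le_of_eq ?_) (lintegral_mono_set hsub)
        rw [enorm_sub_rev]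
    exact ⟨h1.1.trans (add_le_add le_rfl hle), h1.2.trans (add_le_add le_rfl hle)⟩
  have helim : Tendsto (fun k => a + e k + e k) atTop (𝓝 a) := by
    have hLt : (ENNReal.ofReal (t * R))⁻¹ ≠ ⊤ := by simpa using hL
    have t1 := tendsto_setLIntegral_mollify_sub hWG.locInt_grad x (2 * (t * R) + 1)
    have t2 := tendsto_setLIntegral_mollify_sub hWG.locInt x (2 * (t * R) + 1)
    have t3 := ENNReal.Tendsto.const_mul (a := (C * growthConst n M t : ℝ≥0∞))
      (t1.add (ENNReal.Tendsto.const_mul (a := (ENNReal.ofReal (t * R))⁻¹) t2 (Or.inr hLt)))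
        (Or.inr (ENNReal.mul_ne_top (by simp) (by simp)))
    rw [mul_zero, add_zero, mul_zero] at t3
    have t4 := (t3.const_add a).add t3
    rw [add_zero, add_zero] at t4
    exact t4
  refine absurd (ge_of_tendsto' helim fun k => ?_) (not_le.2 ha)
  have hev : ∀ᶠ j in atTop, X j ∈ Metric.ball x 1 := hX.eventually (Metric.ball_mem_nhds x one_pos)
  calc ∫⁻ y, (preciseRep u y).abs ∂(place μ t x)
      ≤ ∫⁻ y, ‖mollify k u y‖ₑ ∂(place μ t x) + e k :=
        (hcomp k x (Metric.mem_ball_self one_pos)).1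
    _ ≤ liminf (fun j => ∫⁻ y, ‖mollify k u y‖ₑ ∂(place μ t (X j))) atTop + e k := by
        gcongr
        exact lintegral_place_le_liminf (contDiff_mollify k hWG.locInt).continuous.enorm t hX
    _ ≤ a + e k + e k := by
        gcongr
        refine liminf_le_of_frequently_le' (Eventually.frequently ?_)
        filter_upwards [hev] with j hj
        exact (hcomp k _ hj).2.trans (add_le_add (hXa j) le_rfl)

/-! ### The Riesz potential as a radial integral; domination of the maximal function. -/

theorem lintegral_Ioi_rpow {e : ℝ} (he : e < -1) {c : ℝ} (hc : 0 < c) :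
    ∫⁻ t in Set.Ioi c, ENNReal.ofReal (t ^ e) = ENNReal.ofReal (-c ^ (e + 1) / (e + 1)) := by
  rw [← integral_Ioi_rpow_of_lt he hc,
    ofReal_integral_eq_lintegral_ofReal (integrableOn_Ioi_rpow_of_lt he hc)]
  filter_upwards [ae_restrict_mem measurableSet_Ioi] with s hs
  exact Real.rpow_nonneg (hc.le.trans hs.le) _

theorem lintegral_Ioi_inv_pow {m : ℕ} (hm : 0 < m) {a : ℝ} (ha : 0 < a) :
    ∫⁻ s in Set.Ioi a, (ENNReal.ofReal s ^ (m + 1))⁻¹ =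
      (m : ℝ≥0∞)⁻¹ * (ENNReal.ofReal a ^ m)⁻¹ := by
  have hm' : (0 : ℝ) < m := by exact_mod_cast hm
  have h1 : ∀ s ∈ Set.Ioi a, (ENNReal.ofReal s ^ (m + 1))⁻¹ =
      ENNReal.ofReal (s ^ (-((m : ℝ) + 1))) := by
    intro s hs
    have hs0 : 0 < s := ha.trans hs
    rw [Real.rpow_neg hs0.le, ENNReal.ofReal_inv_of_pos (by positivity),
      ← ENNReal.ofReal_pow hs0.le]
    norm_cast
  rw [setLIntegral_congr_fun measurableSet_Ioi h1, lintegral_Ioi_rpow (by linarith) ha]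
  have h2 : -a ^ (-((m : ℝ) + 1) + 1) / (-((m : ℝ) + 1) + 1) = (m : ℝ)⁻¹ * (a ^ m)⁻¹ := by
    have : -((m : ℝ) + 1) + 1 = -m := by ring
    rw [this, Real.rpow_neg ha.le, Real.rpow_natCast]
    field_simp
  rw [h2, ENNReal.ofReal_mul (by positivity), ENNReal.ofReal_inv_of_pos hm',
    ENNReal.ofReal_inv_of_pos (by positivity), ENNReal.ofReal_natCast, ENNReal.ofReal_pow ha.le]

/-- Fubini: a point `z ≠ x` lies in `B(x,s)` exactly for `s > |x - z|`, and `∫ s⁻ⁿ ds` over these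
`s` equals `|x - z|^{1-n} / (n-1)`. -/
theorem lintegral_Ioi_radial (hn : 2 ≤ n) {h : Rn n → ℝ≥0∞} (hh : Measurable h) (x : Rn n) :
    ∫⁻ s in Set.Ioi (0 : ℝ), (ENNReal.ofReal s ^ n)⁻¹ * ∫⁻ w in Metric.ball x s, h w =
      ((n - 1 : ℕ) : ℝ≥0∞)⁻¹ * ∫⁻ z, h z / ‖x - z‖ₑ ^ (n - 1) := by
  have hS : MeasurableSet {q : ℝ × Rn n | dist q.2 x < q.1} :=
    (isOpen_lt (by fun_prop) (by fun_prop)).measurableSet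
  have hm : Measurable fun q : ℝ × Rn n => {q : ℝ × Rn n | dist q.2 x < q.1}.indicator
      (fun q => (ENNReal.ofReal q.1 ^ n)⁻¹ * h q.2) q :=
    ((by fun_prop : Measurable fun q : ℝ × Rn n => (ENNReal.ofReal q.1 ^ n)⁻¹).mul
      (hh.comp measurable_snd)).indicator hS
  have h1 : ∀ s : ℝ, (ENNReal.ofReal s ^ n)⁻¹ * ∫⁻ w in Metric.ball x s, h w =
      ∫⁻ z, {q : ℝ × Rn n | dist q.2 x < q.1}.indicator
        (fun q => (ENNReal.ofReal q.1 ^ n)⁻¹ * h q.2) (s, z) := by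
    intro s
    rw [← lintegral_const_mul _ hh, ← lintegral_indicator Metric.isOpen_ball.measurableSet]
    rfl
  simp only [h1]
  rw [lintegral_lintegral_swap (f := fun s z => {q : ℝ × Rn n | dist q.2 x < q.1}.indicator
      (fun q => (ENNReal.ofReal q.1 ^ n)⁻¹ * h q.2) (s, z)) (hm.aemeasurable :),
    ← lintegral_const_mul' _ _
      (ENNReal.inv_ne_top.2 (by exact_mod_cast (by omega : n - 1 ≠ 0)))]
  refine lintegral_congr_ae ?_
  have : Nonempty (Fin n) := ⟨⟨0, by omega⟩⟩
  filter_upwards [compl_mem_ae_iff.2 (measure_singleton (μ := (volume : Measure (Rn n))) x)]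
    with z hz
  have hd : 0 < dist z x := dist_pos.2 hz
  have h2 : (fun s : ℝ => {q : ℝ × Rn n | dist q.2 x < q.1}.indicator
      (fun q => (ENNReal.ofReal q.1 ^ n)⁻¹ * h q.2) (s, z)) =
      (Set.Ioi (dist z x)).indicator fun s => (ENNReal.ofReal s ^ n)⁻¹ * h z := by
    ext s; rfl
  rw [h2, setLIntegral_indicator measurableSet_Ioi, Set.Ioi_inter_Ioi, max_eq_left hd.le,
    lintegral_mul_const _ (by fun_prop)]
  obtain ⟨m, rfl⟩ : ∃ m, n = m + 1 := ⟨n - 1, by omega⟩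
  rw [lintegral_Ioi_inv_pow (by omega) hd, Nat.add_sub_cancel, dist_comm, dist_eq_norm,
    ofReal_norm, ENNReal.div_eq_inv_mul]
  ring

theorem radialPotential_le_rieszPotential (hn : 2 ≤ n) {g : Rn n → Rn n} (hg : Measurable g)
    {r : ℝ} (hr : 0 ≤ r) (ρ : ℝ) (x : Rn n) :
    radialPotential (fun w => ‖g w‖ₑ) r ρ x ≤ rieszPotential g x := by
  have h1 : radialPotential (fun w => ‖g w‖ₑ) r ρ x ≤
      ∫⁻ s in Set.Ioi (0 : ℝ), (ENNReal.ofReal s ^ n)⁻¹ * ∫⁻ w in Metric.ball x s, ‖g w‖ₑ :=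
    lintegral_mono_set fun s hs => hr.trans_lt hs.1
  rw [lintegral_Ioi_radial hn hg.enorm x] at h1
  refine h1.trans (mul_le_of_le_one_left zero_le ?_)
  rw [ENNReal.inv_le_one]
  exact_mod_cast (by omega : 1 ≤ n - 1)

theorem laverage_ball_enorm_le {v : Rn n → ℝ} (hv : ContDiff ℝ 1 v) (x : Rn n) {r ρ : ℝ}
    (hr : 0 < r) (hρ : r ≤ ρ) :
    ⨍⁻ w in Metric.ball x r, ‖v w‖ₑ ∂volume ≤ ⨍⁻ w in Metric.ball x ρ, ‖v w‖ₑ ∂volume +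
      (volume (Metric.ball (0 : Rn n) 1))⁻¹ *
        radialPotential (fun w => ‖fderiv ℝ v w‖ₑ) r ρ x := by
  have hm : Measurable fun w => ‖v w‖ₑ := hv.continuous.enorm.measurable
  rw [laverage_ball_eq hm x hr, laverage_ball_eq hm x (hr.trans_le hρ), ← mul_add]
  refine mul_le_mul' le_rfl ?_
  refine le_trans ?_ (add_le_add le_rfl (lintegral_unitBall_enorm_sub_le hv x hr.le hρ))
  rw [← lintegral_add_left (by exact hm.comp (by fun_prop))]
  refine lintegral_mono fun z => ?_
  have : v (x + r • z) = v (x + ρ • z) - (v (x + ρ • z) - v (x + r • z)) := by ring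
  calc ‖v (x + r • z)‖ₑ = ‖v (x + ρ • z) - (v (x + ρ • z) - v (x + r • z))‖ₑ := by rw [← this]
    _ ≤ _ := enorm_sub_le

theorem radialPotential_le_mul (h : Rn n → ℝ≥0∞) (r ρ : ℝ) (x : Rn n) :
    radialPotential h r ρ x ≤
      (ENNReal.ofReal r ^ n)⁻¹ * (∫⁻ w in Metric.ball x ρ, h w) * ENNReal.ofReal (ρ - r) := by
  calc radialPotential h r ρ x ≤ ∫⁻ _s in Set.Ioc r ρ,
        (ENNReal.ofReal r ^ n)⁻¹ * ∫⁻ w in Metric.ball x ρ, h w := by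
        refine setLIntegral_mono' measurableSet_Ioc fun s hs => ?_
        refine mul_le_mul' ?_ (lintegral_mono_set (Metric.ball_subset_ball hs.2))
        rw [ENNReal.inv_le_inv]
        gcongr
        exact hs.1.le
    _ = _ := by rw [setLIntegral_const, Real.volume_Ioc]

theorem tendsto_laverage_mollify_sub {F : Type*} [NormedAddCommGroup F] [NormedSpace ℝ F]
    [CompleteSpace F] {u : Rn n → F} (hu : LocallyIntegrable u volume)
    (x : Rn n) {r : ℝ} (hr : 0 < r) :
    Tendsto (fun k => ⨍⁻ w in Metric.ball x r, ‖mollify k u w - u w‖ₑ ∂volume) atTop (𝓝 0) := by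
  simp only [setLAverage_eq]
  have := ENNReal.Tendsto.div_const (tendsto_setLIntegral_mollify_sub hu x r)
    (b := volume (Metric.ball x r)) (Or.inr (Metric.measure_ball_pos _ _ hr).ne')
  rwa [ENNReal.zero_div] at this

/-- Limit of the smooth case along mollifications. Since `r > 0`, the weight `s⁻ⁿ` is bounded on the
range of integration, so local `L¹` convergence of the gradients is enough. -/
theorem laverage_ball_enorm_le_of_isWeakGradient {u : Rn n → ℝ} {g : Rn n → Rn n}
    (hg : Measurable g) (h : IsWeakGradient u g) (x : Rn n) {r ρ : ℝ} (hr : 0 < r) (hρ : r ≤ ρ) :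
    ⨍⁻ w in Metric.ball x r, ‖u w‖ₑ ∂volume ≤ ⨍⁻ w in Metric.ball x ρ, ‖u w‖ₑ ∂volume +
      (volume (Metric.ball (0 : Rn n) 1))⁻¹ * radialPotential (fun w => ‖g w‖ₑ) r ρ x := by
  set V := volume (Metric.ball (0 : Rn n) 1)
  have hρ0 := hr.trans_le hρ
  have hum : AEStronglyMeasurable u volume := h.locInt.aestronglyMeasurable
  have hkm : ∀ k, Continuous (mollify k u) := fun k => (contDiff_mollify k h.locInt).continuous
  have hgm : ∀ k, Continuous (mollify k g) := fun k =>
    (contDiff_mollify k h.locInt_grad).continuous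
  have hadd : ∀ (s : ℝ) (k : ℕ), ⨍⁻ w in Metric.ball x s, ‖mollify k u w‖ₑ ∂volume ≤
      ⨍⁻ w in Metric.ball x s, ‖u w‖ₑ ∂volume +
        ⨍⁻ w in Metric.ball x s, ‖mollify k u w - u w‖ₑ ∂volume := fun s k => by
    simp only [setLAverage_eq]
    rw [← ENNReal.add_div, ← lintegral_add_left' hum.restrict.enorm]
    refine ENNReal.div_le_div_right (lintegral_mono fun w => ?_) _
    calc ‖mollify k u w‖ₑ = ‖u w + (mollify k u w - u w)‖ₑ := by congr 1; ring
      _ ≤ _ := enorm_add_le _ _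
  have hadd' : ∀ (s : ℝ) (k : ℕ), ⨍⁻ w in Metric.ball x s, ‖u w‖ₑ ∂volume ≤
      ⨍⁻ w in Metric.ball x s, ‖mollify k u w‖ₑ ∂volume +
        ⨍⁻ w in Metric.ball x s, ‖mollify k u w - u w‖ₑ ∂volume := fun s k => by
    simp only [setLAverage_eq]
    rw [← ENNReal.add_div, ← lintegral_add_left' (hkm k).aestronglyMeasurable.restrict.enorm]
    refine ENNReal.div_le_div_right (lintegral_mono fun w => ?_) _
    calc ‖u w‖ₑ = ‖mollify k u w - (mollify k u w - u w)‖ₑ := by congr 1; ring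
      _ ≤ _ := enorm_sub_le
  have hpot : ∀ k, radialPotential (fun w => ‖mollify k g w‖ₑ) r ρ x ≤
      radialPotential (fun w => ‖g w‖ₑ) r ρ x + (ENNReal.ofReal r ^ n)⁻¹ *
        (∫⁻ w in Metric.ball x ρ, ‖mollify k g w - g w‖ₑ) * ENNReal.ofReal (ρ - r) := fun k => by
    refine le_trans ?_ (add_le_add le_rfl (radialPotential_le_mul _ r ρ x))
    have hms : Measurable fun s : ℝ => (ENNReal.ofReal s ^ n)⁻¹ *
        ∫⁻ w in Metric.ball x s, ‖g w‖ₑ :=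
      (by fun_prop : Measurable fun s : ℝ => (ENNReal.ofReal s ^ n)⁻¹).mul
        (Measurable.of_uncurry_left (f := fun (y : Rn n) (s : ℝ) =>
          ∫⁻ w in Metric.ball y s, ‖g w‖ₑ) (measurable_lintegral_ball hg.enorm))
    simp only [radialPotential]
    rw [← lintegral_add_left hms]
    refine lintegral_mono fun s => ?_
    rw [← mul_add, ← lintegral_add_left hg.enorm]
    refine mul_le_mul' le_rfl (lintegral_mono fun w => ?_)
    calc ‖mollify k g w‖ₑ = ‖g w + (mollify k g w - g w)‖ₑ := by congr 1; abel
      _ ≤ _ := enorm_add_le _ _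
  have hk : ∀ k, ⨍⁻ w in Metric.ball x r, ‖u w‖ₑ ∂volume ≤
      ((⨍⁻ w in Metric.ball x ρ, ‖u w‖ₑ ∂volume +
        ⨍⁻ w in Metric.ball x ρ, ‖mollify k u w - u w‖ₑ ∂volume) +
      V⁻¹ * (radialPotential (fun w => ‖g w‖ₑ) r ρ x + (ENNReal.ofReal r ^ n)⁻¹ *
        (∫⁻ w in Metric.ball x ρ, ‖mollify k g w - g w‖ₑ) * ENNReal.ofReal (ρ - r))) +
      ⨍⁻ w in Metric.ball x r, ‖mollify k u w - u w‖ₑ ∂volume := fun k => by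
    refine (hadd' r k).trans (add_le_add ?_ le_rfl)
    refine (laverage_ball_enorm_le (contDiff_mollify k h.locInt) x hr hρ).trans
      (add_le_add (hadd ρ k) (mul_le_mul' le_rfl ?_))
    simp only [enorm_fderiv_mollify h k]
    exact hpot k
  have hVt : V⁻¹ ≠ ⊤ := ENNReal.inv_ne_top.2 volume_unitBall_ne_zero
  have hrt : (ENNReal.ofReal r ^ n)⁻¹ ≠ ⊤ :=
    ENNReal.inv_ne_top.2 (pow_ne_zero _ (by simpa using hr))
  have t1 := tendsto_laverage_mollify_sub h.locInt x hr
  have t2 := tendsto_laverage_mollify_sub h.locInt x hρ0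
  have t3 := ENNReal.Tendsto.mul_const (b := ENNReal.ofReal (ρ - r))
    (ENNReal.Tendsto.const_mul (a := (ENNReal.ofReal r ^ n)⁻¹)
    (tendsto_setLIntegral_mollify_sub h.locInt_grad x ρ) (Or.inr hrt)) (Or.inr (by simp))
  rw [mul_zero, zero_mul] at t3
  have t4 := ((t2.const_add (⨍⁻ w in Metric.ball x ρ, ‖u w‖ₑ ∂volume)).add
    (ENNReal.Tendsto.const_mul (a := V⁻¹)
      (t3.const_add (radialPotential (fun w => ‖g w‖ₑ) r ρ x)) (Or.inr hVt))).add t1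
  simp only [add_zero] at t4
  exact ge_of_tendsto' t4 hk

/-- Means of an `Lᵖ` function over large balls become small: the part below level `l` contributes at
most `l`, the rest a fixed multiple of `‖u‖_p^p` divided by the volume. -/
theorem tendsto_laverage_ball_atTop (hn : 0 < n) {p : ℝ} (hp : 1 < p) {u : Rn n → ℝ}
    (hu : ∫⁻ z, ‖u z‖ₑ ^ p ≠ ⊤) (x : Rn n) {l : ℝ} (hl : 0 < l) :
    ∀ᶠ ρ : ℝ in atTop, ⨍⁻ w in Metric.ball x ρ, ‖u w‖ₑ ∂volume ≤ ENNReal.ofReal (2 * l) := by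
  set V := volume (Metric.ball (0 : Rn n) 1)
  set N := ∫⁻ z, ‖u z‖ₑ ^ p with hN
  have h1 : Tendsto (fun ρ : ℝ => ENNReal.ofReal (l ^ (1 - p)) * N / (ENNReal.ofReal ρ ^ n * V))
      atTop (𝓝 0) := by
    have h3 : Tendsto (fun ρ : ℝ => ENNReal.ofReal ρ ^ n * V) atTop (𝓝 ⊤) := by
      have h4 := (ENNReal.continuous_pow n).tendsto ⊤
      rw [ENNReal.top_pow hn.ne'] at h4
      have h5 := ENNReal.Tendsto.mul_const (b := V) (h4.comp ENNReal.tendsto_ofReal_atTop)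
        (Or.inl ENNReal.top_ne_zero)
      rwa [ENNReal.top_mul volume_unitBall_ne_zero] at h5
    have h6 := ENNReal.Tendsto.const_div (a := ENNReal.ofReal (l ^ (1 - p)) * N) h3
      (Or.inr (ENNReal.mul_ne_top (by simp) hu))
    rwa [ENNReal.div_top] at h6
  have hl' : 0 < ENNReal.ofReal l := by simpa using hl
  filter_upwards [h1.eventually (gt_mem_nhds hl'), eventually_gt_atTop 0] with ρ hρ hρ0
  have hB0 : volume (Metric.ball x ρ) ≠ 0 := (Metric.measure_ball_pos _ _ hρ0).ne'
  have hBt : volume (Metric.ball x ρ) ≠ ⊤ := measure_ball_lt_top.ne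
  rw [← volume_ball_eq x hρ0] at hρ
  rw [two_mul, ENNReal.ofReal_add hl.le hl.le, setLAverage_eq]
  calc (∫⁻ w in Metric.ball x ρ, ‖u w‖ₑ) / volume (Metric.ball x ρ)
      ≤ (ENNReal.ofReal l * volume (Metric.ball x ρ) + ENNReal.ofReal (l ^ (1 - p)) * N) /
          volume (Metric.ball x ρ) := by
        refine ENNReal.div_le_div_right ?_ _
        refine (lintegral_mono fun w => le_add_mul_rpow hp ‖u w‖ₑ hl).trans ?_
        rw [lintegral_add_left measurable_const, setLIntegral_const,
          lintegral_const_mul' _ _ (by simp)]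
        exact add_le_add le_rfl (mul_le_mul' le_rfl (setLIntegral_le_lintegral _ _))
    _ = ENNReal.ofReal l + ENNReal.ofReal (l ^ (1 - p)) * N / volume (Metric.ball x ρ) := by
        rw [ENNReal.add_div, ENNReal.mul_div_cancel_right hB0 hBt]
    _ ≤ _ := add_le_add le_rfl hρ.le

/-- The maximal function of a Sobolev function is controlled by the Riesz potential of its
gradient. -/
theorem hardyLittlewood_le_rieszPotential (hn : 2 ≤ n) {p : ℝ} (hp : 1 < p) {u : Rn n → ℝ}
    {g : Rn n → Rn n} (hg : Measurable g) (h : IsWeakGradient u g)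
    (hu : ∫⁻ z, ‖u z‖ₑ ^ p ≠ ⊤) (x : Rn n) :
    hardyLittlewood u x ≤ (volume (Metric.ball (0 : Rn n) 1))⁻¹ * rieszPotential g x := by
  refine iSup₂_le fun r hr => ?_
  refine ENNReal.le_of_forall_pos_le_add fun ε hε _ => ?_
  have hε' : (0 : ℝ) < ε / 2 := by positivity
  -- The mean over `B(x,r)` is compared with one over a ball so large that its mean is negligible;
  -- the difference is a truncated Riesz potential.
  obtain ⟨ρ, hρ, hrρ⟩ := ((tendsto_laverage_ball_atTop (by omega) hp hu x hε').and
    (eventually_ge_atTop r)).exists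
  refine (laverage_ball_enorm_le_of_isWeakGradient hg h x hr hrρ).trans ?_
  rw [add_comm]
  refine add_le_add (mul_le_mul' le_rfl (radialPotential_le_rieszPotential hn hg hr.le ρ x)) ?_
  refine hρ.trans (le_of_eq ?_)
  rw [mul_div_cancel₀ _ (two_ne_zero' ℝ), ENNReal.ofReal_coe_nnreal]

/-! ### The Hardy–Littlewood maximal theorem. -/

/-- The maximal function over balls with rational radii. -/
def ratMaximal (h : Rn n → ℝ≥0∞) (x : Rn n) : ℝ≥0∞ :=
  ⨆ (q : ℚ) (_ : 0 < q), ⨍⁻ w in Metric.ball x (q : ℝ), h w ∂volume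

theorem measurable_ratMaximal {h : Rn n → ℝ≥0∞} (hh : Measurable h) :
    Measurable (ratMaximal h) := by
  refine Measurable.iSup fun q => Measurable.iSup fun hq => ?_
  have hq' : (0 : ℝ) < q := by exact_mod_cast hq
  simp only [setLAverage_eq, volume_ball_eq _ hq']
  exact (measurable_lintegral_ball_left hh q).div_const _

/-- A rational radius between `s` and `2s` costs only `2ⁿ`. Rational radii make the maximal function
a countable supremum, hence measurable. -/
theorem setLIntegral_ball_le_ratMaximal (h : Rn n → ℝ≥0∞) (x : Rn n) {s : ℝ} (hs : 0 < s) :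
    ∫⁻ w in Metric.ball x s, h w ≤
      ENNReal.ofReal s ^ n * (2 ^ n * volume (Metric.ball (0 : Rn n) 1) * ratMaximal h x) := by
  obtain ⟨q, hq1, hq2⟩ := exists_rat_btwn (by linarith : s < 2 * s)
  have hq0 : (0 : ℝ) < q := hs.trans hq1
  have hq0' : 0 < q := by exact_mod_cast hq0
  have h1 : ⨍⁻ w in Metric.ball x (q : ℝ), h w ∂volume ≤ ratMaximal h x :=
    le_iSup₂ (f := fun (q : ℚ) (_ : 0 < q) => ⨍⁻ w in Metric.ball x (q : ℝ), h w ∂volume) q hq0'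
  calc ∫⁻ w in Metric.ball x s, h w ≤ ∫⁻ w in Metric.ball x (q : ℝ), h w :=
        lintegral_mono_set (Metric.ball_subset_ball hq1.le)
    _ = volume (Metric.ball x (q : ℝ)) * ⨍⁻ w in Metric.ball x (q : ℝ), h w ∂volume := by
        rw [setLAverage_eq, ENNReal.mul_div_cancel (Metric.measure_ball_pos _ _ hq0).ne'
          measure_ball_lt_top.ne]
    _ ≤ (ENNReal.ofReal (2 * s) ^ n * volume (Metric.ball (0 : Rn n) 1)) * ratMaximal h x := by
        rw [volume_ball_eq x hq0]
        gcongr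
    _ = _ := by
        rw [ENNReal.ofReal_mul zero_le_two, ENNReal.ofReal_ofNat]; ring

/-- Weak-type bound with truncation: where a mean exceeds `t`, values at most `t/2` account for at
most half of it, so the part of `h` above `t/2` already has mean at least `t/2`. Vitali's covering
lemma then applies. -/
theorem volume_lt_ratMaximal_le (hn : 0 < n) {p : ℝ} (hp : 1 < p) {h : Rn n → ℝ≥0∞}
    (hh : Measurable h) (hN : ∫⁻ z, h z ^ p ≠ ⊤) {t : ℝ} (ht : 0 < t) :
    volume {x | ENNReal.ofReal t < ratMaximal h x} ≤
      6 ^ n * (ENNReal.ofReal (t / 2))⁻¹ * ∫⁻ z in {z | ENNReal.ofReal (t / 2) < h z}, h z := by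
  have ht2 : 0 < t / 2 := by positivity
  have hT0 : ENNReal.ofReal (t / 2) ≠ 0 := by simpa using ht
  have hTt : ENNReal.ofReal (t / 2) ≠ ⊤ := ENNReal.ofReal_ne_top
  set E := {x | ENNReal.ofReal t < ratMaximal h x} with hE
  have hD : MeasurableSet {z | ENNReal.ofReal (t / 2) < h z} := measurableSet_lt measurable_const hh
  set D := {z | ENNReal.ofReal (t / 2) < h z} with hDdef
  set I := ∫⁻ z in D, h z with hI
  -- Above the level `t/2`, `h ≤ (t/2)^{1-p} h^p`. The resulting finiteness bounds the radii, as
  -- Vitali's lemma requires.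
  have hIt : I ≠ ⊤ := by
    have h1 : I ≤ ENNReal.ofReal ((t / 2) ^ (1 - p)) * ∫⁻ z, h z ^ p := by
      rw [← lintegral_const_mul' _ _ (by simp)]
      refine le_trans (setLIntegral_mono' hD fun z hz => ?_) (setLIntegral_le_lintegral _ _)
      have hz' : ENNReal.ofReal (t / 2) < h z := hz
      have hz0 : h z ≠ 0 := (zero_le.trans_lt hz').ne'
      rcases eq_or_ne (h z) ⊤ with h3 | h3
      · rw [h3, ENNReal.top_rpow_of_pos (by linarith), ENNReal.mul_top]
        simpa using Real.rpow_pos_of_pos ht2 _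
      · calc h z = h z ^ (1 - p) * h z ^ p := by
              rw [← ENNReal.rpow_add _ _ hz0 h3, sub_add_cancel, ENNReal.rpow_one]
          _ ≤ _ := by
              refine mul_le_mul' ?_ le_rfl
              rw [← ENNReal.ofReal_rpow_of_pos ht2]
              rw [← neg_sub p 1, ENNReal.rpow_neg, ENNReal.rpow_neg]
              exact ENNReal.inv_le_inv.2 (ENNReal.rpow_le_rpow hz'.le (by linarith))
    exact ne_top_of_le_ne_top (ENNReal.mul_ne_top (by simp) hN) h1
  have hex : ∀ x : Rn n, ∃ r : ℝ, x ∈ E → (0 < r ∧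
      volume (Metric.ball x r) ≤ (ENNReal.ofReal (t / 2))⁻¹ *
        ∫⁻ w in Metric.ball x r, D.indicator h w) := by
    intro x
    by_cases hx : x ∈ E
    · have hx' : ENNReal.ofReal t < ratMaximal h x := hx
      simp only [ratMaximal, lt_iSup_iff] at hx'
      obtain ⟨q, hq, hlt⟩ := hx'
      have hq' : (0 : ℝ) < q := by exact_mod_cast hq
      refine ⟨q, fun _ => ⟨hq', ?_⟩⟩
      have hB0 : volume (Metric.ball x (q : ℝ)) ≠ 0 := (Metric.measure_ball_pos _ _ hq').ne'
      have hBt : volume (Metric.ball x (q : ℝ)) ≠ ⊤ := measure_ball_lt_top.ne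
      rw [setLAverage_eq, ENNReal.lt_div_iff_mul_lt (Or.inl hB0) (Or.inl hBt)] at hlt
      set B := volume (Metric.ball x (q : ℝ))
      set J := ∫⁻ w in Metric.ball x (q : ℝ), D.indicator h w
      have h4 : ∫⁻ w in Metric.ball x (q : ℝ), h w ≤ ENNReal.ofReal (t / 2) * B + J := by
        rw [← setLIntegral_const, ← lintegral_add_left measurable_const]
        refine lintegral_mono fun w => ?_
        by_cases hw : w ∈ D
        · rw [Set.indicator_of_mem hw]; exact le_add_self
        · rw [Set.indicator_of_notMem hw, add_zero]; exact not_lt.1 hw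
      have h5 : ENNReal.ofReal (t / 2) * B + ENNReal.ofReal (t / 2) * B ≤
          ENNReal.ofReal (t / 2) * B + J := by
        refine le_trans (le_of_eq ?_) (hlt.le.trans h4)
        rw [← add_mul, ← ENNReal.ofReal_add ht2.le ht2.le, add_halves]
      have h6 := (ENNReal.add_le_add_iff_left (ENNReal.mul_ne_top hTt hBt)).1 h5
      calc B = (ENNReal.ofReal (t / 2))⁻¹ * (ENNReal.ofReal (t / 2) * B) := by
            rw [← mul_assoc, ENNReal.inv_mul_cancel hT0 hTt, one_mul]
        _ ≤ _ := mul_le_mul' le_rfl h6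
    · exact ⟨0, fun h => absurd h hx⟩
  choose r hr using hex
  have hIind : ∫⁻ w, D.indicator h w = I := lintegral_indicator hD h
  obtain ⟨R, hR⟩ : ∃ R : ℝ, ∀ y ∈ E, r y ≤ R := by
    set W := volume (Metric.ball (0 : Rn n) 1)
    set Q : ℝ≥0∞ := W⁻¹ * ((ENNReal.ofReal (t / 2))⁻¹ * I) with hQ
    have hQt : Q ≠ ⊤ := ENNReal.mul_ne_top (ENNReal.inv_ne_top.2 volume_unitBall_ne_zero)
      (ENNReal.mul_ne_top (ENNReal.inv_ne_top.2 hT0) hIt)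
    refine ⟨max 1 Q.toReal, fun y hy => ?_⟩
    obtain ⟨h0, h1⟩ := hr y hy
    have h2 : ENNReal.ofReal (r y) ^ n ≤ Q := by
      rw [volume_ball_eq y h0] at h1
      calc ENNReal.ofReal (r y) ^ n = W⁻¹ * (ENNReal.ofReal (r y) ^ n * W) := by
            rw [mul_comm (_ ^ n), ← mul_assoc, ENNReal.inv_mul_cancel volume_unitBall_ne_zero
              volume_unitBall_ne_top, one_mul]
        _ ≤ Q := by
            refine mul_le_mul' le_rfl (h1.trans (mul_le_mul' le_rfl ?_))
            exact (setLIntegral_le_lintegral _ _).trans hIind.le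
    rcases le_total (r y) 1 with h5 | h5
    · exact h5.trans (le_max_left _ _)
    · refine le_trans ?_ (le_max_right _ _)
      rw [← ENNReal.ofReal_pow h0.le] at h2
      exact (le_self_pow₀ h5 hn.ne').trans ((ENNReal.ofReal_le_iff_le_toReal hQt).1 h2)
  obtain ⟨u, huE, hdisj, hcov⟩ :=
    Vitali.exists_disjoint_subfamily_covering_enlargement_closedBall E id r R hR 5 (by norm_num)
  have hcount : u.Countable := by
    refine hdisj.countable_of_nonempty_interior fun a ha => ?_
    exact ⟨a, Metric.ball_subset_interior_closedBall (Metric.mem_ball_self (hr a (huE ha)).1)⟩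
  have hsub : E ⊆ ⋃ b ∈ u, Metric.ball b (6 * r b) := by
    intro y hy
    obtain ⟨b, hb, hyb⟩ := hcov y hy
    have h1 : y ∈ Metric.closedBall b (5 * r b) :=
      hyb (Metric.mem_closedBall_self (hr y hy).1.le)
    refine Set.mem_biUnion hb (Metric.closedBall_subset_ball ?_ h1)
    linarith [(hr b (huE hb)).1]
  calc volume E ≤ ∑' b : u, volume (Metric.ball (b : Rn n) (6 * r b)) :=
        (measure_mono hsub).trans (measure_biUnion_le volume hcount _)
    _ ≤ ∑' b : u, 6 ^ n * (ENNReal.ofReal (t / 2))⁻¹ *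
          ∫⁻ w in Metric.ball (b : Rn n) (r b), D.indicator h w := by
        refine ENNReal.tsum_le_tsum fun b => ?_
        obtain ⟨h0, h1⟩ := hr b (huE b.2)
        rw [mul_assoc]
        refine le_trans (le_of_eq ?_) (mul_le_mul' le_rfl h1)
        rw [volume_ball_eq _ h0, volume_ball_eq _ (by positivity),
          ENNReal.ofReal_mul (by norm_num), mul_pow, ENNReal.ofReal_ofNat, mul_assoc]
    _ = 6 ^ n * (ENNReal.ofReal (t / 2))⁻¹ *
          ∫⁻ w in ⋃ b ∈ u, Metric.ball (b : Rn n) (r b), D.indicator h w := by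
        rw [ENNReal.tsum_mul_left, lintegral_biUnion hcount]
        · exact fun b _ => Metric.isOpen_ball.measurableSet
        · intro a ha b hb hab
          exact (hdisj ha hb hab).mono Metric.ball_subset_closedBall Metric.ball_subset_closedBall
    _ ≤ _ := mul_le_mul' le_rfl ((setLIntegral_le_lintegral _ _).trans hIind.le)

/-- The layer-cake formula, as an inequality; testing against finite `a < F^p` also covers `F = ∞`.
-/
theorem rpow_le_setLIntegral {p : ℝ} (hp : 1 < p) (F : ℝ≥0∞) :
    F ^ p ≤ ∫⁻ t in Set.Ioi (0 : ℝ), {t : ℝ | ENNReal.ofReal t < F}.indicator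
      (fun t => ENNReal.ofReal (p * t ^ (p - 1))) t := by
  have hp0 : 0 < p := by linarith
  refine ENNReal.le_of_forall_nnreal_lt fun a ha => ?_
  have hb : ((a ^ (1 / p) : ℝ≥0) : ℝ≥0∞) < F := by
    rw [ENNReal.coe_rpow_of_nonneg _ (by positivity), one_div]
    exact (ENNReal.rpow_inv_lt_iff hp0).2 ha
  set b : ℝ≥0 := a ^ (1 / p)
  have hab : (a : ℝ) = (b : ℝ) ^ p := by
    rw [← NNReal.coe_rpow, ← NNReal.rpow_mul, one_div_mul_cancel hp0.ne', NNReal.rpow_one]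
  calc (a : ℝ≥0∞) = ENNReal.ofReal p * ∫⁻ t in Set.Ioc (0 : ℝ) b, ENNReal.ofReal (t ^ (p - 1)) := by
        rw [lintegral_Ioc_rpow (by linarith) (NNReal.coe_nonneg b), ← ENNReal.ofReal_mul hp0.le, sub_add_cancel,
          mul_div_cancel₀ _ hp0.ne', ← ENNReal.ofReal_coe_nnreal, hab]
    _ = ∫⁻ t in Set.Ioc (0 : ℝ) b, ENNReal.ofReal (p * t ^ (p - 1)) := by
        rw [← lintegral_const_mul' _ _ (by simp)]
        simp only [ENNReal.ofReal_mul hp0.le]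
    _ ≤ ∫⁻ t in Set.Ioc (0 : ℝ) b, {t : ℝ | ENNReal.ofReal t < F}.indicator
          (fun t => ENNReal.ofReal (p * t ^ (p - 1))) t := by
        refine setLIntegral_mono' measurableSet_Ioc fun t ht => ?_
        rw [Set.indicator_of_mem]
        refine lt_of_le_of_lt ?_ hb
        rw [← ENNReal.ofReal_coe_nnreal]
        exact ENNReal.ofReal_le_ofReal ht.2
    _ ≤ _ := lintegral_mono_set fun t ht => ht.1

theorem mul_setLIntegral_rpow_le {p : ℝ} (hp : 1 < p) (F : ℝ≥0∞) :
    F * ∫⁻ t in Set.Ioi (0 : ℝ), {t : ℝ | ENNReal.ofReal (t / 2) < F}.indicator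
      (fun t => ENNReal.ofReal (t ^ (p - 2))) t ≤
        ENNReal.ofReal (2 ^ (p - 1) / (p - 1)) * F ^ p := by
  have hp1 : 0 < p - 1 := by linarith
  rcases eq_or_ne F ⊤ with rfl | hF
  · rw [ENNReal.top_rpow_of_pos (by linarith), ENNReal.mul_top]
    · exact le_top
    · have : 0 < (2 : ℝ) ^ (p - 1) / (p - 1) := by positivity
      simpa using this
  lift F to ℝ≥0 using hF
  rcases eq_or_ne F 0 with rfl | hF0
  · simp
  have hFp : (0 : ℝ) < F := by positivity
  calc (F : ℝ≥0∞) * ∫⁻ t in Set.Ioi (0 : ℝ), {t : ℝ | ENNReal.ofReal (t / 2) < F}.indicator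
        (fun t => ENNReal.ofReal (t ^ (p - 2))) t
      ≤ F * ∫⁻ t in Set.Ioc (0 : ℝ) (2 * F), ENNReal.ofReal (t ^ (p - 2)) := by
        refine mul_le_mul' le_rfl ?_
        rw [← lintegral_indicator measurableSet_Ioi, ← lintegral_indicator measurableSet_Ioc]
        refine lintegral_mono fun t => ?_
        by_cases ht : t ∈ Set.Ioi (0 : ℝ)
        · rw [Set.indicator_of_mem ht]
          by_cases ht2 : ENNReal.ofReal (t / 2) < F
          · rw [Set.indicator_of_mem (by exact ht2), Set.indicator_of_mem]
            refine ⟨ht, ?_⟩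
            rw [← ENNReal.ofReal_coe_nnreal, ENNReal.ofReal_lt_ofReal_iff hFp] at ht2
            linarith
          · rw [Set.indicator_of_notMem (by exact ht2)]; exact zero_le
        · rw [Set.indicator_of_notMem ht]; exact zero_le
    _ = ENNReal.ofReal (2 ^ (p - 1) / (p - 1)) * (F : ℝ≥0∞) ^ p := by
        rw [lintegral_Ioc_rpow (by linarith) (by positivity), ← ENNReal.ofReal_coe_nnreal,
          ENNReal.ofReal_rpow_of_pos hFp, ← ENNReal.ofReal_mul (by positivity),
          ← ENNReal.ofReal_mul (by positivity)]
        congr 1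
        have h1 : p - 2 + 1 = p - 1 := by ring
        have h2 : (F : ℝ) ^ p = F * (F : ℝ) ^ (p - 1) := by
          rw [← Real.rpow_one_add' hFp.le (by linarith)]; congr 1; ring
        rw [h1, h2, Real.mul_rpow zero_le_two hFp.le]
        ring

/-- The Hardy–Littlewood maximal theorem in `Lᵖ`, `p > 1`. -/
theorem lintegral_ratMaximal_rpow_le (hn : 0 < n) {p : ℝ} (hp : 1 < p) {h : Rn n → ℝ≥0∞}
    (hh : Measurable h) (hN : ∫⁻ z, h z ^ p ≠ ⊤) :
    ∫⁻ x, ratMaximal h x ^ p ≤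
      6 ^ n * ENNReal.ofReal (2 * p) * ENNReal.ofReal (2 ^ (p - 1) / (p - 1)) *
        ∫⁻ z, h z ^ p := by
  have hp0 : 0 < p := by linarith
  have hM := measurable_ratMaximal hh
  have hpm : Measurable fun t : ℝ => ENNReal.ofReal (p * t ^ (p - 1)) := by fun_prop
  have hS : MeasurableSet {q : Rn n × ℝ | ENNReal.ofReal q.2 < ratMaximal h q.1} :=
    measurableSet_lt (by fun_prop) (hM.comp measurable_fst)
  have hS' : MeasurableSet {q : ℝ × Rn n | ENNReal.ofReal (q.1 / 2) < h q.2} :=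
    measurableSet_lt (by fun_prop) (hh.comp measurable_snd)
  have hmeas2 : Measurable fun q : ℝ × Rn n =>
      {q : ℝ × Rn n | ENNReal.ofReal (q.1 / 2) < h q.2}.indicator
        (fun q => ENNReal.ofReal (q.1 ^ (p - 2)) * h q.2) q :=
    ((by fun_prop : Measurable fun q : ℝ × Rn n => ENNReal.ofReal (q.1 ^ (p - 2))).mul
      (hh.comp measurable_snd)).indicator hS'
  calc ∫⁻ x, ratMaximal h x ^ p
      ≤ ∫⁻ x, ∫⁻ t in Set.Ioi (0 : ℝ),
          {q : Rn n × ℝ | ENNReal.ofReal q.2 < ratMaximal h q.1}.indicator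
            (fun q => ENNReal.ofReal (p * q.2 ^ (p - 1))) (x, t) :=
        lintegral_mono fun x => rpow_le_setLIntegral hp _
    _ = ∫⁻ t in Set.Ioi (0 : ℝ), ∫⁻ x,
          {q : Rn n × ℝ | ENNReal.ofReal q.2 < ratMaximal h q.1}.indicator
            (fun q => ENNReal.ofReal (p * q.2 ^ (p - 1))) (x, t) :=
        lintegral_lintegral_swap (f := fun (x : Rn n) (t : ℝ) =>
          {q : Rn n × ℝ | ENNReal.ofReal q.2 < ratMaximal h q.1}.indicator
            (fun q => ENNReal.ofReal (p * q.2 ^ (p - 1))) (x, t))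
          (((hpm.comp measurable_snd).indicator hS).aemeasurable :)
    _ = ∫⁻ t in Set.Ioi (0 : ℝ), ENNReal.ofReal (p * t ^ (p - 1)) *
          volume {x | ENNReal.ofReal t < ratMaximal h x} := by
        refine lintegral_congr fun t => ?_
        rw [← setLIntegral_const, ← lintegral_indicator (measurableSet_lt measurable_const hM)]
        rfl
    _ ≤ ∫⁻ t in Set.Ioi (0 : ℝ), 6 ^ n * ENNReal.ofReal (2 * p) * ∫⁻ z,
          {q : ℝ × Rn n | ENNReal.ofReal (q.1 / 2) < h q.2}.indicator
            (fun q => ENNReal.ofReal (q.1 ^ (p - 2)) * h q.2) (t, z) := by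
        refine setLIntegral_mono' measurableSet_Ioi fun t ht => ?_
        have ht0 : (0 : ℝ) < t := ht
        refine (mul_le_mul' le_rfl (volume_lt_ratMaximal_le hn hp hh hN ht0)).trans (le_of_eq ?_)
        have h1 : ∫⁻ z, {q : ℝ × Rn n | ENNReal.ofReal (q.1 / 2) < h q.2}.indicator
            (fun q => ENNReal.ofReal (q.1 ^ (p - 2)) * h q.2) (t, z) =
            ENNReal.ofReal (t ^ (p - 2)) * ∫⁻ z in {z | ENNReal.ofReal (t / 2) < h z}, h z := by
          rw [← lintegral_const_mul _ hh,
            ← lintegral_indicator (measurableSet_lt measurable_const hh)]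
          rfl
        rw [h1, ← ENNReal.ofReal_inv_of_pos (by positivity)]
        -- The factor `(t/2)⁻¹` of the weak-type bound lowers the exponent to `p - 2`, which is
        -- integrable at `0` exactly because `p > 1`.
        have h2 : p * t ^ (p - 1) * (t / 2)⁻¹ = 2 * p * t ^ (p - 2) := by
          have : t ^ (p - 1) = t ^ (p - 2) * t := by
            rw [← Real.rpow_add_one ht0.ne']; congr 1; ring
          rw [this]; field_simp
        calc _ = 6 ^ n * (ENNReal.ofReal (p * t ^ (p - 1)) * ENNReal.ofReal ((t / 2)⁻¹)) *
              ∫⁻ z in {z | ENNReal.ofReal (t / 2) < h z}, h z := by ring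
          _ = _ := by
              rw [← ENNReal.ofReal_mul (by positivity), h2, ENNReal.ofReal_mul (by positivity)]
              ring
    _ = 6 ^ n * ENNReal.ofReal (2 * p) * ∫⁻ z, ∫⁻ t in Set.Ioi (0 : ℝ),
          {q : ℝ × Rn n | ENNReal.ofReal (q.1 / 2) < h q.2}.indicator
            (fun q => ENNReal.ofReal (q.1 ^ (p - 2)) * h q.2) (t, z) := by
        rw [lintegral_const_mul' _ _ (ENNReal.mul_ne_top (by simp) ENNReal.ofReal_ne_top)]
        congr 1
        exact lintegral_lintegral_swap (f := fun (t : ℝ) (z : Rn n) =>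
          {q : ℝ × Rn n | ENNReal.ofReal (q.1 / 2) < h q.2}.indicator
            (fun q => ENNReal.ofReal (q.1 ^ (p - 2)) * h q.2) (t, z)) (hmeas2.aemeasurable :)
    _ ≤ 6 ^ n * ENNReal.ofReal (2 * p) * ∫⁻ z,
          ENNReal.ofReal (2 ^ (p - 1) / (p - 1)) * h z ^ p := by
        refine mul_le_mul' le_rfl (lintegral_mono fun z => ?_)
        refine le_trans (le_of_eq ?_) (mul_setLIntegral_rpow_le hp (h z))
        have hmt : Measurable fun t : ℝ => {t : ℝ | ENNReal.ofReal (t / 2) < h z}.indicator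
            (fun t => ENNReal.ofReal (t ^ (p - 2))) t :=
          (by fun_prop : Measurable fun t : ℝ => ENNReal.ofReal (t ^ (p - 2))).indicator
            (measurableSet_lt (by fun_prop) measurable_const)
        rw [← lintegral_const_mul _ hmt]
        refine lintegral_congr fun t => ?_
        by_cases ht : ENNReal.ofReal (t / 2) < h z
        · rw [Set.indicator_of_mem (by exact ht), Set.indicator_of_mem (by exact ht), mul_comm]
        · rw [Set.indicator_of_notMem (by exact ht), Set.indicator_of_notMem (by exact ht),
            mul_zero]
    _ = _ := by rw [lintegral_const_mul' _ _ (by simp), ← mul_assoc]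

/-! ### Hedberg's inequality and the Hardy–Littlewood–Sobolev inequality. -/

theorem setLIntegral_ball_le_of_lintegral_rpow {h : Rn n → ℝ≥0∞} {p a : ℝ} (hp : 1 < p) (ha : 0 < a)
    (hN : ∫⁻ z, h z ^ p = ENNReal.ofReal (a ^ p)) (x : Rn n) {s : ℝ} (hs : 0 < s) :
    ∫⁻ w in Metric.ball x s, h w ≤
      (volume (Metric.ball (0 : Rn n) 1) + 1) * ENNReal.ofReal (a * s ^ ((n : ℝ) - n / p)) := by
  have hp0 : 0 < p := by linarith
  have hsp : 0 < s ^ (-((n : ℝ) / p)) := Real.rpow_pos_of_pos hs _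
  -- At this level both parts of the split are multiples of `a s^{n - n/p}`, the bound that Hölder's
  -- inequality would give.
  set l := a * s ^ (-((n : ℝ) / p)) with hldef
  have hl : 0 < l := mul_pos ha hsp
  refine (lintegral_mono fun w => le_add_mul_rpow hp (h w) hl).trans ?_
  rw [lintegral_add_left measurable_const, setLIntegral_const,
    lintegral_const_mul' _ _ ENNReal.ofReal_ne_top, volume_ball_eq x hs, add_mul, one_mul]
  have e1 : l * s ^ n = a * s ^ ((n : ℝ) - n / p) := by
    rw [hldef, mul_assoc, ← Real.rpow_natCast, ← Real.rpow_add hs]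
    congr 2; ring
  have e2 : l ^ (1 - p) * a ^ p = a * s ^ ((n : ℝ) - n / p) := by
    rw [hldef, Real.mul_rpow ha.le hsp.le, ← Real.rpow_mul hs.le, mul_right_comm,
      ← Real.rpow_add ha, sub_add_cancel, Real.rpow_one]
    congr 2; field_simp; ring
  refine add_le_add (le_of_eq ?_) ?_
  · rw [← mul_assoc, ← ENNReal.ofReal_pow hs.le, ← ENNReal.ofReal_mul hl.le, e1, mul_comm]
  · refine (mul_le_mul' le_rfl (setLIntegral_le_lintegral _ _)).trans (le_of_eq ?_)
    rw [hN, ← ENNReal.ofReal_mul (by positivity), e2]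

/-- The radial integral is cut at `ρ`. Below `ρ` the integrand is at most a multiple of the maximal
function; above `ρ` the `Lᵖ` bound leaves `a s^{-n/p}`, integrable at infinity because `p < n`. -/
theorem lintegral_div_le_near_add_far (hn : 2 ≤ n) {h : Rn n → ℝ≥0∞} (hh : Measurable h) {p a : ℝ}
    (hp : 1 < p) (hpn : p < n) (ha : 0 < a)
    (hN : ∫⁻ z, h z ^ p = ENNReal.ofReal (a ^ p)) (x : Rn n) {ρ : ℝ} (hρ : 0 < ρ) :
    (((n - 1 : ℕ) : ℝ≥0∞))⁻¹ * ∫⁻ z, h z / ‖x - z‖ₑ ^ (n - 1) ≤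
      2 ^ n * volume (Metric.ball (0 : Rn n) 1) * (ratMaximal h x * ENNReal.ofReal ρ) +
      (volume (Metric.ball (0 : Rn n) 1) + 1) * ENNReal.ofReal (1 / (n / p - 1)) *
        ENNReal.ofReal (a * ρ ^ (1 - (n : ℝ) / p)) := by
  have hp0 : 0 < p := by linarith
  have hnp : 1 < (n : ℝ) / p := (one_lt_div hp0).2 hpn
  rw [← lintegral_Ioi_radial hn hh x, ← Set.Ioc_union_Ioi_eq_Ioi hρ.le,
    lintegral_union measurableSet_Ioi Set.Ioc_disjoint_Ioi_same]
  refine add_le_add ?_ ?_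
  · calc _ ≤ ∫⁻ s in Set.Ioc 0 ρ, 2 ^ n * volume (Metric.ball (0 : Rn n) 1) * ratMaximal h x := by
          refine setLIntegral_mono' measurableSet_Ioc fun s hs => ?_
          refine (mul_le_mul' le_rfl (setLIntegral_ball_le_ratMaximal h x hs.1)).trans (le_of_eq ?_)
          rw [← mul_assoc, ENNReal.inv_mul_cancel, one_mul]
          · exact pow_ne_zero _ (by simpa using hs.1)
          · simp
      _ = _ := by
          rw [setLIntegral_const, Real.volume_Ioc, sub_zero]; ring
  · calc _ ≤ ∫⁻ s in Set.Ioi ρ, (volume (Metric.ball (0 : Rn n) 1) + 1) * ENNReal.ofReal a *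
              ENNReal.ofReal (s ^ (-((n : ℝ) / p))) := by
          refine setLIntegral_mono' measurableSet_Ioi fun s hs => ?_
          have hs0 : 0 < s := hρ.trans hs
          refine (mul_le_mul' le_rfl
            (setLIntegral_ball_le_of_lintegral_rpow hp ha hN x hs0)).trans (le_of_eq ?_)
          rw [← ENNReal.ofReal_pow hs0.le, ← ENNReal.ofReal_inv_of_pos (by positivity),
            mul_left_comm, ← ENNReal.ofReal_mul (by positivity), mul_assoc,
            ← ENNReal.ofReal_mul ha.le]
          congr 2
          rw [sub_eq_add_neg, Real.rpow_add hs0, Real.rpow_natCast]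
          field_simp
      _ = _ := by
          rw [lintegral_const_mul' _ _ (ENNReal.mul_ne_top (by finiteness) ENNReal.ofReal_ne_top),
            lintegral_Ioi_rpow (by linarith) hρ, mul_assoc, mul_assoc,
            ← ENNReal.ofReal_mul ha.le, ← ENNReal.ofReal_mul (by
              have : 0 < (n : ℝ) / p - 1 := by linarith
              positivity)]
          congr 2
          have h1 : (n : ℝ) / p - 1 ≠ 0 := by linarith
          have h2 : -((n : ℝ) / p) + 1 ≠ 0 := by linarith
          rw [show (1 : ℝ) - n / p = -((n : ℝ) / p) + 1 by ring,
            show (n : ℝ) / p - 1 = -(-((n : ℝ) / p) + 1) by ring]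
          generalize -((n : ℝ) / p) + 1 = c at h2
          field_simp

/-- Hedberg's inequality. -/
theorem exists_lintegral_div_le_ratMaximal (hn : 2 ≤ n) {p : ℝ} (hp : 1 < p) (hpn : p < n) :
    ∃ K : ℝ≥0, ∀ h : Rn n → ℝ≥0∞, Measurable h → ∫⁻ z, h z ^ p ≠ ⊤ → ∀ x,
      ∫⁻ z, h z / ‖x - z‖ₑ ^ (n - 1) ≤
        K * (ratMaximal h x ^ (1 - p / n) * (∫⁻ z, h z ^ p) ^ (1 / (n : ℝ))) := by
  have hp0 : 0 < p := by linarith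
  have hn0 : (0 : ℝ) < n := by linarith
  have hpn1 : 0 < 1 - p / n := by rw [sub_pos, div_lt_one hn0]; exact hpn
  set V := volume (Metric.ball (0 : Rn n) 1) with hV
  have hVt : V ≠ ⊤ := volume_unitBall_ne_top
  set K₀ : ℝ≥0∞ := ((n - 1 : ℕ) : ℝ≥0∞) *
    (2 ^ n * V + (V + 1) * ENNReal.ofReal (1 / (n / p - 1))) with hK₀
  have hK₀t : K₀ ≠ ⊤ := by
    rw [hK₀]; finiteness
  have hn1 : ((n - 1 : ℕ) : ℝ≥0∞) ≠ 0 := by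
    simp only [ne_eq, Nat.cast_eq_zero]; omega
  -- The summand `1` keeps the constant nonzero, so that the right side is infinite when the maximal
  -- function is.
  refine ⟨K₀.toNNReal + 1, fun h hh hN x => ?_⟩
  rw [ENNReal.coe_add, ENNReal.coe_toNNReal hK₀t, ENNReal.coe_one]
  set m := ratMaximal h x with hm
  rcases eq_or_ne (∫⁻ z, h z ^ p) 0 with hN0 | hN0
  · rw [lintegral_eq_zero_iff (hh.pow_const p)] at hN0
    refine le_trans (le_of_eq ?_) zero_le
    rw [lintegral_eq_zero_iff' (by fun_prop)]
    filter_upwards [hN0] with z hz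
    have : h z = 0 := by simpa [hp0, hp0.not_gt] using hz
    simp [this]
  rcases eq_or_ne m 0 with hm0 | hm0
  · have h1 : ((n - 1 : ℕ) : ℝ≥0∞)⁻¹ * ∫⁻ z, h z / ‖x - z‖ₑ ^ (n - 1) = 0 := by
      rw [← lintegral_Ioi_radial hn hh x]
      refine le_antisymm ?_ zero_le
      calc _ ≤ ∫⁻ s in Set.Ioi (0 : ℝ), 0 := by
            refine setLIntegral_mono' measurableSet_Ioi fun s hs => ?_
            have h2 := setLIntegral_ball_le_ratMaximal h x hs
            rw [← hm, hm0, mul_zero, mul_zero] at h2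
            rw [le_antisymm h2 zero_le, mul_zero]
        _ = 0 := by simp
    rcases mul_eq_zero.1 h1 with h2 | h2
    · simp at h2
    · rw [h2]; exact zero_le
  rcases eq_or_ne m ⊤ with hmt | hmt
  · rw [hmt, ENNReal.top_rpow_of_pos hpn1, ENNReal.top_mul, ENNReal.mul_top]
    · exact le_top
    · simp
    · simp [ENNReal.rpow_eq_zero_iff, hN0, hN]
  obtain ⟨b, hb⟩ : ∃ b : ℝ, b = (∫⁻ z, h z ^ p).toReal := ⟨_, rfl⟩
  have hb0 : 0 < b := hb ▸ ENNReal.toReal_pos hN0 hN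
  have hNb : ∫⁻ z, h z ^ p = ENNReal.ofReal b := by rw [hb, ENNReal.ofReal_toReal hN]
  obtain ⟨c, hc⟩ : ∃ c : ℝ, c = m.toReal := ⟨_, rfl⟩
  have hc0 : 0 < c := hc ▸ ENNReal.toReal_pos hm0 hmt
  have hmc : m = ENNReal.ofReal c := by rw [hc, ENNReal.ofReal_toReal hmt]
  have hba : ∫⁻ z, h z ^ p = ENNReal.ofReal ((b ^ (1 / p)) ^ p) := by
    rw [hNb, ← Real.rpow_mul hb0.le, one_div_mul_cancel hp0.ne', Real.rpow_one]
  -- This radius makes the near and the far part the same product of powers. It requires `0 < m < ∞`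
  -- and a nonzero norm, hence the cases treated before.
  set ρ := b ^ (1 / (n : ℝ)) * c ^ (-(p / n)) with hρ
  have hρ0 : 0 < ρ := by positivity
  have key := lintegral_div_le_near_add_far hn hh hp hpn (by positivity) hba x hρ0
  rw [← hm, ← hV] at key
  have e1 : m * ENNReal.ofReal ρ = m ^ (1 - p / n) * (∫⁻ z, h z ^ p) ^ (1 / (n : ℝ)) := by
    rw [hNb, hmc, ENNReal.ofReal_rpow_of_pos hc0, ENNReal.ofReal_rpow_of_pos hb0,
      ← ENNReal.ofReal_mul (by positivity), ← ENNReal.ofReal_mul (by positivity), hρ]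
    congr 1
    rw [sub_eq_add_neg, Real.rpow_add hc0, Real.rpow_one]; ring
  have e2 : ENNReal.ofReal (b ^ (1 / p) * ρ ^ (1 - (n : ℝ) / p)) =
      m ^ (1 - p / n) * (∫⁻ z, h z ^ p) ^ (1 / (n : ℝ)) := by
    rw [hNb, hmc, ENNReal.ofReal_rpow_of_pos hc0, ENNReal.ofReal_rpow_of_pos hb0,
      ← ENNReal.ofReal_mul (by positivity), hρ, Real.mul_rpow (by positivity) (by positivity),
      ← Real.rpow_mul hb0.le, ← Real.rpow_mul hc0.le, ← mul_assoc, ← Real.rpow_add hb0, mul_comm]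
    congr 3
    · field_simp; ring
    · field_simp; ring
  rw [e1, e2, ← add_mul, ENNReal.inv_mul_le_iff hn1 (by simp), ← mul_assoc, ← hK₀] at key
  exact key.trans (mul_le_mul' le_self_add le_rfl)

/-- The Hardy–Littlewood–Sobolev inequality for the Riesz potential of order one. -/
theorem exists_lintegral_rpow_lintegral_div_le (hn : 2 ≤ n) {p : ℝ} (hp : 1 < p) (hpn : p < n) :
    ∃ K : ℝ≥0, ∀ h : Rn n → ℝ≥0∞, Measurable h → ∫⁻ z, h z ^ p ≠ ⊤ →
      (∫⁻ x, (∫⁻ z, h z / ‖x - z‖ₑ ^ (n - 1)) ^ ((n : ℝ) * p / (n - p))) ^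
          (1 / ((n : ℝ) * p / (n - p))) ≤ K * (∫⁻ z, h z ^ p) ^ (1 / p) := by
  obtain ⟨K, hK⟩ := exists_lintegral_div_le_ratMaximal hn hp hpn
  have hp0 : 0 < p := by linarith
  have hn0 : (0 : ℝ) < n := by linarith
  have hnp : 0 < (n : ℝ) - p := by linarith
  set q := (n : ℝ) * p / (n - p) with hq
  have hq0 : 0 < q := by positivity
  set D : ℝ≥0∞ := 6 ^ n * ENNReal.ofReal (2 * p) * ENNReal.ofReal (2 ^ (p - 1) / (p - 1)) with hD
  have hDt : D ≠ ⊤ := by rw [hD]; finiteness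
  refine ⟨K * D.toNNReal ^ (1 / q), fun h hh hN => ?_⟩
  set N := ∫⁻ z, h z ^ p with hNdef
  have h1 : ∫⁻ x, (∫⁻ z, h z / ‖x - z‖ₑ ^ (n - 1)) ^ q ≤
      (K : ℝ≥0∞) ^ q * N ^ (q / n) * (D * N) := by
    calc _ ≤ ∫⁻ x, (K : ℝ≥0∞) ^ q * N ^ (q / n) * ratMaximal h x ^ p := by
          refine lintegral_mono fun x => ?_
          refine (ENNReal.rpow_le_rpow (hK h hh hN x) hq0.le).trans (le_of_eq ?_)
          rw [ENNReal.mul_rpow_of_nonneg _ _ hq0.le, ENNReal.mul_rpow_of_nonneg _ _ hq0.le,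
            ← ENNReal.rpow_mul, ← ENNReal.rpow_mul]
          -- The exponent `p*` is the one for which the maximal function enters exactly to the power
          -- `p`.
          rw [show (1 - p / n) * q = p by rw [hq]; field_simp,
            show 1 / (n : ℝ) * q = q / n by ring]
          ring
      _ = (K : ℝ≥0∞) ^ q * N ^ (q / n) * ∫⁻ x, ratMaximal h x ^ p := by
          rw [lintegral_const_mul']
          exact ENNReal.mul_ne_top (ENNReal.rpow_ne_top_of_nonneg hq0.le (by simp))
            (ENNReal.rpow_ne_top_of_nonneg (by positivity) hN)
      _ ≤ _ := mul_le_mul' le_rfl (lintegral_ratMaximal_rpow_le (by omega) hp hh hN)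
  refine (ENNReal.rpow_le_rpow h1 (by positivity)).trans (le_of_eq ?_)
  have hN1 : N ^ (q / n) * N = N ^ (q / p) := by
    nth_rewrite 2 [← ENNReal.rpow_one N]
    rw [← ENNReal.rpow_add_of_nonneg _ _ (by positivity) zero_le_one]
    congr 1
    rw [hq]; field_simp; ring
  rw [show (K : ℝ≥0∞) ^ q * N ^ (q / n) * (D * N) = K ^ q * D * (N ^ (q / n) * N) by ring, hN1,
    ENNReal.mul_rpow_of_nonneg _ _ (by positivity), ENNReal.mul_rpow_of_nonneg _ _ (by positivity),
    ← ENNReal.rpow_mul, ← ENNReal.rpow_mul, mul_one_div_cancel hq0.ne', ENNReal.rpow_one,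
    ENNReal.coe_mul, ENNReal.coe_rpow_of_nonneg _ (by positivity), ENNReal.coe_toNNReal hDt]
  congr 2
  field_simp

/-! ### Boundedness from the Sobolev space. -/

theorem rieszPotential_congr {g g' : Rn n → Rn n} (h : g =ᵐ[volume] g') :
    rieszPotential g = rieszPotential g' := by
  funext x
  refine lintegral_congr_ae ?_
  filter_upwards [h] with z hz
  rw [hz]

theorem IsWeakGradient.congr_grad {u : Rn n → ℝ} {g g' : Rn n → Rn n} (hu : IsWeakGradient u g)
    (h : g =ᵐ[volume] g') : IsWeakGradient u g' where
  locInt := hu.locInt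
  locInt_grad := (locallyIntegrable_congr h).1 hu.locInt_grad
  integral_eq φ hφ hφ' e := by
    rw [hu.integral_eq φ hφ hφ' e]
    congr 1
    refine integral_congr_ae ?_
    filter_upwards [h] with x hx
    rw [hx]

theorem lintegral_enorm_rpow_ne_top {E : Type*} [NormedAddCommGroup E] {p : ℝ} (hp : 0 < p)
    {f : Rn n → E} (hf : MemLp f (ENNReal.ofReal p) volume) : ∫⁻ z, ‖f z‖ₑ ^ p ≠ ⊤ := by
  have := lintegral_rpow_enorm_lt_top_of_eLpNorm_lt_top (by simpa using hp) ENNReal.ofReal_ne_top hf.2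
  rw [ENNReal.toReal_ofReal hp.le] at this
  exact this.ne

theorem boundedSobolevLebesgue_maximalOp (hn : 2 ≤ n) {μ : Measure (Rn n)} {R M : ℝ}
    (hμ : IsSphericalLike μ R M) {p : ℝ} (hp : 1 < p) (hpn : p < n) :
    BoundedSobolevLebesgue p (maximalOp μ) := by
  obtain ⟨C, -, hC⟩ := exists_maximalOp_preciseRep_le hn
  obtain ⟨K, hK⟩ := exists_lintegral_rpow_lintegral_div_le hn hp hpn
  have hp0 : 0 < p := by linarith
  have hn0 : (0 : ℝ) < n := by linarith
  have hnp : 0 < (n : ℝ) - p := by linarith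
  set V := volume (Metric.ball (0 : Rn n) 1) with hV
  set D : ℝ≥0∞ := ENNReal.ofReal (C * R ^ (n - 1) * M) * (V⁻¹ + 1) with hD
  have hDt : D ≠ ⊤ := ENNReal.mul_ne_top ENNReal.ofReal_ne_top
    (ENNReal.add_ne_top.2 ⟨ENNReal.inv_ne_top.2 volume_unitBall_ne_zero, ENNReal.one_ne_top⟩)
  have hq0 : 0 < (n : ℝ) * p / (n - p) := by positivity
  suffices H : ∀ (u : Rn n → ℝ) (g : Rn n → Rn n), IsSobolev p u g →
      eLpNorm (maximalOp μ (preciseRep u)) (ENNReal.ofReal (n * p / (n - p))) volume ≤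
        (D.toNNReal * K : ℝ≥0) * sobolevNorm p u g by
    refine ⟨D.toNNReal * K, fun u g hug => ⟨⟨?_, (H u g hug).trans_lt ?_⟩, H u g hug⟩⟩
    · exact (lowerSemicontinuous_maximalOp hn hμ hp hug).measurable.aestronglyMeasurable
    · exact ENNReal.mul_lt_top ENNReal.coe_lt_top
        (ENNReal.add_lt_top.2 ⟨hug.memLp.2, hug.memLp_grad.2⟩)
  intro u g hug
  -- A strongly measurable version of the gradient; it leaves the Riesz potential and the
  -- weak-gradient identity unchanged.
  obtain ⟨g', hg', hgg'⟩ := hug.memLp_grad.1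
  have hpt : ∀ x, maximalOp μ (preciseRep u) x ≤ D * rieszPotential g' x := fun x => by
    refine (hC μ R M hμ p hp u g hug x).trans ?_
    rw [rieszPotential_congr hgg', hD, mul_assoc (ENNReal.ofReal _), add_mul, one_mul]
    exact mul_le_mul' le_rfl (add_le_add (hardyLittlewood_le_rieszPotential hn hp hg'.measurable
      (hug.weakGradient.congr_grad hgg') (lintegral_enorm_rpow_ne_top hp0 hug.memLp) x) le_rfl)
  have hN := lintegral_enorm_rpow_ne_top hp0 (hug.memLp_grad.ae_eq hgg')
  rw [eLpNorm_eq_lintegral_rpow_enorm_toReal (by simpa using hq0) ENNReal.ofReal_ne_top,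
    ENNReal.toReal_ofReal hq0.le]
  simp only [enorm_eq_self]
  have hgn : (∫⁻ z, ‖g' z‖ₑ ^ p) ^ (1 / p) = eLpNorm g (ENNReal.ofReal p) volume := by
    rw [eLpNorm_congr_ae hgg', eLpNorm_eq_lintegral_rpow_enorm_toReal (by simpa using hp0)
      ENNReal.ofReal_ne_top, ENNReal.toReal_ofReal hp0.le]
  set q := (n : ℝ) * p / (n - p) with hq
  calc _ ≤ (∫⁻ x, D ^ q * rieszPotential g' x ^ q) ^ (1 / q) := by
        refine ENNReal.rpow_le_rpow (lintegral_mono fun x => ?_) (by positivity)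
        rw [← ENNReal.mul_rpow_of_nonneg _ _ hq0.le]
        exact ENNReal.rpow_le_rpow (hpt x) hq0.le
    _ = D * (∫⁻ x, rieszPotential g' x ^ q) ^ (1 / q) := by
        rw [lintegral_const_mul' _ _ (ENNReal.rpow_ne_top_of_nonneg hq0.le hDt),
          ENNReal.mul_rpow_of_nonneg _ _ (by positivity), ← ENNReal.rpow_mul,
          mul_one_div_cancel hq0.ne', ENNReal.rpow_one]
    _ ≤ D * (K * (∫⁻ z, ‖g' z‖ₑ ^ p) ^ (1 / p)) :=
        mul_le_mul' le_rfl (hK (fun z => ‖g' z‖ₑ) hg'.measurable.enorm hN)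
    _ ≤ _ := by
        rw [hgn, ENNReal.coe_mul, ENNReal.coe_toNNReal hDt, ← mul_assoc]
        exact mul_le_mul' le_rfl le_add_self

/-! ### Normalized Hausdorff measures under dilation. -/

/-- Dilation by `t` followed by translation by `x`. -/
def dilation (t : ℝ) (ht : t ≠ 0) (x : Rn n) : Rn n ≃ₜ Rn n :=
  (Homeomorph.smulOfNeZero t ht).trans (Homeomorph.addRight x)

theorem coe_dilation (t : ℝ) (ht : t ≠ 0) (x : Rn n) :
    (dilation t ht x : Rn n → Rn n) = fun z => t • z + x := rfl

theorem hausdorffMeasure_image_dilation {d : ℝ} (hd : 0 ≤ d) {t : ℝ} (ht : t ≠ 0) (x : Rn n)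
    (s : Set (Rn n)) :
    Measure.hausdorffMeasure d (dilation t ht x '' s) = ‖t‖₊ ^ d • Measure.hausdorffMeasure d s := by
  rw [← Measure.hausdorffMeasure_smul₀ hd ht s, ← Set.image_smul,
    ← (IsometryEquiv.addRight x).hausdorffMeasure_image d ((fun z => t • z) '' s), Set.image_image]
  rfl

/-- The dilation multiplies the measure of every subset and the total mass by the same `t^{n-1}`,
nonzero and finite, so the quotient is unchanged even if the total mass is `0` or `∞`. -/
theorem place_normalizedHausdorff (hn : 0 < n) {A : Set (Rn n)} (hA : IsClosed A) {t : ℝ}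
    (ht : 0 < t) (x : Rn n) :
    place (normalizedHausdorff A) t x = normalizedHausdorff (dilation t ht.ne' x '' A) := by
  have hd : (0 : ℝ) ≤ (n : ℝ) - 1 := sub_nonneg.2 (by exact_mod_cast hn)
  ext E hE
  have hA' : IsClosed (dilation t ht.ne' x '' A) := (dilation t ht.ne' x).isClosedMap _ hA
  have him : dilation t ht.ne' x '' (dilation t ht.ne' x ⁻¹' E ∩ A) =
      E ∩ dilation t ht.ne' x '' A := by
    rw [Set.inter_comm, Set.image_inter_preimage, Set.inter_comm]
  have hE' : MeasurableSet (dilation t ht.ne' x ⁻¹' E) :=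
    (dilation t ht.ne' x).continuous.measurable hE
  have ht1 : ((‖t‖₊ ^ ((n : ℝ) - 1) : ℝ≥0) : ℝ≥0∞) ≠ 0 := by
    simpa using (NNReal.rpow_pos (nnnorm_pos.2 ht.ne')).ne'
  rw [place, ← coe_dilation t ht.ne' x, Measure.map_apply (dilation t ht.ne' x).continuous.measurable hE,
    normalizedHausdorff, normalizedHausdorff, ProbabilityTheory.cond, ProbabilityTheory.cond,
    Measure.smul_apply, Measure.smul_apply, Measure.restrict_apply hE, Measure.restrict_apply hE',
    ← him, hausdorffMeasure_image_dilation hd, hausdorffMeasure_image_dilation hd]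
  simp only [smul_eq_mul, ENNReal.smul_def]
  rw [ENNReal.mul_inv (Or.inl ht1) (Or.inl ENNReal.coe_ne_top), mul_mul_mul_comm,
    ENNReal.inv_mul_cancel ht1 ENNReal.coe_ne_top, one_mul]

theorem maximalOp_normalizedHausdorff (hn : 0 < n) {A : Set (Rn n)} (hA : IsClosed A)
    {S : Rn n → ℝ → Set (Rn n)}
    (hS : ∀ x t (ht : 0 < t), dilation t ht.ne' x '' A = S x t) (v : Rn n → EReal) (x : Rn n) :
    maximalOp (normalizedHausdorff A) v x =
      ⨆ (t : ℝ) (_ : 0 < t), ⨍⁻ z in S x t, (v z).abs ∂(Measure.hausdorffMeasure ((n : ℝ) - 1)) := by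
  rw [maximalOp_eq]
  refine iSup_congr fun t => iSup_congr fun ht => ?_
  rw [place_normalizedHausdorff hn hA ht, hS x t ht, laverage, Measure.restrict_apply_univ]
  rfl

/-! ### Growth of the boundary of the cube and of the sphere. -/

/-- Upper `(n-1)`-regularity of a set. -/
def HasUpperGrowth (A : Set (Rn n)) (M : ℝ≥0) : Prop :=
  ∀ (x : Rn n) (r : ℝ), 0 < r →
    Measure.hausdorffMeasure ((n : ℝ) - 1) (A ∩ Metric.ball x r) ≤ M * ENNReal.ofReal r ^ (n - 1)

theorem HasUpperGrowth.measure_ne_top {A : Set (Rn n)} {M : ℝ≥0} (h : HasUpperGrowth A M)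
    (hA : Bornology.IsBounded A) : Measure.hausdorffMeasure ((n : ℝ) - 1) A ≠ ⊤ := by
  obtain ⟨r, hr, hAr⟩ := hA.subset_ball_lt 0 0
  rw [← Set.inter_eq_left.2 hAr]
  exact ne_top_of_le_ne_top (by finiteness) (h 0 r hr)

theorem HasUpperGrowth.isSphericalLike {A : Set (Rn n)} {M : ℝ≥0} (h : HasUpperGrowth A M)
    (hA : IsClosed A) {R : ℝ} (hR : A ⊆ Metric.closedBall 0 R)
    (h0 : Measure.hausdorffMeasure ((n : ℝ) - 1) A ≠ 0) :
    ∃ M', IsSphericalLike (normalizedHausdorff A) R M' := by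
  have htop := h.measure_ne_top (Metric.isBounded_closedBall.subset hR)
  refine ⟨((Measure.hausdorffMeasure ((n : ℝ) - 1) A)⁻¹ * M).toReal,
    ProbabilityTheory.cond_isProbabilityMeasure_of_finite h0 htop, ?_, fun x r hr => ?_⟩
  · refine Measure.support_subset_of_isClosed Metric.isClosed_closedBall ?_
    rw [mem_ae_iff, normalizedHausdorff, ProbabilityTheory.cond_apply hA.measurableSet]
    rw [(Set.disjoint_compl_right_iff_subset.2 hR).inter_eq]
    simp
  · rw [ENNReal.ofReal_mul ENNReal.toReal_nonneg, ENNReal.ofReal_toReal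
      (ENNReal.mul_ne_top (ENNReal.inv_ne_top.2 h0) ENNReal.coe_ne_top), ENNReal.ofReal_pow hr.le,
      normalizedHausdorff, ProbabilityTheory.cond_apply hA.measurableSet, mul_assoc]
    exact mul_le_mul' le_rfl (h x r hr)

/-- Growth is inherited by a set that is a Lipschitz image of `A` with a Lipschitz right inverse. -/
theorem HasUpperGrowth.of_lipschitzOnWith (hn : 0 < n) {A S : Set (Rn n)} {M : ℝ≥0}
    (h : HasUpperGrowth A M) {f g : Rn n → Rn n} {K L : ℝ≥0} (hf : LipschitzOnWith K f A)
    (hg : LipschitzOnWith L g S) (hgS : Set.MapsTo g S A) (hfg : ∀ z ∈ S, f (g z) = z) :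
    ∃ M', HasUpperGrowth S M' := by
  have hd : (0 : ℝ) ≤ (n : ℝ) - 1 := sub_nonneg.2 (by exact_mod_cast hn)
  refine ⟨K ^ ((n : ℝ) - 1) * (M * ((L + 1) * 2) ^ (n - 1)), fun x r hr => ?_⟩
  rcases (S ∩ Metric.ball x r).eq_empty_or_nonempty with he | ⟨s, hs, hsx⟩
  · rw [he, measure_empty]; exact zero_le
  -- Recentring at a point `s` of `S` costs a factor `2` and is needed because `g` is controlled
  -- only on `S`. Using `L + 1` keeps the radius positive when `L = 0`.
  have hsub : S ∩ Metric.ball x r ⊆ f '' (A ∩ Metric.ball (g s) ((L + 1) * 2 * r)) := by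
    rintro z ⟨hz, hzx⟩
    refine ⟨g z, ⟨hgS hz, ?_⟩, hfg z hz⟩
    have h1 : dist z s < 2 * r := by
      have := dist_triangle_right z s x
      rw [Metric.mem_ball] at hzx hsx
      linarith
    rw [Metric.mem_ball]
    have h2 := hg.dist_le_mul z hz s hs
    have hL : (0 : ℝ) ≤ L := L.2
    nlinarith [dist_nonneg (x := z) (y := s)]
  refine (measure_mono hsub).trans
    (((hf.mono Set.inter_subset_left).hausdorffMeasure_image_le hd).trans ?_)
  refine (mul_le_mul' le_rfl (h (g s) _ (by positivity))).trans (le_of_eq ?_)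
  rw [ENNReal.ofReal_mul (by positivity), show ((L : ℝ) + 1) * 2 = (((L + 1) * 2 : ℝ≥0) : ℝ) by simp,
    ENNReal.ofReal_coe_nnreal, mul_pow]
  simp only [ENNReal.coe_mul, ENNReal.coe_pow, ENNReal.coe_rpow_of_nonneg _ hd]
  ring

theorem lipschitzOnWith_inv_smul {A : Set (Rn n)} {N : Rn n → ℝ} {B K c : ℝ≥0} (hc : 0 < c)
    (hN : LipschitzWith K N) (hNc : ∀ z ∈ A, c ≤ N z) (hB : ∀ z ∈ A, ‖z‖ ≤ B) :
    LipschitzOnWith (c⁻¹ + B * (K * (c⁻¹ * c⁻¹))) (fun z => (N z)⁻¹ • z) A := by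
  refine LipschitzOnWith.of_dist_le_mul fun z hz w hw => ?_
  have hc' : (0 : ℝ) < c := hc
  have hz0 : 0 < N z := hc'.trans_le (hNc z hz)
  have hw0 : 0 < N w := hc'.trans_le (hNc w hw)
  have hzi : (N z)⁻¹ ≤ (c : ℝ)⁻¹ := inv_anti₀ hc' (hNc z hz)
  have hwi : (N w)⁻¹ ≤ (c : ℝ)⁻¹ := inv_anti₀ hc' (hNc w hw)
  have e1 : (N z)⁻¹ • z - (N w)⁻¹ • w = (N z)⁻¹ • (z - w) + ((N z)⁻¹ - (N w)⁻¹) • w := by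
    rw [smul_sub, sub_smul]; abel
  have e2 : |(N z)⁻¹ - (N w)⁻¹| ≤ K * dist z w * ((c : ℝ)⁻¹ * (c : ℝ)⁻¹) := by
    rw [inv_sub_inv hz0.ne' hw0.ne', abs_div, div_eq_mul_inv, abs_mul, abs_of_pos hz0, abs_of_pos hw0,
      mul_inv]
    have := hN.dist_le_mul w z
    rw [Real.dist_eq, dist_comm w z] at this
    gcongr
  rw [dist_eq_norm, e1]
  calc _ ≤ (N z)⁻¹ * dist z w + |(N z)⁻¹ - (N w)⁻¹| * ‖w‖ := by
        refine (norm_add_le _ _).trans (le_of_eq ?_)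
        rw [norm_smul, norm_smul, Real.norm_eq_abs, Real.norm_eq_abs, abs_of_pos (inv_pos.2 hz0),
          dist_eq_norm]
    _ ≤ (c : ℝ)⁻¹ * dist z w + K * dist z w * ((c : ℝ)⁻¹ * (c : ℝ)⁻¹) * B := by
        gcongr
        exact hB w hw
    _ = _ := by push_cast; ring

/-- The maximum norm on `ℝⁿ`. -/
def maxNorm (z : Rn n) : ℝ := ‖WithLp.ofLp z‖

theorem maxNorm_smul (t : ℝ) (z : Rn n) : maxNorm (t • z) = |t| * maxNorm z := by
  rw [maxNorm, WithLp.ofLp_smul, norm_smul, Real.norm_eq_abs, maxNorm]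

theorem maxNorm_le_norm (z : Rn n) : maxNorm z ≤ ‖z‖ := by
  simpa [maxNorm] using (PiLp.lipschitzWith_ofLp 2 fun _ : Fin n => ℝ).norm_le_mul (by simp) z

theorem lipschitzWith_maxNorm : LipschitzWith 1 (maxNorm : Rn n → ℝ) := by
  have := lipschitzWith_one_norm.comp (PiLp.lipschitzWith_ofLp 2 fun _ : Fin n => ℝ)
  rwa [one_mul] at this

/-- The Lipschitz constant of the identity from the maximum norm to the Euclidean norm. -/
def normConst (n : ℕ) : ℝ≥0 := (Fintype.card (Fin n) : ℝ≥0) ^ (1 / (2 : ℝ≥0∞)).toReal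

theorem normConst_pos (hn : 0 < n) : 0 < normConst n :=
  NNReal.rpow_pos (by simpa using hn)

theorem norm_le_normConst_mul (z : Rn n) : ‖z‖ ≤ normConst n * maxNorm z :=
  (PiLp.lipschitzWith_toLp 2 fun _ : Fin n => ℝ).norm_le_mul (by simp) (WithLp.ofLp z)

theorem cube_eq (x : Rn n) {t : ℝ} (ht : 0 ≤ t) :
    cube x t = EuclideanSpace.equiv (Fin n) ℝ ⁻¹'
      Metric.closedBall (EuclideanSpace.equiv (Fin n) ℝ x) t := by
  ext z
  simp [cube, dist_pi_le_iff ht, Real.dist_eq]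

theorem frontier_cube (hn : 0 < n) (x : Rn n) {t : ℝ} (ht : 0 < t) :
    frontier (cube x t) = {z | maxNorm (z - x) = t} := by
  have : Nonempty (Fin n) := ⟨⟨0, hn⟩⟩
  have h := (EuclideanSpace.equiv (Fin n) ℝ).toHomeomorph.preimage_frontier
    (Metric.closedBall (EuclideanSpace.equiv (Fin n) ℝ x) t)
  rw [frontier_closedBall _ ht.ne'] at h
  rw [cube_eq x ht.le]
  refine h.symm.trans ?_
  ext z
  simp only [maxNorm, WithLp.ofLp_sub, Set.mem_preimage, mem_sphere_iff_norm, Set.mem_ofPred_eq]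
  rfl

theorem image_dilation_frontier_cube (hn : 0 < n) (x : Rn n) {t : ℝ} (ht : 0 < t) :
    dilation t ht.ne' x '' frontier (cube 0 1) = frontier (cube x t) := by
  rw [frontier_cube hn _ one_pos, frontier_cube hn _ ht]
  ext z
  constructor
  · rintro ⟨w, hw, rfl⟩
    have hw' : maxNorm w = 1 := by simpa using hw
    simp [coe_dilation, maxNorm_smul, hw', abs_of_pos ht]
  · intro hz
    have hz' : maxNorm (z - x) = t := hz
    refine ⟨t⁻¹ • (z - x), ?_, by simp [coe_dilation, ht.ne']⟩
    simp [maxNorm_smul, hz', abs_of_pos ht, ht.ne']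

theorem image_dilation_sphere (x : Rn n) {t : ℝ} (ht : 0 < t) :
    dilation t ht.ne' x '' Metric.sphere 0 1 = Metric.sphere x t := by
  ext z
  constructor
  · rintro ⟨w, hw, rfl⟩
    have hw' : ‖w‖ = 1 := by simpa using hw
    simp [coe_dilation, norm_smul, hw', abs_of_pos ht]
  · intro hz
    have hz' : ‖z - x‖ = t := by simpa [dist_eq_norm] using hz
    refine ⟨t⁻¹ • (z - x), ?_, by simp [coe_dilation, ht.ne']⟩
    simp [norm_smul, hz', abs_of_pos ht, ht.ne']

/-- The parametrization of the coordinate hyperplane `z i = ε`. -/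
def hyperplane {d : ℕ} (i : Fin (d + 1)) (ε : ℝ) (y : Fin d → ℝ) : Rn (d + 1) :=
  WithLp.toLp 2 (i.insertNth ε y)

theorem lipschitzWith_hyperplane {d : ℕ} (i : Fin (d + 1)) (ε : ℝ) :
    LipschitzWith (normConst (d + 1)) (hyperplane i ε) := by
  have h : LipschitzWith 1 fun y : Fin d → ℝ => (i.insertNth ε y : Fin (d + 1) → ℝ) := by
    refine LipschitzWith.of_dist_le_mul fun y z => ?_
    rw [Fin.dist_insertNth_insertNth]
    simp
  have := (PiLp.lipschitzWith_toLp 2 fun _ : Fin (d + 1) => ℝ).comp h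
  rwa [mul_one] at this

theorem hausdorffMeasure_fin (d : ℕ) :
    (Measure.hausdorffMeasure (((d + 1 : ℕ) : ℝ) - 1) : Measure (Fin d → ℝ)) = volume := by
  rw [Nat.cast_add_one, add_sub_cancel_right, ← hausdorffMeasure_pi_real, Fintype.card_fin]

theorem exists_abs_eq_maxNorm (hn : 0 < n) (z : Rn n) : ∃ i, |z i| = maxNorm z := by
  have : Nonempty (Fin n) := ⟨⟨0, hn⟩⟩
  obtain ⟨i, hi⟩ := Finite.exists_max fun i => ‖z i‖
  exact ⟨i, le_antisymm (norm_le_pi_norm (WithLp.ofLp z) i)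
    ((pi_norm_le_iff_of_nonneg (norm_nonneg _)).2 hi)⟩

/-- Some coordinate of such a point is `±1`, so the set lies in `2n` hyperplanes. Each is a
Lipschitz image of `ℝ^{n-1}` with the maximum norm, where Hausdorff measure is Lebesgue measure. -/
theorem exists_hasUpperGrowth_cube (hn : 0 < n) :
    ∃ M, HasUpperGrowth {z : Rn n | maxNorm z = 1} M := by
  obtain ⟨d, rfl⟩ : ∃ d, n = d + 1 := ⟨n - 1, by omega⟩
  have hd : (0 : ℝ) ≤ ((d + 1 : ℕ) : ℝ) - 1 := by simp
  set K : ℝ≥0∞ := (normConst (d + 1) : ℝ≥0∞) ^ (((d + 1 : ℕ) : ℝ) - 1) with hK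
  have hKt : K ≠ ⊤ := ENNReal.rpow_ne_top_of_nonneg hd ENNReal.coe_ne_top
  refine ⟨((d + 1 : ℕ) * (2 * (K.toNNReal * 2 ^ d)) : ℝ≥0), fun x r hr => ?_⟩
  have hsub : {z : Rn (d + 1) | maxNorm z = 1} ∩ Metric.ball x r ⊆
      ⋃ i : Fin (d + 1), ⋃ b : Bool, hyperplane i (if b then 1 else -1) ''
        Metric.ball (i.removeNth (WithLp.ofLp x)) r := by
    rintro z ⟨hz, hzx⟩
    obtain ⟨i, hi⟩ := exists_abs_eq_maxNorm hn z
    rw [show maxNorm z = 1 from hz] at hi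
    have hb : ∃ b : Bool, z i = if b then 1 else -1 := by
      rcases (abs_eq zero_le_one).1 hi with h | h
      · exact ⟨true, by simpa using h⟩
      · exact ⟨false, by simpa using h⟩
    obtain ⟨b, hb⟩ := hb
    refine Set.mem_iUnion₂.2 ⟨i, b, i.removeNth (WithLp.ofLp z), ?_, ?_⟩
    · have h1 : dist (WithLp.ofLp z) (WithLp.ofLp x) < r := by
        have := (PiLp.lipschitzWith_ofLp 2 fun _ : Fin (d + 1) => ℝ).dist_le_mul z x
        rw [NNReal.coe_one, one_mul] at this
        exact this.trans_lt hzx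
      rw [Metric.mem_ball, dist_pi_lt_iff hr]
      exact fun j => (dist_le_pi_dist (WithLp.ofLp z) (WithLp.ofLp x) (i.succAbove j)).trans_lt h1
    · rw [hyperplane, ← hb, Fin.insertNth_self_removeNth]
  refine (measure_mono hsub).trans ((measure_iUnion_le _).trans ?_)
  calc _ ≤ ∑' _ : Fin (d + 1), ∑' _ : Bool, K * ENNReal.ofReal (2 * r) ^ d := by
        refine ENNReal.tsum_le_tsum fun i => (measure_iUnion_le _).trans ?_
        refine ENNReal.tsum_le_tsum fun b => ?_
        refine ((lipschitzWith_hyperplane i _).hausdorffMeasure_image_le hd _).trans ?_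
        rw [hausdorffMeasure_fin, Real.volume_pi_ball _ hr, Fintype.card_fin,
          ENNReal.ofReal_pow (by positivity)]
    _ = _ := by
        rw [ENNReal.ofReal_mul zero_le_two, mul_pow]
        simp only [tsum_fintype, Finset.sum_const, Finset.card_univ, Fintype.card_fin,
          Fintype.card_bool, nsmul_eq_mul, ENNReal.coe_mul, ENNReal.coe_toNNReal hKt,
          ENNReal.coe_pow, ENNReal.coe_natCast, ENNReal.coe_ofNat, ENNReal.ofReal_ofNat,
          Nat.add_sub_cancel, Nat.cast_ofNat]
        ring

/-- Forgetting one coordinate is 1-Lipschitz and maps a face onto a set containing the unit ball of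
`ℝ^{n-1}`. -/
theorem hausdorffMeasure_cube_ne_zero (hn : 0 < n) :
    Measure.hausdorffMeasure ((n : ℝ) - 1) {z : Rn n | maxNorm z = 1} ≠ 0 := by
  obtain ⟨d, rfl⟩ : ∃ d, n = d + 1 := ⟨n - 1, by omega⟩
  have hd : (0 : ℝ) ≤ ((d + 1 : ℕ) : ℝ) - 1 := by simp
  have hf : LipschitzWith 1 fun z : Rn (d + 1) => (0 : Fin (d + 1)).removeNth (WithLp.ofLp z) := by
    refine LipschitzWith.of_dist_le_mul fun z w => ?_
    refine le_trans ?_ ((PiLp.lipschitzWith_ofLp 2 fun _ : Fin (d + 1) => ℝ).dist_le_mul z w)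
    refine (dist_pi_le_iff dist_nonneg).2 fun j => ?_
    exact dist_le_pi_dist (WithLp.ofLp z) (WithLp.ofLp w) _
  have hsub : Metric.ball (0 : Fin d → ℝ) 1 ⊆
      (fun z : Rn (d + 1) => (0 : Fin (d + 1)).removeNth (WithLp.ofLp z)) ''
        {z : Rn (d + 1) | maxNorm z = 1} := by
    intro y hy
    refine ⟨hyperplane 0 1 y, ?_, by simp [hyperplane]⟩
    have hy' : ‖y‖ ≤ 1 := by simpa using (Metric.mem_ball.1 hy).le
    refine le_antisymm ?_ ?_
    · refine (pi_norm_le_iff_of_nonneg zero_le_one).2 fun j => ?_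
      refine Fin.cases ?_ (fun j => ?_) j
      · simp [hyperplane]
      · simpa [hyperplane] using (norm_le_pi_norm y j).trans hy'
    · simpa [hyperplane, maxNorm] using norm_le_pi_norm (WithLp.ofLp (hyperplane 0 1 y)) 0
  intro h0
  have h1 := (measure_mono hsub).trans (hf.hausdorffMeasure_image_le hd _)
  rw [h0, mul_zero, hausdorffMeasure_fin] at h1
  exact (Metric.measure_ball_pos volume (0 : Fin d → ℝ) one_pos).ne' (le_antisymm h1 zero_le)

theorem exists_isSphericalLike_cube (hn : 0 < n) :
    ∃ R M, IsSphericalLike (normalizedHausdorff (frontier (cube (0 : Rn n) 1))) R M := by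
  have hQ : frontier (cube (0 : Rn n) 1) = {z : Rn n | maxNorm z = 1} := by
    simpa using frontier_cube hn 0 one_pos
  obtain ⟨M, hM⟩ := exists_hasUpperGrowth_cube hn
  rw [← hQ] at hM
  refine ⟨normConst n, hM.isSphericalLike isClosed_frontier ?_ ?_⟩
  · rw [hQ]
    intro z hz
    have hz' : maxNorm z = 1 := hz
    simpa [hz'] using norm_le_normConst_mul z
  · rw [hQ]
    exact hausdorffMeasure_cube_ne_zero hn

/-- The radial projection `z ↦ z/‖z‖` from the boundary of the cube to the sphere has inverse `z ↦
z/maxNorm z`, and both are Lipschitz there. The pair carries the growth bound to the sphere; the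
inverse alone shows that the sphere has positive measure. -/
theorem exists_isSphericalLike_sphere (hn : 0 < n) :
    ∃ R M, IsSphericalLike (normalizedHausdorff (Metric.sphere (0 : Rn n) 1)) R M := by
  have hd : (0 : ℝ) ≤ (n : ℝ) - 1 := sub_nonneg.2 (by exact_mod_cast hn)
  obtain ⟨M, hM⟩ := exists_hasUpperGrowth_cube hn
  have hc := normConst_pos hn
  have hmax : ∀ z ∈ Metric.sphere (0 : Rn n) 1, ((normConst n)⁻¹ : ℝ≥0) ≤ maxNorm z := by
    intro z hz
    have hz' : ‖z‖ = 1 := by simpa using hz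
    have := norm_le_normConst_mul z
    rw [hz'] at this
    rw [NNReal.coe_inv]
    exact (inv_le_iff_one_le_mul₀' (by exact_mod_cast hc)).2 this
  have hf := lipschitzOnWith_inv_smul (A := {z : Rn n | maxNorm z = 1}) (B := normConst n) one_pos
    lipschitzWith_one_norm (fun z hz => by
      have hz' : maxNorm z = 1 := hz
      simpa [hz'] using maxNorm_le_norm z) (fun z hz => by
      have hz' : maxNorm z = 1 := hz
      simpa [hz'] using norm_le_normConst_mul z)
  have hg := lipschitzOnWith_inv_smul (A := Metric.sphere (0 : Rn n) 1) (B := 1) (inv_pos.2 hc)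
    lipschitzWith_maxNorm hmax (fun z hz => by simpa using (mem_sphere_zero_iff_norm.1 hz).le)
  have hpos : ∀ z ∈ Metric.sphere (0 : Rn n) 1, 0 < maxNorm z := fun z hz =>
    lt_of_lt_of_le (by exact_mod_cast inv_pos.2 hc) (hmax z hz)
  have hmaps : Set.MapsTo (fun z : Rn n => (maxNorm z)⁻¹ • z) (Metric.sphere 0 1)
      {z : Rn n | maxNorm z = 1} := by
    intro z hz
    have := hpos z hz
    change maxNorm ((maxNorm z)⁻¹ • z) = 1
    rw [maxNorm_smul, abs_of_pos (inv_pos.2 this), inv_mul_cancel₀ this.ne']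
  obtain ⟨M', hM'⟩ := hM.of_lipschitzOnWith hn hf hg hmaps fun z hz => by
    have h1 := hpos z hz
    have h2 : ‖z‖ = 1 := by simpa using hz
    simp only [norm_smul, norm_inv, Real.norm_eq_abs, abs_of_pos h1, h2, mul_one, inv_inv, smul_smul,
      mul_inv_cancel₀ h1.ne', one_smul]
  refine ⟨1, hM'.isSphericalLike Metric.isClosed_sphere Metric.sphere_subset_closedBall fun h0 => ?_⟩
  have hsub : {z : Rn n | maxNorm z = 1} ⊆
      (fun z : Rn n => (maxNorm z)⁻¹ • z) '' Metric.sphere 0 1 := by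
    intro z hz
    have hz' : maxNorm z = 1 := hz
    have hz0 : 0 < ‖z‖ := lt_of_lt_of_le (by rw [hz']; exact one_pos) (maxNorm_le_norm z)
    refine ⟨‖z‖⁻¹ • z, by simp [norm_smul, hz0.ne'], ?_⟩
    simp [maxNorm_smul, hz', smul_smul, hz0.ne']
  have h1 := (measure_mono hsub).trans (hg.hausdorffMeasure_image_le hd)
  rw [h0, mul_zero] at h1
  exact hausdorffMeasure_cube_ne_zero hn (le_antisymm h1 zero_le)

end SphericalLike

end

theorem theorem1p3 (n : ℕ) (hn : 2 ≤ n) :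
    -- the pointwise estimate, with a constant `C` that depends only on `n`
    (∃ C : ℝ, 0 < C ∧
      ∀ (μ : Measure (SphericalLike.Rn n)) (R M : ℝ), SphericalLike.IsSphericalLike μ R M →
      ∀ p : ℝ, 1 < p → p < n →
      ∀ (u : SphericalLike.Rn n → ℝ) (g : SphericalLike.Rn n → SphericalLike.Rn n),
        SphericalLike.IsSobolev p u g →
      ∀ x : SphericalLike.Rn n,
        SphericalLike.maximalOp μ (SphericalLike.preciseRep u) x ≤
          ENNReal.ofReal (C * R ^ (n - 1) * M) *
            (SphericalLike.hardyLittlewood u x + SphericalLike.rieszPotential g x)) ∧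
    -- boundedness from `W^{1,p}` to `L^{p*}`
    (∀ (μ : Measure (SphericalLike.Rn n)) (R M : ℝ), SphericalLike.IsSphericalLike μ R M →
      ∀ p : ℝ, 1 < p → p < n →
        SphericalLike.BoundedSobolevLebesgue p (SphericalLike.maximalOp μ)) ∧
    -- the spherical maximal operator is covered
    ((∃ R M : ℝ, SphericalLike.IsSphericalLike
        (SphericalLike.normalizedHausdorff (Metric.sphere (0 : SphericalLike.Rn n) 1)) R M) ∧
      ∀ v : SphericalLike.Rn n → EReal,
        SphericalLike.maximalOp
          (SphericalLike.normalizedHausdorff (Metric.sphere (0 : SphericalLike.Rn n) 1)) v =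
            SphericalLike.sphericalMaximal v) ∧
    -- averages over boundaries of cubes are covered
    ((∃ R M : ℝ, SphericalLike.IsSphericalLike
        (SphericalLike.normalizedHausdorff
          (frontier (SphericalLike.cube (0 : SphericalLike.Rn n) 1))) R M) ∧
      ∀ v : SphericalLike.Rn n → EReal,
        SphericalLike.maximalOp
          (SphericalLike.normalizedHausdorff
            (frontier (SphericalLike.cube (0 : SphericalLike.Rn n) 1))) v =
            SphericalLike.cubeBoundaryMaximal v) := by
  have hn0 : 0 < n := by omega
  refine ⟨?_, fun μ R M hμ p hp hpn => SphericalLike.boundedSobolevLebesgue_maximalOp hn hμ hp hpn,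
    ⟨SphericalLike.exists_isSphericalLike_sphere hn0, fun v => ?_⟩,
    ⟨SphericalLike.exists_isSphericalLike_cube hn0, fun v => ?_⟩⟩
  · obtain ⟨C, hC, h⟩ := SphericalLike.exists_maximalOp_preciseRep_le hn
    exact ⟨C, hC, fun μ R M hμ p hp _ => h μ R M hμ p hp⟩
  · exact funext fun x => SphericalLike.maximalOp_normalizedHausdorff hn0 Metric.isClosed_sphere
      (fun x t ht => SphericalLike.image_dilation_sphere x ht) v x
  · exact funext fun x => SphericalLike.maximalOp_normalizedHausdorff hn0 isClosed_frontier
      (fun x t ht => SphericalLike.image_dilation_frontier_cube hn0 x ht) v x
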